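/- For a sequence $\vec x=\langle x_n\mid n\in\mathbb N\rangle$ of natural numbers let $$\mathrm{AFS}^2(\vec x)=\Big\{\Big(\sum_{k=k_0}^{k_1}x_k,\ \sum_{k=k_1+1}^{k_2}x_k\Big)\ \Big|\ k_0\le k_1<k_2\Big\}.$$ An instance of $\mathsf{AHT}^2$ is a colouring $c:\mathbb N^2\to\{0,\dots,k-1\}$ with $k$ finite, and a solution to it is an infinite set $Y\subseteq\mathbb N$ such that $c$ is constant on $\mathrm{AFS}^2(\vec y)$, where $\vec y$ is the increasing enumeration of $Y$; $\mathsf{AHT}^2$ is the statement that every instance has a solution. $\mathbb Z\text{-}\mathsf{RT}^3$ is the statement that for every finite $k$ and every colouring $c:[\mathbb N]^3\to\{0,\dots,k-1\}$ of the three-element subsets of $\mathbb N$ with $c(\{x,y,z\})=c(\{x+t,y+t,z+t\})$ for all $\{x,y,z\}\in[\mathbb N]^3$ and $t\in\mathbb N$, there is an infinite $X\subseteq\mathbb N$ such that $c$ is constant on $[X]^3$. Let $\mathsf{RCA}_0$ be the theory in the language of second-order arithmetic that consists of the basic axioms of arithmetic, $\Sigma^0_1$ induction and $\Delta^0_1$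 comprehension, and let $\mathsf{ACA}_0$ consist of the basic axioms, the induction axiom for sets and arithmetical comprehension. Then: 1. There is a computable colouring $c:\mathbb N^2\to\{0,1,2,3\}$, that is, a computable instance of $\mathsf{AHT}^2$ with four colours, such that every solution to $c$ computes the halting set $0'$. 2. Over $\mathsf{RCA}_0$, the statements $\mathsf{AHT}^2$ and $\mathbb Z\text{-}\mathsf{RT}^3$ are equivalent, and each of them implies $\mathsf{ACA}_0$: every axiom of $\mathsf{ACA}_0$ is a consequence of $\mathsf{RCA}_0+\mathsf{AHT}^2$, and of $\mathsf{RCA}_0+\mathbb Z\text{-}\mathsf{RT}^3$. -/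

import Mathlib

universe u

/-! ## Computability: two-dimensional adjacent sums and the halting set -/

namespace AdjacentHindman

/-- The set of adjacent pairs of adjacent finite sums of the sequence `x`. -/
def AFS2 (x : ℕ → ℕ) : Set (ℕ × ℕ) :=
  {p | ∃ k₀ k₁ k₂ : ℕ, k₀ ≤ k₁ ∧ k₁ < k₂ ∧
    p = (∑ k ∈ Finset.Icc k₀ k₁, x k, ∑ k ∈ Finset.Icc (k₁ + 1) k₂, x k)}

/-- `Y` is a solution to the instance `c`: it is infinite, and `c` is constant on the adjacent
pairs of adjacent sums of the increasing enumeration of `Y`. -/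
def IsSolution {κ : Type*} (c : ℕ → ℕ → κ) (Y : Set ℕ) : Prop :=
  Y.Infinite ∧ ∃ i : κ, ∀ p ∈ AFS2 (Nat.nth (· ∈ Y)), c p.1 p.2 = i

open Classical in
/-- The characteristic function of a set of natural numbers, as an oracle. -/
noncomputable def charFun (A : Set ℕ) : ℕ →. ℕ :=
  fun n => Part.some (if n ∈ A then 1 else 0)

/-- The halting set: the `e` such that the `e`-th program halts on input `e`. -/
def haltingSet : Set ℕ :=
  {e | (Nat.Partrec.Code.eval (Denumerable.ofNat Nat.Partrec.Code e) e).Dom}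

/-- The set `B` computes the set `A`. -/
def Computes (B A : Set ℕ) : Prop :=
  TuringReducible (charFun A) (charFun B)

end AdjacentHindman

/-! ## Second-order arithmetic -/

namespace SecondOrderArith

/-- Number terms; number variables are named by natural numbers. -/
inductive Term : Type
  | var (x : ℕ)
  | zero
  | one
  | add (s t : Term)
  | mul (s t : Term)

namespace Term

instance : Zero Term := ⟨Term.zero⟩
instance : One Term := ⟨Term.one⟩
instance : Add Term := ⟨Term.add⟩
instance : Mul Term := ⟨Term.mul⟩

/-- The number variable `x` occurs in the term. -/
def Occurs (x : ℕ) : Term → Prop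
  | var y => x = y
  | zero => False
  | one => False
  | add s t => Occurs x s ∨ Occurs x t
  | mul s t => Occurs x s ∨ Occurs x t

/-- The pairing `⟨s, t⟩ = (s + t)² + s`. -/
def pair (s t : Term) : Term := (s + t) * (s + t) + s

end Term

/-- Formulas of the two-sorted language of second-order arithmetic. Number variables and set
variables are separately named by natural numbers. -/
inductive Formula : Type
  | eq (s t : Term)
  | lt (s t : Term)
  | mem (t : Term) (X : ℕ)
  | neg (φ : Formula)
  | and (φ ψ : Formula)
  | all (x : ℕ) (φ : Formula)
  | allSet (X : ℕ) (φ : Formula)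

namespace Formula

def or (φ ψ : Formula) : Formula := neg (and (neg φ) (neg ψ))

def imp (φ ψ : Formula) : Formula := neg (and φ (neg ψ))

def iff (φ ψ : Formula) : Formula := and (imp φ ψ) (imp ψ φ)

/-- Existential number quantifier. -/
def ex (x : ℕ) (φ : Formula) : Formula := neg (all x (neg φ))

/-- Existential set quantifier. -/
def exSet (X : ℕ) (φ : Formula) : Formula := neg (allSet X (neg φ))

/-- Universal quantification over a list of number variables. -/
def alls (xs : List ℕ) (φ : Formula) : Formula := xs.foldr all φ

/-- Existential quantification over a list of number variables. -/
def exs (xs : List ℕ) (φ : Formula) : Formula := xs.foldr ex φ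

def le (s t : Term) : Formula := or (lt s t) (eq s t)

/-- The number variable `x` occurs free. -/
def NumFree (x : ℕ) : Formula → Prop
  | eq s t => s.Occurs x ∨ t.Occurs x
  | lt s t => s.Occurs x ∨ t.Occurs x
  | mem t _ => t.Occurs x
  | neg φ => NumFree x φ
  | and φ ψ => NumFree x φ ∨ NumFree x ψ
  | all y φ => x ≠ y ∧ NumFree x φ
  | allSet _ φ => NumFree x φ

/-- The set variable `X` occurs free. -/
def SetFree (X : ℕ) : Formula → Prop
  | eq _ _ => False
  | lt _ _ => False
  | mem _ Y => X = Y
  | neg φ => SetFree X φ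
  | and φ ψ => SetFree X φ ∨ SetFree X ψ
  | all _ φ => SetFree X φ
  | allSet Y φ => X ≠ Y ∧ SetFree X φ

/-- Bounded quantifier (`Σ⁰₀`) formulas. Bounded existential quantifiers arise from
`∀ x < t` by negation. -/
inductive IsBounded : Formula → Prop
  | eq (s t : Term) : IsBounded (eq s t)
  | lt (s t : Term) : IsBounded (lt s t)
  | mem (t : Term) (X : ℕ) : IsBounded (mem t X)
  | neg {φ : Formula} : IsBounded φ → IsBounded (neg φ)
  | and {φ ψ : Formula} : IsBounded φ → IsBounded ψ → IsBounded (and φ ψ)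
  | ball {x : ℕ} {t : Term} {φ : Formula} : ¬ t.Occurs x → IsBounded φ →
      IsBounded (all x (imp (lt (.var x) t) φ))

/-- `Σ⁰₁` formulas: `∃ x θ` with `θ` bounded. -/
def IsSigma01 (φ : Formula) : Prop := ∃ x θ, IsBounded θ ∧ φ = ex x θ

/-- `Π⁰₁` formulas: `∀ x θ` with `θ` bounded. -/
def IsPi01 (φ : Formula) : Prop := ∃ x θ, IsBounded θ ∧ φ = all x θ

/-- Arithmetical formulas: no set quantifiers, free set variables allowed. -/
def IsArithmetical : Formula → Prop
  | eq _ _ => True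
  | lt _ _ => True
  | mem _ _ => True
  | neg φ => IsArithmetical φ
  | and φ ψ => IsArithmetical φ ∧ IsArithmetical ψ
  | all _ φ => IsArithmetical φ
  | allSet _ _ => False

end Formula

/-! ### Semantics -/

/-- A (Henkin) structure: an arbitrary, possibly nonstandard, first-order part, together with a
nonempty collection of subsets of it over which the set quantifiers range. -/
structure Model : Type (u + 1) where
  Num : Type u
  zero : Num
  one : Num
  add : Num → Num → Num
  mul : Num → Num → Num
  lt : Num → Num → Prop
  Sets : Set (Set Num)
  sets_nonempty : Sets.Nonempty

namespace Model

variable (M : Model.{u})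

/-- The value of a term under an assignment of the number variables. -/
def eval (v : ℕ → M.Num) : Term → M.Num
  | .var x => v x
  | .zero => M.zero
  | .one => M.one
  | .add s t => M.add (eval v s) (eval v t)
  | .mul s t => M.mul (eval v s) (eval v t)

/-- Satisfaction of a formula under assignments of the number and the set variables. -/
def Sat : (ℕ → M.Num) → (ℕ → M.Sets) → Formula → Prop
  | v, _, .eq s t => M.eval v s = M.eval v t
  | v, _, .lt s t => M.lt (M.eval v s) (M.eval v t)
  | v, w, .mem t X => M.eval v t ∈ (w X : Set M.Num)
  | v, w, .neg φ => ¬ Sat v w φ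
  | v, w, .and φ ψ => Sat v w φ ∧ Sat v w ψ
  | v, w, .all x φ => ∀ a : M.Num, Sat (Function.update v x a) w φ
  | v, w, .allSet X φ => ∀ A : M.Sets, Sat v (Function.update w X A) φ

/-- A formula is true in `M` if its universal closure is, i.e. if it is satisfied under all
assignments. -/
def Models (φ : Formula) : Prop := ∀ v w, M.Sat v w φ

end Model

/-- `T` entails `φ`: every model of `T` is a model of `φ`. Since arbitrary Henkin models are
allowed, this is provability of `φ` from `T`. -/
def Entails (T : Set Formula) (φ : Formula) : Prop :=
  ∀ M : Model.{u}, (∀ ψ ∈ T, M.Models ψ) → M.Models φ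

/-! ### The axiom systems -/

open Formula

/-- Abbreviation for number variables. -/
abbrev nv (x : ℕ) : Term := Term.var x

/-- The basic axioms of arithmetic. -/
def basicAxioms : Set Formula :=
  { neg (eq (nv 0 + 1) 0),
    imp (eq (nv 0 + 1) (nv 1 + 1)) (eq (nv 0) (nv 1)),
    eq (nv 0 + 0) (nv 0),
    eq (nv 0 + (nv 1 + 1)) ((nv 0 + nv 1) + 1),
    eq (nv 0 * 0) 0,
    eq (nv 0 * (nv 1 + 1)) (nv 0 * nv 1 + nv 0),
    neg (lt (nv 0) 0),
    iff (lt (nv 0) (nv 1 + 1)) (or (lt (nv 0) (nv 1)) (eq (nv 0) (nv 1))) }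

/-- `φ(t)` for the formula `φ(x)`, written as `∀ x (x = t → φ(x))`; used only when `x` does not
occur in `t` and the variables of `t` are not free in `φ`. -/
def atTerm (x : ℕ) (t : Term) (φ : Formula) : Formula := all x (imp (eq (nv x) t) φ)

/-- Induction for `φ(x)`: `φ(0) ∧ ∀ y (φ(y) → φ(y + 1)) → ∀ x φ(x)`. -/
def inductionFor (x y : ℕ) (φ : Formula) : Formula :=
  imp (and (atTerm x 0 φ) (all y (imp (atTerm x (nv y) φ) (atTerm x (nv y + 1) φ)))) (all x φ)

/-- Comprehension for `φ(x)`: `∃ X ∀ x (x ∈ X ↔ φ(x))`. -/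
def comprehensionFor (x X : ℕ) (φ : Formula) : Formula :=
  exSet X (all x (iff (mem (nv x) X) φ))

/-- `Σ⁰₁` induction, with number and set parameters. -/
def sigma01Induction : Set Formula :=
  {χ | ∃ (φ : Formula) (x y : ℕ), IsSigma01 φ ∧ y ≠ x ∧ ¬ NumFree y φ ∧ χ = inductionFor x y φ}

/-- `Δ⁰₁` comprehension, with number and set parameters. -/
def delta01Comprehension : Set Formula :=
  {χ | ∃ (φ ψ : Formula) (x X : ℕ), IsSigma01 φ ∧ IsPi01 ψ ∧ ¬ SetFree X φ ∧
    χ = imp (all x (iff φ ψ)) (comprehensionFor x X φ)}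

/-- Arithmetical comprehension, with number and set parameters. -/
def arithmeticalComprehension : Set Formula :=
  {χ | ∃ (φ : Formula) (x X : ℕ), IsArithmetical φ ∧ ¬ SetFree X φ ∧
    χ = comprehensionFor x X φ}

/-- The single induction axiom `0 ∈ X ∧ ∀ n (n ∈ X → n + 1 ∈ X) → ∀ n (n ∈ X)`. -/
def inductionAxiom : Formula :=
  imp (and (mem 0 0) (all 0 (imp (mem (nv 0) 0) (mem (nv 0 + 1) 0)))) (all 0 (mem (nv 0) 0))

def RCA₀ : Set Formula := basicAxioms ∪ sigma01Induction ∪ delta01Comprehension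

def ACA₀ : Set Formula := basicAxioms ∪ {inductionAxiom} ∪ arithmeticalComprehension

/-! ### The combinatorial principles

The auxiliary formulas below have only set variables as parameters (with the exception of the
number of colours, which is always the number variable `0`), so no variable is captured. -/

/-- `X` is infinite, i.e. unbounded. -/
def isInfinite (X : ℕ) : Formula := all 1 (ex 2 (and (lt (nv 1) (nv 2)) (mem (nv 2) X)))

/-- `F` is (the graph of) a function from numbers to numbers. -/
def isFunction (F : ℕ) : Formula :=
  and (all 1 (imp (mem (nv 1) F) (exs [2, 3] (eq (nv 1) ((nv 2).pair (nv 3))))))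
    (all 1 (ex 2 (and (mem ((nv 1).pair (nv 2)) F)
      (all 3 (imp (mem ((nv 1).pair (nv 3)) F) (eq (nv 3) (nv 2)))))))

/-- `F` is the increasing enumeration of `Y`. -/
def isIncreasingEnumeration (F Y : ℕ) : Formula :=
  and (isFunction F) (and
    (alls [1, 2, 3, 4] (imp (and (lt (nv 1) (nv 2))
        (and (mem ((nv 1).pair (nv 3)) F) (mem ((nv 2).pair (nv 4)) F)))
      (lt (nv 3) (nv 4))))
    (all 1 (iff (mem (nv 1) Y) (ex 2 (mem ((nv 2).pair (nv 1)) F)))))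

/-- `G` is the function of partial sums of the function `F`:
`G(0) = 0` and `G(n + 1) = G(n) + F(n)`, that is, `G(n) = ∑ k < n, F(k)`. -/
def isPartialSums (G F : ℕ) : Formula :=
  and (isFunction G) (and (mem (Term.pair 0 0) G)
    (alls [1, 2, 3] (imp (and (mem ((nv 1).pair (nv 2)) G) (mem ((nv 1).pair (nv 3)) F))
      (mem ((nv 1 + 1).pair (nv 2 + nv 3)) G))))

/-- `C` is a colouring of the pairs of numbers with colours `< k`, where `k` is the number
variable `0`; the colour of `(x, y)` is the `i` with `⟨⟨x, y⟩, i⟩ ∈ C`. -/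
def isColouringOfPairs (C : ℕ) : Formula :=
  and (all 1 (imp (mem (nv 1) C) (exs [2, 3, 4]
      (and (lt (nv 4) (nv 0)) (eq (nv 1) (((nv 2).pair (nv 3)).pair (nv 4)))))))
    (alls [1, 2] (ex 3 (and (mem (((nv 1).pair (nv 2)).pair (nv 3)) C)
      (all 4 (imp (mem (((nv 1).pair (nv 2)).pair (nv 4)) C) (eq (nv 4) (nv 3)))))))

/-- `C` is a colouring of the three-element sets of numbers, represented as triples
`x < y < z`, with colours `< k`, where `k` is the number variable `0`; the colour of `{x, y, z}` is
the `i` with `⟨⟨⟨x, y⟩, z⟩, i⟩ ∈ C`. -/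
def isColouringOfTriples (C : ℕ) : Formula :=
  and (all 1 (imp (mem (nv 1) C) (exs [2, 3, 4, 5]
      (and (and (lt (nv 2) (nv 3)) (lt (nv 3) (nv 4))) (and (lt (nv 5) (nv 0))
        (eq (nv 1) ((((nv 2).pair (nv 3)).pair (nv 4)).pair (nv 5))))))))
    (alls [1, 2, 3] (imp (and (lt (nv 1) (nv 2)) (lt (nv 2) (nv 3)))
      (ex 4 (and (mem ((((nv 1).pair (nv 2)).pair (nv 3)).pair (nv 4)) C)
        (all 5 (imp (mem ((((nv 1).pair (nv 2)).pair (nv 3)).pair (nv 5)) C)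
          (eq (nv 5) (nv 4))))))))

/-- The colouring `C` of triples is invariant under translation. -/
def isTranslationInvariant (C : ℕ) : Formula :=
  alls [1, 2, 3, 4, 5] (imp (and (lt (nv 1) (nv 2)) (lt (nv 2) (nv 3)))
    (iff (mem ((((nv 1).pair (nv 2)).pair (nv 3)).pair (nv 5)) C)
      (mem ((((nv 1 + nv 4).pair (nv 2 + nv 4)).pair (nv 3 + nv 4)).pair (nv 5)) C)))

/-- Some colour `i < k` is the colour under `C` of all adjacent pairs of adjacent sums of the
sequence whose partial sums are `G`: for all `k₀ ≤ k₁ < k₂`, if `p = G(k₁ + 1) - G(k₀)` and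
`q = G(k₂ + 1) - G(k₁ + 1)` then `(p, q)` has colour `i`. Variables: `k = 0`, `i = 1`,
`k₀, k₁, k₂ = 2, 3, 4`, the three values of `G` are `5, 6, 7`, and `p, q = 8, 9`. -/
def isMonochromaticAFS2 (C G : ℕ) : Formula :=
  ex 1 (and (lt (nv 1) (nv 0)) (alls [2, 3, 4, 5, 6, 7, 8, 9] (imp
    (and (and (le (nv 2) (nv 3)) (lt (nv 3) (nv 4))) (and
      (and (mem ((nv 2).pair (nv 5)) G)
        (and (mem ((nv 3 + 1).pair (nv 6)) G) (mem ((nv 4 + 1).pair (nv 7)) G)))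
      (and (eq (nv 5 + nv 8) (nv 6)) (eq (nv 6 + nv 9) (nv 7)))))
    (mem (((nv 8).pair (nv 9)).pair (nv 1)) C))))

/-- The two-dimensional adjacent Hindman theorem, for all finite numbers `k` of colours. The
set variables are: the colouring `0`, the solution `1`, its increasing enumeration `2`, and the
partial sums `3` of the latter. -/
def AHT2 : Formula :=
  all 0 (allSet 0 (imp (isColouringOfPairs 0)
    (exSet 1 (and (isInfinite 1) (exSet 2 (and (isIncreasingEnumeration 2 1)
      (exSet 3 (and (isPartialSums 3 2) (isMonochromaticAFS2 0 3)))))))))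

/-- The Ramsey theorem for triples, for translation invariant colourings with any finite number
`k` of colours. -/
def ZRT3 : Formula :=
  all 0 (allSet 0 (imp (and (isColouringOfTriples 0) (isTranslationInvariant 0))
    (exSet 1 (and (isInfinite 1) (ex 1 (and (lt (nv 1) (nv 0)) (alls [2, 3, 4] (imp
      (and (and (lt (nv 2) (nv 3)) (lt (nv 3) (nv 4)))
        (and (mem (nv 2) 1) (and (mem (nv 3) 1) (mem (nv 4) 1))))
      (mem ((((nv 2).pair (nv 3)).pair (nv 4)).pair (nv 1)) 0)))))))))

end SecondOrderArith

/-!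
Adjacent finite sums of a sequence are adjacent gaps of its set of partial sums, so both principles
speak about infinite sets `X` and colourings of the pairs `(b - a, c - b)` with `a < b < c` in `X`;
conversely, after thinning `X` its consecutive gaps increase and enumerate a solution.

To code an enumerated set `A` with stages `E s`, colour `(p, q)` by two bits: whether `v p < v q`
for the 2-adic valuation `v`, and whether `E p` and `E q` agree below `v p`. If the colour is
constant on the gaps of `X`, the first bit says *yes*: otherwise all gaps past one of least
valuation would have the same valuation, but the sum of two adjacent ones has a larger valuation.
Adding a later gap to `p` therefore preserves `v p`, so `p` and `q` can be taken beyond the stage at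
which `E` has settled below `v p`; hence the second bit says *agree* as well, and every gap `p`
knows `A` correctly below `v p`. As `v p` is unbounded, `X` computes `A`.

In a model of `RCA₀` the same colouring of a `Σ⁰₁` set, with the largest power of two dividing `p`
in place of `v p`, gives `Σ⁰₁` comprehension, which removes one quantifier of an arithmetical
formula at a time. Bounded definability and primitive recursion inside the model are what this
argument needs: colouring and solution are then sets of the model.
-/

namespace AdjacentHindman

section JumpColour

/-- The two laws of the 2-adic valuation that the argument needs. They are shared by the valuation
of natural numbers and, in a model of arithmetic, by the largest power of two dividing a number. -/
structure IsDyadic {α β : Type*} [Zero α] [Add α] [LT β] (v : α → β) : Prop where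
  map_add_of_lt {p q : α} : p ≠ 0 → q ≠ 0 → v p < v q → v (p + q) = v p
  lt_map_add_of_eq {p q : α} : p ≠ 0 → q ≠ 0 → v p = v q → v p < v (p + q)

/-- The approximations `E p` and `E q` of an enumerated set agree below `v p`; here `E s x` says
that `x` is enumerated by stage `s`. -/
def Agree {α β : Type*} [LT β] (v : α → β) (E : α → β → Prop) (p q : α) : Prop :=
  ∀ x, x < v p → (E p x ↔ E q x)

open Classical in
/-- The colouring of pairs that codes the two bits `v p < v q` and `Agree v E p q`. -/
noncomputable def jumpColour {α β : Type*} [LT β] (v : α → β) (E : α → β → Prop) (p q : α) :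
    Fin 4 :=
  if v p < v q then (if Agree v E p q then 0 else 1) else (if Agree v E p q then 2 else 3)

/-- The colour of the gaps `b - a`, `c - b` of three elements `a < b < c` of `X` is always `i`. -/
def GapHomogeneous {α κ : Type*} [LT α] [Sub α] (d : α → α → κ) (X : Set α) (i : κ) : Prop :=
  ∀ a ∈ X, ∀ b ∈ X, ∀ c ∈ X, a < b → b < c → d (b - a) (c - b) = i

/-- Some gap `b - a` between two elements `a < b` of `X` has the least value under `v`. In a model
of arithmetic this is not automatic, and it replaces an infinite descent. -/
def HasMinimalGap {α β : Type*} [LT α] [Sub α] [LE β] (v : α → β) (X : Set α) : Prop :=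
  ∃ a ∈ X, ∃ b ∈ X, a < b ∧ ∀ a' ∈ X, ∀ b' ∈ X, a' < b' → v (b - a) ≤ v (b' - a')

section

variable {α β : Type*} [LT β] {v : α → β} {E : α → β → Prop} {p q p' q' : α}

theorem lt_iff_of_jumpColour_eq (h : jumpColour v E p q = jumpColour v E p' q') :
    v p < v q ↔ v p' < v q' := by
  unfold jumpColour at h
  split_ifs at h <;> simp_all

theorem agree_iff_of_jumpColour_eq (h : jumpColour v E p q = jumpColour v E p' q') :
    Agree v E p q ↔ Agree v E p' q' := by
  unfold jumpColour at h
  split_ifs at h <;> simp_all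

end

variable {α β : Type*} [AddCommMonoid α] [LinearOrder α] [CanonicallyOrderedAdd α] [Sub α]
  [OrderedSub α] [LinearOrder β] {v : α → β} {E : α → β → Prop} {X : Set α} {i : Fin 4}

theorem IsDyadic.map_sub_lt_map_sub (hv : IsDyadic v) (hX : ∀ a, ∃ b ∈ X, a < b)
    (hhom : GapHomogeneous (jumpColour v E) X i) (hmin : HasMinimalGap v X)
    {a b c : α} (ha : a ∈ X) (hb : b ∈ X) (hc : c ∈ X) (hab : a < b) (hbc : b < c) :
    v (b - a) < v (c - b) := by
  by_contra hnot
  have antitone : ∀ a' ∈ X, ∀ b' ∈ X, ∀ c' ∈ X, a' < b' → b' < c' → v (c' - b') ≤ v (b' - a') :=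
    fun a' ha' b' hb' c' hc' hab' hbc' => not_lt.1 <| mt (lt_iff_of_jumpColour_eq <|
      (hhom a' ha' b' hb' c' hc' hab' hbc').trans (hhom a ha b hb c hc hab hbc).symm).1 hnot
  -- Past a gap of least valuation all gaps have that valuation, but a sum of two has a larger one.
  obtain ⟨p, hp, q, hq, hpq, least⟩ := hmin
  obtain ⟨r, hr, hqr⟩ := hX q
  obtain ⟨s, hs, hrs⟩ := hX r
  have hr_eq : v (r - q) = v (q - p) :=
    (antitone p hp q hq r hr hpq hqr).antisymm (least q hq r hr hqr)
  have hs_eq : v (s - r) = v (q - p) :=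
    ((antitone q hq r hr s hs hqr hrs).trans hr_eq.le).antisymm (least r hr s hs hrs)
  have hlt := hv.lt_map_add_of_eq (tsub_pos_of_lt hqr).ne' (tsub_pos_of_lt hrs).ne'
    (hr_eq.trans hs_eq.symm)
  rw [add_comm, tsub_add_tsub_cancel hrs.le hqr.le, hr_eq] at hlt
  exact hlt.not_ge (antitone p hp q hq s hs hpq (hqr.trans hrs))

variable [AddLeftReflectLE α]

theorem exists_mem_le_sub (hX : ∀ a, ∃ b ∈ X, a < b) (a s : α) : ∃ b ∈ X, a < b ∧ s ≤ b - a := by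
  obtain ⟨b, hb, hab⟩ := hX (a + s)
  exact ⟨b, hb, le_self_add.trans_lt hab, le_tsub_of_add_le_left hab.le⟩

theorem IsDyadic.agree_sub_sub (hv : IsDyadic v) (hX : ∀ a, ∃ b ∈ X, a < b)
    (hhom : GapHomogeneous (jumpColour v E) X i) (hmin : HasMinimalGap v X)
    (hE : Monotone E) (hsettle : ∀ m, ∃ s, ∀ x, x < m → (∃ r, E r x) → E s x)
    {a b c : α} (ha : a ∈ X) (hb : b ∈ X) (hc : c ∈ X) (hab : a < b) (hbc : b < c) :
    Agree v E (b - a) (c - b) := by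
  -- By homogeneity a single triple suffices: one whose two gaps exceed a stage at which the
  -- enumeration has settled below `v (b - a)`.
  obtain ⟨s, hs⟩ := hsettle (v (b - a))
  have settled : ∀ t, s ≤ t → ∀ x, x < v (b - a) → (E t x ↔ ∃ r, E r x) := fun t hst x hx =>
    ⟨fun h => ⟨t, h⟩, fun h => hE hst x (hs x hx h)⟩
  obtain ⟨p, hp, hbp, hsp⟩ := exists_mem_le_sub hX b s
  obtain ⟨q, hq, hpq, hsq⟩ := exists_mem_le_sub hX p s
  have hap : v (p - a) = v (b - a) := by
    rw [← tsub_add_tsub_cancel hbp.le hab.le, add_comm]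
    exact hv.map_add_of_lt (tsub_pos_of_lt hab).ne' (tsub_pos_of_lt hbp).ne'
      (hv.map_sub_lt_map_sub hX hhom hmin ha hb hp hab hbp)
  refine (agree_iff_of_jumpColour_eq <| (hhom a ha p hp q hq (hab.trans hbp) hpq).trans
    (hhom a ha b hb c hc hab hbc).symm).1 fun x hx => ?_
  rw [hap] at hx
  rw [settled _ (hsp.trans (tsub_le_tsub_left hab.le p)) x hx, settled _ hsq x hx]

theorem IsDyadic.approx_sub_iff (hv : IsDyadic v) (hX : ∀ a, ∃ b ∈ X, a < b)
    (hhom : GapHomogeneous (jumpColour v E) X i) (hmin : HasMinimalGap v X)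
    (hE : Monotone E) (hsettle : ∀ m, ∃ s, ∀ x, x < m → (∃ r, E r x) → E s x)
    {a b : α} (ha : a ∈ X) (hb : b ∈ X) (hab : a < b) {x : β} (hx : x < v (b - a)) :
    E (b - a) x ↔ ∃ s, E s x := by
  refine ⟨fun h => ⟨_, h⟩, fun ⟨s, hs⟩ => ?_⟩
  obtain ⟨c, hc, hbc, hsc⟩ := exists_mem_le_sub hX b s
  exact (hv.agree_sub_sub hX hhom hmin hE hsettle ha hb hc hab hbc x hx).2 (hE hsc x hs)

end JumpColour

section HaltingSet

open Nat.Partrec (Code)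

theorem isDyadic_padicValNat : IsDyadic (padicValNat 2) where
  map_add_of_lt {p q} hp hq h := by
    have dvd_add_iff : 2 ^ (padicValNat 2 p + 1) ∣ p + q ↔ 2 ^ (padicValNat 2 p + 1) ∣ p :=
      (Nat.dvd_add_iff_left ((padicValNat_dvd_iff_le hq).2 h)).symm
    rw [padicValNat_dvd_iff_le hp, padicValNat_dvd_iff_le (by omega)] at dvd_add_iff
    have := (padicValNat_dvd_iff_le (p := 2) (by omega)).1 <|
      dvd_add ((padicValNat_dvd_iff_le hp).2 le_rfl) ((padicValNat_dvd_iff_le hq).2 h.le)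
    omega
  lt_map_add_of_eq {p q} hp hq h := by
    have exists_odd : ∀ {r}, r ≠ 0 → ∃ a, r = 2 ^ padicValNat 2 r * (2 * a + 1) := fun {r} hr => by
      obtain ⟨b, hb⟩ := pow_padicValNat_dvd (p := 2) (n := r)
      rcases Nat.even_or_odd' b with ⟨a, rfl | rfl⟩
      · refine absurd ⟨a, ?_⟩ (pow_succ_padicValNat_not_dvd (p := 2) hr)
        rw [pow_succ, mul_assoc]
        exact hb
      · exact ⟨a, hb⟩
    obtain ⟨a, ha⟩ := exists_odd hp
    obtain ⟨b, hb⟩ := exists_odd hq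
    refine Nat.lt_of_succ_le <| (padicValNat_dvd_iff_le (by omega)).1 ⟨a + b + 1, ?_⟩
    nth_rw 1 [ha, hb]
    rw [← h, Nat.succ_eq_add_one, pow_succ]
    ring

theorem primrec_padicValNat_two : Primrec (padicValNat 2) := by
  have hpow : Primrec₂ ((· ^ ·) : ℕ → ℕ → ℕ) := Primrec₂.unpaired'.1 Nat.Primrec.pow
  have hdvd : PrimrecRel fun n k : ℕ => n ≠ 0 ∧ 2 ^ k ∣ n :=
    (Primrec.eq.comp Primrec.fst (Primrec.const 0)).not.and <|
      PrimrecPred.of_eq (Primrec.eq.comp (Primrec.nat_mod.comp Primrec.fst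
        (hpow.comp (Primrec.const 2) Primrec.snd)) (Primrec.const 0))
        fun _ => (Nat.dvd_iff_mod_eq_zero).symm
  refine (Primrec.nat_findGreatest Primrec.id hdvd).of_eq fun n => ?_
  rcases eq_or_ne n 0 with rfl | hn
  · simp
  have hle : padicValNat 2 n ≤ n := Nat.lt_two_pow_self.le.trans
    (Nat.le_of_dvd (Nat.pos_of_ne_zero hn) pow_padicValNat_dvd)
  refine Nat.findGreatest_eq_iff.2 ⟨hle, fun _ => ⟨hn, pow_padicValNat_dvd⟩, fun k hk _ h => ?_⟩
  exact hk.not_ge ((padicValNat_dvd_iff_le hn).1 h.2)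

/-- The `e`-th program halts on input `e` within `s` steps. -/
def HaltsWithin (s e : ℕ) : Prop := ((Denumerable.ofNat Code e).evaln s e).isSome

theorem monotone_haltsWithin : Monotone HaltsWithin := fun _ _ hst _ hs =>
  have ⟨x, hx⟩ := Option.isSome_iff_exists.1 hs
  Option.isSome_iff_exists.2 ⟨x, Code.evaln_mono hst hx⟩

theorem mem_haltingSet_iff {e : ℕ} : e ∈ haltingSet ↔ ∃ s, HaltsWithin s e := by
  simp only [haltingSet, Set.mem_ofPred_eq, Part.dom_iff_mem, HaltsWithin, Option.isSome_iff_exists,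
    ← Option.mem_def, Code.evaln_complete]
  exact exists_comm

theorem exists_stage_haltsWithin (m : ℕ) :
    ∃ s, ∀ e, e < m → (∃ r, HaltsWithin r e) → HaltsWithin s e := by
  choose! r hr using fun e (h : ∃ r, HaltsWithin r e) => h
  exact ⟨(Finset.range m).sup r, fun e he h =>
    monotone_haltsWithin (Finset.le_sup (Finset.mem_range.2 he)) e (hr e h)⟩

theorem primrecRel_haltsWithin : PrimrecRel HaltsWithin :=
  Primrec.eq.comp (Primrec.option_isSome.comp (Code.primrec_evaln.comp
    ((Primrec.fst.pair ((Primrec.ofNat Code).comp Primrec.snd)).pair Primrec.snd)))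
    (Primrec.const true)

theorem primrecRel_agree {v : ℕ → ℕ} {E : ℕ → ℕ → Prop} (hv : Primrec v) (hE : PrimrecRel E) :
    PrimrecRel (Agree v E) := by
  have hiff : PrimrecRel fun (x : ℕ) (r : ℕ × ℕ) => E r.1 x ↔ E r.2 x := by
    have h₁ : PrimrecPred fun a : ℕ × (ℕ × ℕ) => E a.2.1 a.1 :=
      hE.comp (Primrec.fst.comp Primrec.snd) Primrec.fst
    have h₂ : PrimrecPred fun a : ℕ × (ℕ × ℕ) => E a.2.2 a.1 :=
      hE.comp (Primrec.snd.comp Primrec.snd) Primrec.fst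
    exact ((h₁.and h₂).or (h₁.not.and h₂.not)).of_eq fun _ => iff_iff_and_or_not_and_not.symm
  exact (hiff.forall_mem_list.comp (Primrec.list_range.comp (hv.comp Primrec.fst))
    Primrec.id).of_eq fun r => by simp [Agree]

theorem primrec_jumpColour {v : ℕ → ℕ} {E : ℕ → ℕ → Prop} (hv : Primrec v) (hE : PrimrecRel E) :
    Primrec₂ (jumpColour v E) := by
  classical
  have hagree := primrecRel_agree hv hE
  have hlt := Primrec.nat_lt.comp (hv.comp Primrec.fst) (hv.comp Primrec.snd)
  exact (Primrec.ite hlt (Primrec.ite hagree (Primrec.const (0 : Fin 4)) (Primrec.const 1))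
    (Primrec.ite hagree (Primrec.const 2) (Primrec.const 3))).of_eq
    fun _ => by simp only [jumpColour]; congr

/-- The sum of the `n` least elements of `Y`. -/
noncomputable def partialSum (Y : Set ℕ) (n : ℕ) : ℕ := ∑ k ∈ Finset.range n, Nat.nth (· ∈ Y) k

section PartialSum

variable {Y : Set ℕ}

theorem partialSum_succ (n : ℕ) : partialSum Y (n + 1) = partialSum Y n + Nat.nth (· ∈ Y) n :=
  Finset.sum_range_succ _ n

theorem monotone_partialSum : Monotone (partialSum Y) :=
  monotone_nat_of_le_succ fun n => (partialSum_succ n).symm ▸ Nat.le_add_right _ _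

theorem partialSum_succ_lt (hY : Y.Infinite) (n : ℕ) :
    partialSum Y (n + 1) < partialSum Y (n + 2) := by
  have : n + 1 ≤ Nat.nth (· ∈ Y) (n + 1) := (Nat.nth_strictMono hY).le_apply
  rw [partialSum_succ (n + 1)]
  omega

theorem sum_Icc_nth_eq_sub {m n : ℕ} (h : m ≤ n) :
    ∑ k ∈ Finset.Icc m n, Nat.nth (· ∈ Y) k = partialSum Y (n + 1) - partialSum Y m := by
  rw [partialSum, partialSum, ← Finset.sum_range_add_sum_Ico _ (Nat.le_add_right_of_le h),
    Nat.add_sub_cancel_left]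
  rfl

theorem exists_lt_partialSum (hY : Y.Infinite) (a : ℕ) :
    ∃ b ∈ Set.range (partialSum Y), a < b := by
  have hmono : StrictMono fun n => partialSum Y (n + 1) :=
    strictMono_nat_of_lt_succ (partialSum_succ_lt hY)
  exact ⟨_, ⟨a + 2, rfl⟩, Nat.lt_of_succ_le (hmono.le_apply (x := a + 1))⟩

theorem IsSolution.exists_gapHomogeneous {κ : Type*} {d : ℕ → ℕ → κ} (h : IsSolution d Y) :
    ∃ i, GapHomogeneous d (Set.range (partialSum Y)) i := by
  obtain ⟨-, i, hi⟩ := h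
  refine ⟨i, ?_⟩
  rintro _ ⟨k, rfl⟩ _ ⟨l, rfl⟩ _ ⟨m, rfl⟩ hkl hlm
  have hkl' := monotone_partialSum.reflect_lt hkl
  have hlm' := monotone_partialSum.reflect_lt hlm
  obtain ⟨l, rfl⟩ := Nat.exists_eq_add_one.2 (Nat.zero_lt_of_lt hkl')
  obtain ⟨m, rfl⟩ := Nat.exists_eq_add_one.2 (Nat.zero_lt_of_lt hlm')
  refine hi (_, _) ⟨k, l, m, Nat.le_of_lt_succ hkl', Nat.lt_of_succ_lt_succ hlm', ?_⟩
  rw [sum_Icc_nth_eq_sub (Nat.le_of_lt_succ hkl'), sum_Icc_nth_eq_sub (Nat.le_of_lt_succ hlm')]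

theorem hasMinimalGap_partialSum (hY : Y.Infinite) (v : ℕ → ℕ) :
    HasMinimalGap v (Set.range (partialSum Y)) := by
  obtain ⟨⟨a, b⟩, ⟨ha, hb, hab⟩, hmin⟩ := exists_minimalFor_of_wellFoundedLT
    (fun r : ℕ × ℕ => r.1 ∈ Set.range (partialSum Y) ∧ r.2 ∈ Set.range (partialSum Y) ∧ r.1 < r.2)
    (fun r => v (r.2 - r.1)) ⟨(_, _), ⟨1, rfl⟩, ⟨2, rfl⟩, partialSum_succ_lt hY 0⟩
  exact ⟨a, ha, b, hb, hab, fun a' ha' b' hb' hab' =>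
    (le_total _ _).elim id (hmin (j := (a', b')) ⟨ha', hb', hab'⟩)⟩

variable {E : ℕ → ℕ → Prop}

theorem IsSolution.approx_iff (h : IsSolution (jumpColour (padicValNat 2) E) Y) (hE : Monotone E)
    (hsettle : ∀ m, ∃ s, ∀ x, x < m → (∃ r, E r x) → E s x) {n : ℕ} (hn : n ∈ Y) {x : ℕ}
    (hx : x < padicValNat 2 n) : E n x ↔ ∃ s, E s x := by
  obtain ⟨i, hi⟩ := h.exists_gapHomogeneous
  obtain ⟨k, rfl⟩ : n ∈ Set.range (Nat.nth (· ∈ Y)) := by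
    rwa [Nat.range_nth_of_infinite (p := (· ∈ Y)) h.1]
  have hgap : partialSum Y (k + 1) - partialSum Y k = Nat.nth (· ∈ Y) k := by
    rw [partialSum_succ, Nat.add_sub_cancel_left]
  have hpos : Nat.nth (· ∈ Y) k ≠ 0 := fun h0 => by simp [h0] at hx
  rw [← hgap] at hx ⊢
  exact isDyadic_padicValNat.approx_sub_iff (exists_lt_partialSum h.1) hi
    (hasMinimalGap_partialSum h.1 _) hE hsettle ⟨k, rfl⟩ ⟨k + 1, rfl⟩ (by omega) hx

theorem IsSolution.exists_lt_padicValNat (h : IsSolution (jumpColour (padicValNat 2) E) Y)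
    (x : ℕ) : ∃ n ∈ Y, x < padicValNat 2 n := by
  obtain ⟨i, hi⟩ := h.exists_gapHomogeneous
  have hmono : StrictMono fun k => padicValNat 2 (Nat.nth (· ∈ Y) (k + 1)) :=
    strictMono_nat_of_lt_succ fun k => by
      have := isDyadic_padicValNat.map_sub_lt_map_sub (exists_lt_partialSum h.1) hi
        (hasMinimalGap_partialSum h.1 _) ⟨k + 1, rfl⟩ ⟨k + 2, rfl⟩ ⟨k + 3, rfl⟩
        (partialSum_succ_lt h.1 k) (partialSum_succ_lt h.1 (k + 1))
      rwa [partialSum_succ (k + 2), partialSum_succ (k + 1), Nat.add_sub_cancel_left,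
        Nat.add_sub_cancel_left] at this
  exact ⟨_, Nat.nth_mem_of_infinite h.1 (x + 2),
    Nat.lt_of_succ_le (hmono.le_apply (x := x + 1))⟩

end PartialSum

open Classical in
theorem computes_of_approximations {v : ℕ → ℕ} {E : ℕ → ℕ → Prop} (hv : Primrec v)
    (hE : PrimrecRel E) {Y A : Set ℕ} (hcorrect : ∀ n ∈ Y, ∀ x, x < v n → (E n x ↔ x ∈ A))
    (hunbounded : ∀ x, ∃ n ∈ Y, x < v n) : Computes Y A := by
  rw [Computes, TuringReducible, RecursiveIn.iff_nat]
  have prim {f : ℕ → ℕ} (hf : Primrec f) : Nat.RecursiveIn {charFun Y} fun n => f n :=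
    (Primrec.nat_iff.1 hf).recursiveIn
  have fst : Primrec fun m : ℕ => m.unpair.1 := Primrec.fst.comp Primrec.unpair
  have snd : Primrec fun m : ℕ => m.unpair.2 := Primrec.snd.comp Primrec.unpair
  have test : Primrec fun m : ℕ => if m.unpair.1 = 1 ∧
      m.unpair.2.unpair.1 < v m.unpair.2.unpair.2 then 0 else 1 :=
    Primrec.ite ((Primrec.eq.comp fst (Primrec.const 1)).and
      (Primrec.nat_lt.comp (fst.comp snd) (hv.comp (snd.comp snd)))) (Primrec.const 0)
      (Primrec.const 1)
  have output : Primrec fun m : ℕ => if E m.unpair.2 m.unpair.1 then 1 else 0 :=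
    Primrec.ite (hE.comp snd fst) (Primrec.const 1) (Primrec.const 0)
  have oracle : Nat.RecursiveIn {charFun Y} (charFun Y) := .oracle _ rfl
  have tested : Nat.RecursiveIn {charFun Y} fun m => Part.some
      (if m.unpair.2 ∈ Y ∧ m.unpair.1 < v m.unpair.2 then 0 else 1) := by
    refine ((prim test).comp ((oracle.comp .right).pair (prim Primrec.id))).of_eq fun m => ?_
    have hquery : (Part.some m.unpair.2 >>= charFun Y) =
        Part.some (if m.unpair.2 ∈ Y then 1 else 0) := Part.bind_some _ _
    by_cases hm : m.unpair.2 ∈ Y <;> simp [hquery, Seq.seq, hm]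
  have search : Nat.RecursiveIn {charFun Y} fun x => Part.some (Nat.find (hunbounded x)) := by
    refine tested.rfind.of_eq fun x => Part.eq_some_iff.2 (Nat.mem_rfind.2 ⟨?_, fun {m} hm => ?_⟩)
    · simpa using Nat.find_spec (hunbounded x)
    · simpa using Nat.find_min (hunbounded x) hm
  refine ((prim output).comp ((prim Primrec.id).pair search)).of_eq fun x => ?_
  obtain ⟨hY, hx⟩ := Nat.find_spec (hunbounded x)
  simp [charFun, Seq.seq, hcorrect _ hY x hx]

theorem exists_colouring_computing_haltingSet : ∃ c : ℕ → ℕ → Fin 4, Computable₂ c ∧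
    ∀ Y : Set ℕ, IsSolution c Y → Computes Y haltingSet :=
  ⟨jumpColour (padicValNat 2) HaltsWithin,
    (primrec_jumpColour primrec_padicValNat_two primrecRel_haltsWithin).to_comp,
    fun _ h => computes_of_approximations primrec_padicValNat_two primrecRel_haltsWithin
      (fun _ hn _ hx => (h.approx_iff monotone_haltsWithin exists_stage_haltsWithin hn hx).trans
        mem_haltingSet_iff.symm) h.exists_lt_padicValNat⟩

end HaltingSet

end AdjacentHindman

namespace SecondOrderArith

/-! ## Renaming variables -/

/-- The term with every number variable `x` replaced by `ρ x`. -/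
def Term.rename (ρ : ℕ → ℕ) : Term → Term
  | .var x => .var (ρ x)
  | .zero => .zero
  | .one => .one
  | .add s t => .add (s.rename ρ) (t.rename ρ)
  | .mul s t => .mul (s.rename ρ) (t.rename ρ)

theorem Term.mem_range_of_occurs_rename {ρ : ℕ → ℕ} {x : ℕ} :
    ∀ {t : Term}, (t.rename ρ).Occurs x → x ∈ Set.range ρ
  | .var y, h => ⟨y, h.symm⟩
  | .add s t, h | .mul s t, h =>
    h.elim (mem_range_of_occurs_rename (t := s)) (mem_range_of_occurs_rename (t := t))

theorem Term.occurs_of_occurs_rename {ρ : ℕ → ℕ} (hρ : Function.Injective ρ) {x : ℕ} :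
    ∀ {t : Term}, (t.rename ρ).Occurs (ρ x) → t.Occurs x
  | .var _, h => hρ h
  | .add s t, h | .mul s t, h =>
    h.imp (occurs_of_occurs_rename hρ (t := s)) (occurs_of_occurs_rename hρ (t := t))

/-- The formula with all number variables, free and bound, renamed by `ρ`, and all set variables
by `σ`. -/
def Formula.rename (ρ σ : ℕ → ℕ) : Formula → Formula
  | .eq s t => .eq (s.rename ρ) (t.rename ρ)
  | .lt s t => .lt (s.rename ρ) (t.rename ρ)
  | .mem t X => .mem (t.rename ρ) (σ X)
  | .neg φ => .neg (φ.rename ρ σ)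
  | .and φ ψ => .and (φ.rename ρ σ) (ψ.rename ρ σ)
  | .all x φ => .all (ρ x) (φ.rename ρ σ)
  | .allSet X φ => .allSet (σ X) (φ.rename ρ σ)

theorem Formula.mem_range_of_numFree_rename {ρ σ : ℕ → ℕ} {x : ℕ} :
    ∀ {φ : Formula}, (φ.rename ρ σ).NumFree x → x ∈ Set.range ρ
  | .eq _ _, h => h.elim Term.mem_range_of_occurs_rename Term.mem_range_of_occurs_rename
  | .lt _ _, h => h.elim Term.mem_range_of_occurs_rename Term.mem_range_of_occurs_rename
  | .mem _ _, h => Term.mem_range_of_occurs_rename h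
  | .neg φ, h => mem_range_of_numFree_rename (φ := φ) h
  | .and φ ψ, h =>
    h.elim (mem_range_of_numFree_rename (φ := φ)) (mem_range_of_numFree_rename (φ := ψ))
  | .all _ φ, h => mem_range_of_numFree_rename (φ := φ) h.2
  | .allSet _ φ, h => mem_range_of_numFree_rename (φ := φ) h

theorem Formula.mem_range_of_setFree_rename {ρ σ : ℕ → ℕ} {X : ℕ} :
    ∀ {φ : Formula}, (φ.rename ρ σ).SetFree X → X ∈ Set.range σ
  | .mem _ Y, h => ⟨Y, h.symm⟩
  | .neg φ, h => mem_range_of_setFree_rename (φ := φ) h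
  | .and φ ψ, h =>
    h.elim (mem_range_of_setFree_rename (φ := φ)) (mem_range_of_setFree_rename (φ := ψ))
  | .all _ φ, h => mem_range_of_setFree_rename (φ := φ) h
  | .allSet _ φ, h => mem_range_of_setFree_rename (φ := φ) h.2

theorem Formula.IsBounded.rename {ρ σ : ℕ → ℕ} (hρ : Function.Injective ρ) {φ : Formula}
    (h : φ.IsBounded) : (φ.rename ρ σ).IsBounded := by
  induction h with
  | eq s t => exact .eq _ _
  | lt s t => exact .lt _ _
  | mem t X => exact .mem _ _
  | neg _ ih => exact .neg ih
  | and _ _ ih₁ ih₂ => exact .and ih₁ ih₂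
  | ball hx _ ih => exact .ball (fun h => hx (Term.occurs_of_occurs_rename hρ h)) ih

namespace Model

variable {M : Model.{u}}

theorem eval_rename (v : ℕ → M.Num) (ρ : ℕ → ℕ) :
    ∀ t : Term, M.eval v (t.rename ρ) = M.eval (v ∘ ρ) t
  | .var _ => rfl
  | .zero => rfl
  | .one => rfl
  | .add s t => congrArg₂ M.add (eval_rename v ρ s) (eval_rename v ρ t)
  | .mul s t => congrArg₂ M.mul (eval_rename v ρ s) (eval_rename v ρ t)

theorem sat_rename {ρ σ : ℕ → ℕ} (hρ : Function.Injective ρ) (hσ : Function.Injective σ)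
    (φ : Formula) : ∀ (v : ℕ → M.Num) (w : ℕ → M.Sets),
      M.Sat v w (φ.rename ρ σ) ↔ M.Sat (v ∘ ρ) (w ∘ σ) φ := by
  induction φ with
  | eq s t => intro v w; simp only [Formula.rename, Sat, eval_rename]
  | lt s t => intro v w; simp only [Formula.rename, Sat, eval_rename]
  | mem t X => intro v w; simp only [Formula.rename, Sat, eval_rename, Function.comp_apply]
  | neg φ ih => intro v w; simp only [Formula.rename, Sat, ih]
  | and φ ψ ih₁ ih₂ => intro v w; simp only [Formula.rename, Sat, ih₁, ih₂]
  | all x φ ih =>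
    intro v w
    simp only [Formula.rename, Sat, ih, Function.update_comp_eq_of_injective v hρ]
  | allSet X φ ih =>
    intro v w
    simp only [Formula.rename, Sat, ih, Function.update_comp_eq_of_injective w hσ]

theorem sat_congr_set {w w' : ℕ → M.Sets} {φ : Formula} (v : ℕ → M.Num)
    (h : ∀ X, φ.SetFree X → w X = w' X) : M.Sat v w φ ↔ M.Sat v w' φ := by
  induction φ generalizing v w w' with
  | eq s t => rfl
  | lt s t => rfl
  | mem t X => simp only [Sat, h X rfl]
  | neg φ ih => simp only [Sat, ih v h]
  | and φ ψ ih₁ ih₂ =>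
    simp only [Sat, ih₁ v fun X hX => h X (.inl hX), ih₂ v fun X hX => h X (.inr hX)]
  | all x φ ih => exact forall_congr' fun a => ih _ h
  | allSet X φ ih =>
    refine forall_congr' fun A => ih _ fun Y hY => ?_
    by_cases e : Y = X
    · subst e; simp
    · simp [e, h Y ⟨e, hY⟩]

section Connectives

variable (v : ℕ → M.Num) (w : ℕ → M.Sets) (φ ψ : Formula)

theorem sat_imp : M.Sat v w (.imp φ ψ) ↔ (M.Sat v w φ → M.Sat v w ψ) := by
  simp only [Formula.imp, Sat, not_and, not_not]

theorem sat_or : M.Sat v w (.or φ ψ) ↔ (M.Sat v w φ ∨ M.Sat v w ψ) := by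
  simp only [Formula.or, Sat, not_and_or, not_not]

theorem sat_iff : M.Sat v w (.iff φ ψ) ↔ (M.Sat v w φ ↔ M.Sat v w ψ) := by
  simp only [Formula.iff, Sat, sat_imp, iff_iff_implies_and_implies]

theorem sat_ex (x : ℕ) : M.Sat v w (.ex x φ) ↔ ∃ a, M.Sat (Function.update v x a) w φ := by
  simp only [Formula.ex, Sat, not_forall, not_not]

theorem sat_exSet (X : ℕ) : M.Sat v w (.exSet X φ) ↔ ∃ A, M.Sat v (Function.update w X A) φ := by
  simp only [Formula.exSet, Sat, not_forall, not_not]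

end Connectives

/-! ## Definability with parameters -/

/-- The environment `v` with a new first entry `a`; a bound variable is the entry `0`, as for
de Bruijn indices. -/
def cons {α : Type*} (a : α) (v : ℕ → α) : ℕ → α
  | 0 => a
  | i + 1 => v i

@[simp] theorem cons_zero {α : Type*} (a : α) (v : ℕ → α) : cons a v 0 = a := rfl

@[simp] theorem cons_succ {α : Type*} (a : α) (v : ℕ → α) (i : ℕ) : cons a v (i + 1) = v i := rfl

instance : Zero M.Num := ⟨M.zero⟩
instance : One M.Num := ⟨M.one⟩
instance : Add M.Num := ⟨M.add⟩
instance : Mul M.Num := ⟨M.mul⟩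
instance : LT M.Num := ⟨M.lt⟩

/-- Polynomial functions with parameters. -/
inductive Poly : ((ℕ → M.Num) → M.Num) → Prop
  | var (i : ℕ) : Poly fun v => v i
  | const (a : M.Num) : Poly fun _ => a
  | add {s t : (ℕ → M.Num) → M.Num} : Poly s → Poly t → Poly fun v => s v + t v
  | mul {s t : (ℕ → M.Num) → M.Num} : Poly s → Poly t → Poly fun v => s v * t v

/-- Predicates defined by a bounded formula with number and set parameters. -/
inductive Bdd : ((ℕ → M.Num) → Prop) → Prop
  | eq {s t : (ℕ → M.Num) → M.Num} : Poly s → Poly t → Bdd fun v => s v = t v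
  | lt {s t : (ℕ → M.Num) → M.Num} : Poly s → Poly t → Bdd fun v => s v < t v
  | mem {t : (ℕ → M.Num) → M.Num} {A : Set M.Num} : Poly t → A ∈ M.Sets → Bdd fun v => t v ∈ A
  | not {P : (ℕ → M.Num) → Prop} : Bdd P → Bdd fun v => ¬ P v
  | and {P Q : (ℕ → M.Num) → Prop} : Bdd P → Bdd Q → Bdd fun v => P v ∧ Q v
  | ball_cons {t : (ℕ → M.Num) → M.Num} {P : (ℕ → M.Num) → Prop} : Poly t → Bdd P →
      Bdd fun v => ∀ a, a < t v → P (cons a v)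

theorem Poly.subst {t : (ℕ → M.Num) → M.Num} (ht : Poly t) {σ : ℕ → (ℕ → M.Num) → M.Num}
    (hσ : ∀ i, Poly (σ i)) : Poly fun v => t fun i => σ i v := by
  induction ht with
  | var i => exact hσ i
  | const a => exact .const a
  | add _ _ ih₁ ih₂ => exact .add ih₁ ih₂
  | mul _ _ ih₁ ih₂ => exact .mul ih₁ ih₂

theorem Poly.lift {t : (ℕ → M.Num) → M.Num} (ht : Poly t) : Poly fun v => t fun i => v (i + 1) :=
  ht.subst fun i => .var (i + 1)

theorem poly_cons {s : (ℕ → M.Num) → M.Num} {σ : ℕ → (ℕ → M.Num) → M.Num} (hs : Poly s)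
    (hσ : ∀ i, Poly (σ i)) : ∀ i, Poly fun v => cons (s v) (fun j => σ j v) i
  | 0 => hs
  | i + 1 => hσ i

theorem Bdd.of_iff {P Q : (ℕ → M.Num) → Prop} (hP : Bdd P) (h : ∀ v, Q v ↔ P v) : Bdd Q :=
  (funext fun v => propext (h v) : Q = P) ▸ hP

theorem Bdd.subst {P : (ℕ → M.Num) → Prop} (hP : Bdd P) {σ : ℕ → (ℕ → M.Num) → M.Num}
    (hσ : ∀ i, Poly (σ i)) : Bdd fun v => P fun i => σ i v := by
  induction hP generalizing σ with
  | eq hs ht => exact .eq (hs.subst hσ) (ht.subst hσ)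
  | lt hs ht => exact .lt (hs.subst hσ) (ht.subst hσ)
  | mem ht hA => exact .mem (ht.subst hσ) hA
  | not _ ih => exact .not (ih hσ)
  | and _ _ ih₁ ih₂ => exact .and (ih₁ hσ) (ih₂ hσ)
  | ball_cons ht _ ih =>
    exact .ball_cons (ht.subst hσ) (ih (poly_cons (.var 0) fun i => (hσ i).lift))

theorem Bdd.lift {P : (ℕ → M.Num) → Prop} (hP : Bdd P) : Bdd fun v => P fun i => v (i + 1) :=
  hP.subst fun i => .var (i + 1)

theorem Bdd.imp {P Q : (ℕ → M.Num) → Prop} (hP : Bdd P) (hQ : Bdd Q) : Bdd fun v => P v → Q v :=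
  (hP.and hQ.not).not.of_iff fun _ => not_and_not_right.symm

theorem Bdd.or {P Q : (ℕ → M.Num) → Prop} (hP : Bdd P) (hQ : Bdd Q) : Bdd fun v => P v ∨ Q v :=
  (hP.not.and hQ.not).not.of_iff fun _ => or_iff_not_and_not

theorem Bdd.iff {P Q : (ℕ → M.Num) → Prop} (hP : Bdd P) (hQ : Bdd Q) : Bdd fun v => P v ↔ Q v :=
  ((hP.imp hQ).and (hQ.imp hP)).of_iff fun _ => iff_iff_implies_and_implies

theorem exists_dependsOn_Iio_map₂ {α β γ δ : Type*} {f : (ℕ → α) → β} {g : (ℕ → α) → γ}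
    (F : β → γ → δ) (hf : ∃ n, DependsOn f (Set.Iio n)) (hg : ∃ n, DependsOn g (Set.Iio n)) :
    ∃ n, DependsOn (fun v => F (f v) (g v)) (Set.Iio n) := by
  obtain ⟨m, hm⟩ := hf
  obtain ⟨n, hn⟩ := hg
  exact ⟨max m n, fun v v' h => congrArg₂ F
    (hm fun i hi => h i (Set.Iio_subset_Iio (le_max_left m n) hi))
    (hn fun i hi => h i (Set.Iio_subset_Iio (le_max_right m n) hi))⟩

theorem Poly.exists_dependsOn_Iio {t : (ℕ → M.Num) → M.Num} (ht : Poly t) :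
    ∃ n, DependsOn t (Set.Iio n) := by
  induction ht with
  | var i => exact ⟨i + 1, fun _ _ h => h i (Nat.lt_succ_self i)⟩
  | const a => exact ⟨0, fun _ _ _ => rfl⟩
  | add _ _ ih₁ ih₂ => exact exists_dependsOn_Iio_map₂ _ ih₁ ih₂
  | mul _ _ ih₁ ih₂ => exact exists_dependsOn_Iio_map₂ _ ih₁ ih₂

theorem Bdd.exists_dependsOn_Iio {P : (ℕ → M.Num) → Prop} (hP : Bdd P) :
    ∃ n, DependsOn P (Set.Iio n) := by
  induction hP with
  | eq hs ht => exact exists_dependsOn_Iio_map₂ _ hs.exists_dependsOn_Iio ht.exists_dependsOn_Iio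
  | lt hs ht => exact exists_dependsOn_Iio_map₂ _ hs.exists_dependsOn_Iio ht.exists_dependsOn_Iio
  | @mem t A ht _ => exact ht.exists_dependsOn_Iio.imp fun n hn v v' h => congrArg (· ∈ A) (hn h)
  | not _ ih => exact ih.imp fun n hn v v' h => congrArg Not (hn h)
  | and _ _ ih₁ ih₂ => exact exists_dependsOn_Iio_map₂ _ ih₁ ih₂
  | @ball_cons t P ht _ ih =>
    refine exists_dependsOn_Iio_map₂ (fun b (Q : M.Num → Prop) => ∀ a, a < b → Q a)
      (g := fun v a => P (cons a v)) ht.exists_dependsOn_Iio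
      (ih.imp fun n hn v v' h => funext fun a => hn ?_)
    rintro (_ | i) hi
    exacts [rfl, h i (Nat.lt_of_succ_lt hi)]

/-! ### From definable predicates to formulas -/

/-- The assignment of `v` to the even and of `p` to the odd variables. The variables of a predicate
are represented by the even, its parameters by the odd variables of a formula. -/
def interleave {α : Type*} (v p : ℕ → α) (i : ℕ) : α := if Even i then v (i / 2) else p (i / 2)

section Interleave

variable {α : Type*} (v p q : ℕ → α)

@[simp] theorem interleave_even (i : ℕ) : interleave v p (2 * i) = v i := by
  simp [interleave]

@[simp] theorem interleave_odd (i : ℕ) : interleave v p (2 * i + 1) = p i := by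
  simp [interleave, Nat.mul_add_div]

theorem interleave_ext {f g : ℕ → α} (heven : ∀ i, f (2 * i) = g (2 * i))
    (hodd : ∀ i, f (2 * i + 1) = g (2 * i + 1)) : f = g :=
  funext fun i => by rcases Nat.even_or_odd' i with ⟨j, rfl | rfl⟩ <;> simp only [heven, hodd]

@[simp] theorem interleave_comp_even : interleave v p ∘ (fun i => 2 * i) = v :=
  funext (interleave_even v p)

@[simp] theorem interleave_comp_odd : interleave v p ∘ (fun i => 2 * i + 1) = p :=
  funext (interleave_odd v p)

theorem update_interleave_even (i : ℕ) (a : α) :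
    Function.update (interleave v p) (2 * i) a = interleave (Function.update v i a) p := by
  refine interleave_ext (fun j => ?_) fun j => ?_
  · simp [Function.update_apply]
  · rw [Function.update_of_ne (by omega), interleave_odd, interleave_odd]

theorem update_interleave_odd (i : ℕ) (a : α) :
    Function.update (interleave v p) (2 * i + 1) a = interleave v (Function.update p i a) := by
  refine interleave_ext (fun j => ?_) fun j => ?_
  · rw [Function.update_of_ne (by omega), interleave_even, interleave_even]
  · simp [Function.update_apply]

theorem update_cons_zero (a b : α) : Function.update (cons a v) 0 b = cons b v := by
  funext i
  cases i <;> simp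

/-- Fix the even numbers, and map the `i`-th odd number to the `f i`-th one. -/
def oddMap (f : ℕ → ℕ) : ℕ → ℕ := interleave (fun i => 2 * i) fun i => 2 * f i + 1

theorem oddMap_injective {f : ℕ → ℕ} (hf : Function.Injective f) :
    Function.Injective (oddMap f) := by
  intro i j h
  rcases Nat.even_or_odd' i with ⟨a, rfl | rfl⟩ <;>
    rcases Nat.even_or_odd' j with ⟨b, rfl | rfl⟩ <;>
    simp only [oddMap, interleave_even, interleave_odd] at h
  · omega
  · omega
  · omega
  · rw [hf (a₁ := a) (a₂ := b) (by omega)]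

theorem one_notMem_range_oddMap_succ : 1 ∉ Set.range (oddMap Nat.succ) := by
  rintro ⟨i, hi⟩
  rcases Nat.even_or_odd' i with ⟨a, rfl | rfl⟩ <;>
    simp only [oddMap, interleave_even, interleave_odd] at hi <;> omega

theorem interleave_comp_oddMap (f : ℕ → ℕ) : interleave v p ∘ oddMap f = interleave v (p ∘ f) :=
  interleave_ext (fun i => by simp [oddMap]) fun i => by simp [oddMap]

/-- Turn the variable `0` into the parameter `1`, and shift the others accordingly. -/
def bindMap : ℕ → ℕ := interleave (cons 1 fun i => 2 * i) fun i => 2 * i + 3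

theorem bindMap_injective : Function.Injective bindMap := by
  intro i j h
  rcases Nat.even_or_odd' i with ⟨_ | a, rfl | rfl⟩ <;>
    rcases Nat.even_or_odd' j with ⟨_ | b, rfl | rfl⟩ <;>
    simp only [bindMap, interleave_even, interleave_odd, cons_zero, cons_succ] at h <;> omega

theorem interleave_cons_comp_bindMap (a : α) :
    interleave v (cons a p) ∘ bindMap = interleave (cons a v) p := by
  refine interleave_ext (fun i => ?_) fun i => ?_
  · cases i with
    | zero => simp only [Function.comp, bindMap, interleave_even, cons_zero]; rfl
    | succ i => simp [bindMap]
  · simp only [Function.comp, bindMap, interleave_odd]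
    exact interleave_odd v (cons a p) (i + 1)

end Interleave

/-- The term `τ` has the value `t` when its odd variables have the values `p`. -/
def Represents (τ : Term) (p : ℕ → M.Num) (t : (ℕ → M.Num) → M.Num) : Prop :=
  ∀ v, M.eval (interleave v p) τ = t v

theorem Represents.rename {τ : Term} {p : ℕ → M.Num} {f : ℕ → ℕ} {t : (ℕ → M.Num) → M.Num}
    (h : Represents τ (p ∘ f) t) : Represents (τ.rename (oddMap f)) p t := fun v => by
  rw [eval_rename, interleave_comp_oddMap, h v]

theorem Represents.left {τ : Term} {p : ℕ → M.Num} {t : (ℕ → M.Num) → M.Num}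
    (h : Represents τ p t) (q : ℕ → M.Num) :
    Represents (τ.rename (oddMap fun i => 2 * i)) (interleave p q) t :=
  Represents.rename (by rwa [interleave_comp_even])

theorem Represents.right {τ : Term} {q : ℕ → M.Num} {t : (ℕ → M.Num) → M.Num}
    (h : Represents τ q t) (p : ℕ → M.Num) :
    Represents (τ.rename (oddMap fun i => 2 * i + 1)) (interleave p q) t :=
  Represents.rename (by rwa [interleave_comp_odd])

theorem Poly.exists_represents {t : (ℕ → M.Num) → M.Num} (ht : Poly t) :
    ∃ τ p, Represents τ p t := by
  induction ht with
  | var i => exact ⟨.var (2 * i), fun _ => 0, fun v => interleave_even v _ i⟩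
  | const a => exact ⟨.var 1, fun _ => a, fun v => interleave_odd v _ 0⟩
  | add _ _ ih₁ ih₂ =>
    obtain ⟨τ₁, p₁, h₁⟩ := ih₁
    obtain ⟨τ₂, p₂, h₂⟩ := ih₂
    exact ⟨.add _ _, _, fun v => congrArg₂ M.add (h₁.left p₂ v) (h₂.right p₁ v)⟩
  | mul _ _ ih₁ ih₂ =>
    obtain ⟨τ₁, p₁, h₁⟩ := ih₁
    obtain ⟨τ₂, p₂, h₂⟩ := ih₂
    exact ⟨.mul _ _, _, fun v => congrArg₂ M.mul (h₁.left p₂ v) (h₂.right p₁ v)⟩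

/-- The bounded formula `θ` defines `P` when its odd variables have the values `p`, and its set
variables the values `w`. -/
structure Defines (θ : Formula) (p : ℕ → M.Num) (w : ℕ → M.Sets) (P : (ℕ → M.Num) → Prop) :
    Prop where
  isBounded : θ.IsBounded
  sat_iff (v : ℕ → M.Num) : M.Sat (interleave v p) w θ ↔ P v

theorem Defines.rename {θ : Formula} {p : ℕ → M.Num} {w : ℕ → M.Sets} {f g : ℕ → ℕ}
    {P : (ℕ → M.Num) → Prop} (h : Defines θ (p ∘ f) (w ∘ g) P) (hf : Function.Injective f)
    (hg : Function.Injective g) : Defines (θ.rename (oddMap f) g) p w P where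
  isBounded := h.isBounded.rename (oddMap_injective hf)
  sat_iff v := by
    rw [sat_rename (oddMap_injective hf) hg, interleave_comp_oddMap, h.sat_iff]

theorem Defines.left {θ : Formula} {p : ℕ → M.Num} {w : ℕ → M.Sets} {P : (ℕ → M.Num) → Prop}
    (h : Defines θ p w P) (q : ℕ → M.Num) (w' : ℕ → M.Sets) :
    Defines (θ.rename (oddMap fun i => 2 * i) fun i => 2 * i) (interleave p q)
      (interleave w w') P :=
  Defines.rename (by rwa [interleave_comp_even, interleave_comp_even])
    (mul_right_injective₀ two_ne_zero) (mul_right_injective₀ two_ne_zero)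

theorem Defines.right {θ : Formula} {q : ℕ → M.Num} {w' : ℕ → M.Sets} {P : (ℕ → M.Num) → Prop}
    (h : Defines θ q w' P) (p : ℕ → M.Num) (w : ℕ → M.Sets) :
    Defines (θ.rename (oddMap fun i => 2 * i + 1) fun i => 2 * i + 1) (interleave p q)
      (interleave w w') P :=
  have hinj : Function.Injective fun i : ℕ => 2 * i + 1 :=
    (add_left_injective 1).comp (mul_right_injective₀ two_ne_zero)
  Defines.rename (by rwa [interleave_comp_odd, interleave_comp_odd]) hinj hinj

theorem Defines.ball_cons {τ : Term} {θ : Formula} {p : ℕ → M.Num} {w : ℕ → M.Sets}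
    {t : (ℕ → M.Num) → M.Num} {P : (ℕ → M.Num) → Prop} (ht : Represents τ p t)
    (h : Defines θ p w P) :
    Defines (.all 1 (.imp (.lt (.var 1) (τ.rename (oddMap Nat.succ))) (θ.rename bindMap id)))
      (cons 0 p) w fun v => ∀ a, a < t v → P (cons a v) where
  isBounded := .ball (fun h => one_notMem_range_oddMap_succ (Term.mem_range_of_occurs_rename h))
    (h.isBounded.rename bindMap_injective)
  sat_iff v := by
    have hupdate (a : M.Num) :
        Function.update (interleave v (cons 0 p)) 1 a = interleave v (cons a p) :=
      (update_interleave_odd v (cons 0 p) 0 a).trans (by rw [update_cons_zero])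
    have hbound (a : M.Num) : M.eval (interleave v (cons a p)) (τ.rename (oddMap Nat.succ)) = t v :=
      Represents.rename (p := cons a p) ht v
    have hvar (a : M.Num) : M.eval (interleave v (cons a p)) (.var 1) = a :=
      interleave_odd v (cons a p) 0
    simp only [Sat, sat_imp, hupdate, hbound, hvar, sat_rename bindMap_injective
      Function.injective_id, Function.comp_id, interleave_cons_comp_bindMap, h.sat_iff]
    rfl

theorem Bdd.exists_defines {P : (ℕ → M.Num) → Prop} (hP : Bdd P) : ∃ θ p w, Defines θ p w P := by
  obtain ⟨A₀, hA₀⟩ := M.sets_nonempty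
  induction hP with
  | eq hs ht =>
    obtain ⟨σ, p, hσ⟩ := hs.exists_represents
    obtain ⟨τ, q, hτ⟩ := ht.exists_represents
    have hσ := hσ.left q
    have hτ := hτ.right p
    exact ⟨.eq _ _, _, fun _ => ⟨A₀, hA₀⟩, .eq _ _, fun v =>
      Iff.of_eq (congrArg₂ (· = ·) (hσ v) (hτ v))⟩
  | lt hs ht =>
    obtain ⟨σ, p, hσ⟩ := hs.exists_represents
    obtain ⟨τ, q, hτ⟩ := ht.exists_represents
    have hσ := hσ.left q
    have hτ := hτ.right p
    exact ⟨.lt _ _, _, fun _ => ⟨A₀, hA₀⟩, .lt _ _, fun v =>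
      Iff.of_eq (congrArg₂ M.lt (hσ v) (hτ v))⟩
  | @mem t A ht hA =>
    obtain ⟨τ, p, hτ⟩ := ht.exists_represents
    exact ⟨.mem τ 0, p, fun _ => ⟨A, hA⟩, .mem _ _, fun v => by rw [Sat, hτ]⟩
  | not _ ih =>
    obtain ⟨θ, p, w, h⟩ := ih
    exact ⟨.neg θ, p, w, .neg h.isBounded, fun v => not_congr (h.sat_iff v)⟩
  | and _ _ ih₁ ih₂ =>
    obtain ⟨θ₁, p₁, w₁, h₁⟩ := ih₁
    obtain ⟨θ₂, p₂, w₂, h₂⟩ := ih₂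
    have h₁ := h₁.left p₂ w₂
    have h₂ := h₂.right p₁ w₁
    exact ⟨_, _, _, .and h₁.isBounded h₂.isBounded,
      fun v => and_congr (h₁.sat_iff v) (h₂.sat_iff v)⟩
  | ball_cons ht _ ih =>
    obtain ⟨τ, p, hτ⟩ := ht.exists_represents
    obtain ⟨θ, q, w, h⟩ := ih
    exact ⟨_, _, _, (h.right p w).ball_cons (hτ.left q)⟩

/-! ### Induction and comprehension -/

/-- `M` is a model of `RCA₀`. -/
class IsRCA (M : Model.{u}) : Prop where
  models : ∀ ψ ∈ RCA₀, M.Models ψ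

/-- The renaming frees the parameter `1` and the set variable `0`, which the schemes of `RCA₀`
bind. -/
theorem Defines.sat_rename_succ_iff {θ : Formula} {p : ℕ → M.Num} {w : ℕ → M.Sets}
    {P : M.Num → M.Num → Prop} (h : Defines θ p w fun v => P (v 0) (v 1)) (A : M.Sets)
    (v : ℕ → M.Num) (a b c : M.Num) :
    M.Sat (Function.update (Function.update (interleave v (cons a p)) 2 b) 0 c) (cons A w)
      (θ.rename (oddMap Nat.succ) Nat.succ) ↔ P c b := by
  have hrename : Defines (θ.rename (oddMap Nat.succ) Nat.succ) (cons a p) (cons A w) _ :=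
    Defines.rename h Nat.succ_injective Nat.succ_injective
  have hupdate := update_interleave_even (Function.update v 1 b) (cons a p) 0 c
  rw [← update_interleave_even v (cons a p) 1 b] at hupdate
  refine (Iff.of_eq (congrArg (fun u => M.Sat u _ _) hupdate)).trans ((hrename.sat_iff _).trans ?_)
  simp

theorem sigma_induction [IsRCA M] {P : M.Num → M.Num → Prop} (hP : Bdd fun v => P (v 0) (v 1))
    (h₀ : ∃ y, P y 0) (h₁ : ∀ x, (∃ y, P y x) → ∃ y, P y (x + 1)) (x : M.Num) : ∃ y, P y x := by
  obtain ⟨θ, p, w, h⟩ := hP.exists_defines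
  obtain ⟨A₀, hA₀⟩ := M.sets_nonempty
  have hbounded := h.isBounded.rename (σ := Nat.succ) (oddMap_injective Nat.succ_injective)
  have hone : ¬ (Formula.ex 0 (θ.rename (oddMap Nat.succ) Nat.succ)).NumFree 1 := fun hf =>
    one_notMem_range_oddMap_succ (Formula.mem_range_of_numFree_rename hf.2)
  have ax := IsRCA.models (inductionFor 2 1 (.ex 0 (θ.rename (oddMap Nat.succ) Nat.succ)))
    (.inl (.inr ⟨_, 2, 1, ⟨0, _, hbounded, rfl⟩, by decide, hone, rfl⟩))
    (interleave (fun _ => 0) (cons 0 p)) (cons ⟨A₀, hA₀⟩ w)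
  have hupdate (a : M.Num) : Function.update (interleave (fun _ => 0) (cons 0 p)) 1 a =
      interleave (fun _ => 0) (cons a p) :=
    (update_interleave_odd _ _ 0 a).trans (by rw [update_cons_zero])
  simp only [inductionFor, atTerm, sat_imp, Sat, sat_ex, hupdate, h.sat_rename_succ_iff] at ax
  refine ax ⟨fun a ha => ?_, fun a ih b hb => ?_⟩ x
  · obtain rfl : a = 0 := by
      simp only [eval, Function.update_self] at ha
      exact ha
    exact h₀
  · have hval (c : M.Num) :
        Function.update (interleave (fun _ => 0) (cons a p)) 2 c 1 = a :=
      (Function.update_of_ne (by decide) _ _).trans (interleave_odd _ (cons a p) 0)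
    obtain rfl : b = a + 1 := by
      simp only [eval, Function.update_self, hval] at hb
      exact hb
    exact h₁ a (ih a (by simp only [eval, Function.update_self, hval]))

theorem delta_comprehension [IsRCA M] {P Q : M.Num → M.Num → Prop}
    (hP : Bdd fun v => P (v 0) (v 1)) (hQ : Bdd fun v => Q (v 0) (v 1))
    (h : ∀ x, (∃ y, P y x) ↔ ∀ y, Q y x) : {x | ∃ y, P y x} ∈ M.Sets := by
  obtain ⟨θ₁, p₁, w₁, h₁⟩ := hP.exists_defines
  obtain ⟨θ₂, p₂, w₂, h₂⟩ := hQ.exists_defines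
  have h₁ := h₁.left p₂ w₂
  have h₂ := h₂.right p₁ w₁
  obtain ⟨A₀, hA₀⟩ := M.sets_nonempty
  have hinj := oddMap_injective Nat.succ_injective
  have ax := IsRCA.models _ (.inr ⟨_, _, 2, 0,
    ⟨0, _, h₁.isBounded.rename (σ := Nat.succ) hinj, rfl⟩,
    ⟨0, _, h₂.isBounded.rename (σ := Nat.succ) hinj, rfl⟩,
    fun hf => by simpa using Formula.mem_range_of_setFree_rename hf, rfl⟩)
    (interleave (fun _ => 0) (cons 0 (interleave p₁ p₂))) (cons ⟨A₀, hA₀⟩ (interleave w₁ w₂))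
  simp only [comprehensionFor, sat_imp, Sat, sat_iff, sat_ex, sat_exSet, update_cons_zero,
    h₁.sat_rename_succ_iff, h₂.sat_rename_succ_iff, eval, Function.update_self, cons_zero] at ax
  obtain ⟨A, hA⟩ := ax h
  rw [show {x | ∃ y, P y x} = (A : Set M.Num) from Set.ext fun x => (hA x).symm]
  exact A.2

/-! ## Arithmetic in a model -/

section Arithmetic

variable [IsRCA M]

theorem bdd_induction {P : M.Num → Prop} (hP : Bdd fun v => P (v 0))
    (h₀ : P 0) (h₁ : ∀ x, P x → P (x + 1)) (x : M.Num) : P x :=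
  (sigma_induction (P := fun _ x => P x) (hP.subst fun _ => .var 1) ⟨0, h₀⟩
    (fun x ⟨y, h⟩ => ⟨y, h₁ x h⟩) x).elim fun _ h => h

theorem sat_of_mem_basicAxioms {ψ : Formula} (h : ψ ∈ basicAxioms) (v : ℕ → M.Num) :
    M.Sat v (fun _ => ⟨_, M.sets_nonempty.choose_spec⟩) ψ :=
  IsRCA.models ψ (.inl (.inl h)) v _

namespace Arith

theorem succ_ne_zero (a : M.Num) : a + 1 ≠ 0 :=
  sat_of_mem_basicAxioms (ψ := .neg (.eq (nv 0 + 1) 0)) (by simp [basicAxioms]) (fun _ => a)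

theorem succ_inj {a b : M.Num} (h : a + 1 = b + 1) : a = b :=
  (sat_imp _ _ _ _).1 (sat_of_mem_basicAxioms
    (ψ := .imp (.eq (nv 0 + 1) (nv 1 + 1)) (.eq (nv 0) (nv 1)))
    (by simp [basicAxioms]) (cons a fun _ => b)) h

theorem add_zero (a : M.Num) : a + 0 = a :=
  sat_of_mem_basicAxioms (ψ := .eq (nv 0 + 0) (nv 0)) (by simp [basicAxioms]) (fun _ => a)

theorem add_succ (a b : M.Num) : a + (b + 1) = a + b + 1 :=
  sat_of_mem_basicAxioms (ψ := .eq (nv 0 + (nv 1 + 1)) ((nv 0 + nv 1) + 1)) (by simp [basicAxioms])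
    (cons a fun _ => b)

theorem mul_zero (a : M.Num) : a * 0 = 0 :=
  sat_of_mem_basicAxioms (ψ := .eq (nv 0 * 0) 0) (by simp [basicAxioms]) (fun _ => a)

theorem mul_succ (a b : M.Num) : a * (b + 1) = a * b + a :=
  sat_of_mem_basicAxioms (ψ := .eq (nv 0 * (nv 1 + 1)) (nv 0 * nv 1 + nv 0)) (by simp [basicAxioms])
    (cons a fun _ => b)

theorem not_lt_zero (a : M.Num) : ¬ a < 0 :=
  sat_of_mem_basicAxioms (ψ := .neg (.lt (nv 0) 0)) (by simp [basicAxioms]) (fun _ => a)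

theorem lt_succ {a b : M.Num} : a < b + 1 ↔ a < b ∨ a = b := by
  have := sat_of_mem_basicAxioms (M := M)
    (ψ := .iff (.lt (nv 0) (nv 1 + 1)) (.or (.lt (nv 0) (nv 1)) (.eq (nv 0) (nv 1))))
    (by simp [basicAxioms]) (cons a fun _ => b)
  rw [sat_iff, sat_or] at this
  exact this

theorem add_assoc (a b c : M.Num) : a + b + c = a + (b + c) := by
  refine bdd_induction (P := fun c => a + b + c = a + (b + c))
    (.eq (.add (.const _) (.var 0)) (.add (.const _) (.add (.const _) (.var 0)))) ?_ ?_ c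
  · simp only [add_zero]
  · intro c h; simp only [add_succ, h]

theorem zero_add (a : M.Num) : 0 + a = a := by
  refine bdd_induction (P := fun a => 0 + a = a) (.eq (.add (.const _) (.var 0)) (.var 0)) ?_ ?_ a
  · exact add_zero 0
  · intro a h; rw [add_succ, h]

theorem succ_add (a b : M.Num) : a + 1 + b = a + b + 1 := by
  refine bdd_induction (P := fun b => a + 1 + b = a + b + 1)
    (.eq (.add (.const _) (.var 0)) (.add (.add (.const _) (.var 0)) (.const _))) ?_ ?_ b
  · simp only [add_zero]
  · intro b h; simp only [add_succ, h]

theorem add_comm (a b : M.Num) : a + b = b + a := by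
  refine bdd_induction (P := fun b => a + b = b + a)
    (.eq (.add (.const _) (.var 0)) (.add (.var 0) (.const _))) ?_ ?_ b
  · rw [add_zero, zero_add]
  · intro b h; rw [add_succ, succ_add, h]

theorem add_right_cancel {a b c : M.Num} : a + c = b + c → a = b := by
  refine bdd_induction (P := fun c => a + c = b + c → a = b)
    (.imp (.eq (.add (.const _) (.var 0)) (.add (.const _) (.var 0)))
      (.eq (.const _) (.const _))) ?_ ?_ c
  · simp only [add_zero, imp_self]
  · intro c h e; rw [add_succ, add_succ] at e; exact h (succ_inj e)

theorem add_mul (a b c : M.Num) : (a + b) * c = a * c + b * c := by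
  refine bdd_induction (P := fun c => (a + b) * c = a * c + b * c)
    (.eq (.mul (.const _) (.var 0)) (.add (.mul (.const _) (.var 0)) (.mul (.const _) (.var 0))))
    ?_ ?_ c
  · simp only [mul_zero, add_zero]
  · intro c h
    simp only [mul_succ, h]
    rw [add_assoc, add_assoc, ← add_assoc (b * c), ← add_assoc a, add_comm (b * c) a]

theorem zero_mul (a : M.Num) : 0 * a = 0 := by
  refine bdd_induction (P := fun a => 0 * a = 0) (.eq (.mul (.const _) (.var 0)) (.const _)) ?_ ?_ a
  · exact mul_zero 0
  · intro a h; rw [mul_succ, h, add_zero]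

theorem mul_one (a : M.Num) : a * 1 = a := by
  rw [← zero_add (1 : M.Num), mul_succ, mul_zero, zero_add]

theorem one_mul (a : M.Num) : 1 * a = a := by
  refine bdd_induction (P := fun a => 1 * a = a) (.eq (.mul (.const _) (.var 0)) (.var 0)) ?_ ?_ a
  · exact mul_zero 1
  · intro a h; rw [mul_succ, h]

theorem mul_comm (a b : M.Num) : a * b = b * a := by
  refine bdd_induction (P := fun b => a * b = b * a)
    (.eq (.mul (.const _) (.var 0)) (.mul (.var 0) (.const _))) ?_ ?_ b
  · rw [mul_zero, zero_mul]
  · intro b h; rw [mul_succ, add_mul, one_mul, h]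

theorem mul_add (a b c : M.Num) : a * (b + c) = a * b + a * c := by
  rw [mul_comm, add_mul, mul_comm b, mul_comm c]

theorem mul_assoc (a b c : M.Num) : a * b * c = a * (b * c) := by
  refine bdd_induction (P := fun c => a * b * c = a * (b * c))
    (.eq (.mul (.const _) (.var 0)) (.mul (.const _) (.mul (.const _) (.var 0)))) ?_ ?_ c
  · simp only [mul_zero]
  · intro c h; rw [mul_succ, mul_succ, mul_add, h]

theorem lt_add_succ (a b : M.Num) : a < a + b + 1 := by
  refine bdd_induction (P := fun b => a < a + b + 1)
    (.lt (.const _) (.add (.add (.const _) (.var 0)) (.const _))) ?_ ?_ b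
  · rw [add_zero, lt_succ]; exact .inr rfl
  · intro b h; rw [← add_assoc, lt_succ]; exact .inl h

theorem exists_add_of_lt {a b : M.Num} (h : a < b) : ∃ c, b = a + c + 1 := by
  have := sigma_induction (P := fun c b => a < b → b = a + c + 1)
    (.imp (.lt (.const _) (.var 1)) (.eq (.var 1) (.add (.add (.const _) (.var 0)) (.const _))))
    ⟨0, fun h => (not_lt_zero _ h).elim⟩ ?_ b
  · exact this.imp fun c hc => hc h
  · rintro b ⟨c, hc⟩
    by_cases hb : a < b
    · exact ⟨c + 1, fun _ => by rw [← add_assoc, ← hc hb]⟩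
    · refine ⟨0, fun h => ?_⟩
      rw [(lt_succ.1 h).resolve_left hb, add_zero]

theorem lt_iff {a b : M.Num} : a < b ↔ ∃ c, b = a + c + 1 :=
  ⟨exists_add_of_lt, fun ⟨c, hc⟩ => hc ▸ lt_add_succ a c⟩

theorem lt_irrefl (a : M.Num) : ¬ a < a := fun h => by
  obtain ⟨c, hc⟩ := exists_add_of_lt h
  rw [add_assoc, add_comm] at hc
  exact succ_ne_zero c (add_right_cancel (hc.symm.trans (zero_add a).symm))

theorem lt_trans {a b c : M.Num} (h₁ : a < b) (h₂ : b < c) : a < c := by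
  obtain ⟨d, rfl⟩ := exists_add_of_lt h₁
  obtain ⟨e, rfl⟩ := exists_add_of_lt h₂
  rw [lt_iff]
  exact ⟨d + 1 + e, by simp only [add_assoc]⟩

theorem zero_lt_succ (a : M.Num) : 0 < a + 1 := lt_iff.2 ⟨a, by rw [zero_add]⟩

theorem succ_lt_succ {a b : M.Num} (h : a < b) : a + 1 < b + 1 := by
  obtain ⟨c, rfl⟩ := exists_add_of_lt h
  exact lt_iff.2 ⟨c, by rw [succ_add a c]⟩

theorem zero_lt_or_eq (a : M.Num) : 0 < a ∨ 0 = a := by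
  refine bdd_induction (P := fun a => 0 < a ∨ 0 = a)
    (.or (.lt (.const _) (.var 0)) (.eq (.const _) (.var 0))) (.inr rfl) ?_ a
  exact fun a _ => .inl (zero_lt_succ a)

theorem succ_lt_or_eq_of_lt {a b : M.Num} (h : a < b) : a + 1 < b ∨ a + 1 = b := by
  obtain ⟨c, rfl⟩ := exists_add_of_lt h
  rcases zero_lt_or_eq c with hc | rfl
  · obtain ⟨d, rfl⟩ := exists_add_of_lt hc
    rw [zero_add, ← add_assoc]
    exact .inl (succ_lt_succ (lt_add_succ a d))
  · exact .inr (by rw [add_zero])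

theorem lt_trichotomy (a b : M.Num) : a < b ∨ a = b ∨ b < a := by
  refine bdd_induction (P := fun a => a < b ∨ a = b ∨ b < a)
    (.or (.lt (.var 0) (.const _)) (.or (.eq (.var 0) (.const _)) (.lt (.const _) (.var 0))))
    ?_ ?_ a
  · exact (zero_lt_or_eq b).imp_right .inl
  · rintro a (h | rfl | h)
    · exact (succ_lt_or_eq_of_lt h).imp_right .inl
    · exact .inr (.inr (lt_succ.2 (.inr rfl)))
    · exact .inr (.inr (lt_succ.2 (.inl h)))

end Arith

open Arith in
noncomputable instance : LinearOrder M.Num where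
  le a b := a < b ∨ a = b
  lt a b := a < b
  le_refl a := .inr rfl
  le_trans
    | _, _, _, .inl h₁, .inl h₂ => .inl (lt_trans h₁ h₂)
    | _, _, _, h₁, .inr rfl => h₁
    | _, _, _, .inr rfl, h₂ => h₂
  le_antisymm
    | a, _, .inl h₁, .inl h₂ => (lt_irrefl a (lt_trans h₁ h₂)).elim
    | _, _, _, .inr h₂ => h₂.symm
    | _, _, .inr h₁, _ => h₁
  lt_iff_le_not_ge a b := by
    refine ⟨fun h => ⟨.inl h, ?_⟩, fun h => h.1.resolve_right fun e => h.2 (.inr e.symm)⟩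
    rintro (h' | rfl)
    · exact lt_irrefl a (lt_trans h h')
    · exact lt_irrefl b h
  le_total a b := (lt_trichotomy a b).elim (.inl ∘ .inl) fun h =>
    h.elim (.inl ∘ .inr) (.inr ∘ .inl)
  toDecidableLE := Classical.decRel _

instance : CommSemiring M.Num where
  add_assoc := Arith.add_assoc
  zero_add := Arith.zero_add
  add_zero := Arith.add_zero
  nsmul := nsmulRec
  add_comm := Arith.add_comm
  left_distrib := Arith.mul_add
  right_distrib := Arith.add_mul
  zero_mul := Arith.zero_mul
  mul_zero := Arith.mul_zero
  mul_assoc := Arith.mul_assoc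
  one_mul := Arith.one_mul
  mul_one := Arith.mul_one
  mul_comm := Arith.mul_comm

theorem Arith.lt_add_one_iff {a b : M.Num} : a < b + 1 ↔ a ≤ b := Arith.lt_succ

theorem Arith.exists_add_of_le {a b : M.Num} (h : a ≤ b) : ∃ c, b = a + c := by
  obtain ⟨c, hc⟩ := Arith.exists_add_of_lt (Arith.lt_add_one_iff.2 h)
  exact ⟨c, Arith.succ_inj hc⟩

theorem Arith.le_add_right (a b : M.Num) : a ≤ a + b :=
  Arith.lt_add_one_iff.1 (Arith.lt_add_succ a b)

instance : IsOrderedCancelAddMonoid M.Num where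
  add_le_add_left a b h c := by
    obtain ⟨d, rfl⟩ := Arith.exists_add_of_le h
    rw [add_right_comm]
    exact Arith.le_add_right _ _
  le_of_add_le_add_left a b c h := by
    obtain ⟨d, hd⟩ := Arith.exists_add_of_le h
    rw [add_assoc, add_comm a, add_comm a] at hd
    rw [Arith.add_right_cancel hd]
    exact Arith.le_add_right _ _

instance : CanonicallyOrderedAdd M.Num where
  exists_add_of_le := Arith.exists_add_of_le
  le_add_self a b := by rw [add_comm]; exact Arith.le_add_right _ _
  le_self_add := Arith.le_add_right

instance : Nontrivial M.Num :=
  ⟨⟨0, 1, fun h => Arith.succ_ne_zero (0 : M.Num) (by rw [zero_add, h])⟩⟩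

theorem Arith.mul_lt_mul_of_pos_left {a b c : M.Num} (ha : 0 < a) (h : b < c) :
    a * b < a * c := by
  obtain ⟨d, rfl⟩ := exists_add_of_lt h
  obtain ⟨e, rfl⟩ := exists_add_of_lt ha
  have : (0 + e + 1) * (b + d + 1) = (0 + e + 1) * b + (d + e * d + e) + 1 := by ring
  rw [this]
  exact lt_add_succ _ _

instance : IsStrictOrderedRing M.Num where
  zero_le_one := (Arith.le_add_right 0 1).trans_eq (zero_add 1)
  mul_lt_mul_of_pos_left a ha _ _ h := Arith.mul_lt_mul_of_pos_left ha h
  mul_lt_mul_of_pos_right a ha b c h := by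
    rw [mul_comm b, mul_comm c]
    exact Arith.mul_lt_mul_of_pos_left ha h

theorem Arith.add_one_le_iff {a b : M.Num} : a + 1 ≤ b ↔ a < b := by
  rw [← Arith.lt_add_one_iff, add_lt_add_iff_right]

noncomputable instance : SuccOrder M.Num := .ofSuccLeIff (fun a => a + 1) Arith.add_one_le_iff

noncomputable instance : SuccAddOrder M.Num := ⟨fun _ => rfl⟩

open Classical in
noncomputable instance : Sub M.Num :=
  ⟨fun a b => if h : b ≤ a then (Arith.exists_add_of_le h).choose else 0⟩

instance : OrderedSub M.Num where
  tsub_le_iff_right a b c := by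
    by_cases h : b ≤ a
    · have hsub : a - b = (Arith.exists_add_of_le h).choose := dif_pos h
      rw [hsub, ← add_le_add_iff_left b, ← (Arith.exists_add_of_le h).choose_spec, add_comm b c]
    · have hsub : a - b = 0 := dif_neg h
      rw [hsub]
      exact iff_of_true zero_le ((le_of_not_ge h).trans le_add_self)

end Arithmetic

/-! ## Definable predicates and functions -/

section Definability

theorem Bdd.ball {t : (ℕ → M.Num) → M.Num} {R : M.Num → (ℕ → M.Num) → Prop} (ht : Poly t)
    (hR : Bdd fun v => R (v 0) fun i => v (i + 1)) : Bdd fun v => ∀ a, a < t v → R a v :=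
  .ball_cons ht hR

theorem Bdd.bex {t : (ℕ → M.Num) → M.Num} {R : M.Num → (ℕ → M.Num) → Prop} (ht : Poly t)
    (hR : Bdd fun v => R (v 0) fun i => v (i + 1)) : Bdd fun v => ∃ a, a < t v ∧ R a v :=
  (Bdd.ball (R := fun a v => ¬ R a v) ht hR.not).not.of_iff fun v => by push Not; rfl

/-- The pairing function `⟨a, b⟩ = (a + b)² + a`. -/
def pr (a b : M.Num) : M.Num := (a + b) * (a + b) + a

theorem Poly.pr {s t : (ℕ → M.Num) → M.Num} (hs : Poly s) (ht : Poly t) :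
    Poly fun v => pr (s v) (t v) :=
  .add (.mul (.add hs ht) (.add hs ht)) hs

/-- Predicates of the form `∃ y, Q y` with `Q` bounded, with parameters. -/
def Sigma1 (P : (ℕ → M.Num) → Prop) : Prop :=
  ∃ Q : (ℕ → M.Num) → Prop, Bdd Q ∧ ∀ v, P v ↔ ∃ y, Q (cons y v)

theorem Bdd.sigma1 {P : (ℕ → M.Num) → Prop} (h : Bdd P) : Sigma1 P :=
  ⟨_, h.lift, fun _ => ⟨fun h => ⟨0, h⟩, fun ⟨_, h⟩ => h⟩⟩

theorem Sigma1.of_iff {P Q : (ℕ → M.Num) → Prop} (hP : Sigma1 P) (h : ∀ v, Q v ↔ P v) : Sigma1 Q :=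
  (funext fun v => propext (h v) : Q = P) ▸ hP

theorem Sigma1.or {P Q : (ℕ → M.Num) → Prop} (hP : Sigma1 P) (hQ : Sigma1 Q) :
    Sigma1 fun v => P v ∨ Q v := by
  obtain ⟨P', hP', hP⟩ := hP
  obtain ⟨Q', hQ', hQ⟩ := hQ
  exact ⟨_, hP'.or hQ', fun v => by beta_reduce; rw [hP, hQ, exists_or]⟩

theorem Sigma1.subst {P : (ℕ → M.Num) → Prop} (hP : Sigma1 P) {σ : ℕ → (ℕ → M.Num) → M.Num}
    (hσ : ∀ i, Poly (σ i)) : Sigma1 fun v => P fun i => σ i v := by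
  obtain ⟨P', hP', hP⟩ := hP
  exact ⟨_, hP'.subst (poly_cons (.var 0) fun i => (hσ i).lift), fun v => hP fun i => σ i v⟩

theorem Sigma1.exists_dependsOn_Iio {P : (ℕ → M.Num) → Prop} (h : Sigma1 P) :
    ∃ n, DependsOn P (Set.Iio (n + 1)) := by
  obtain ⟨Q, hQ, h⟩ := h
  obtain ⟨n, hn⟩ := hQ.exists_dependsOn_Iio
  refine ⟨n, fun v v' hv => ?_⟩
  have hcons (y : M.Num) : Q (cons y v) = Q (cons y v') := hn fun
    | 0, _ => rfl
    | i + 1, hi => hv i ((Nat.lt_succ_self i).trans (Nat.lt_succ_of_lt hi))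
  simp only [h, hcons]

/-- Functions with a definable graph. -/
def RecFun (f : (ℕ → M.Num) → M.Num) : Prop := Bdd fun v => v 0 = f fun i => v (i + 1)

theorem Poly.recFun {f : (ℕ → M.Num) → M.Num} (h : Poly f) : RecFun f := .eq (.var 0) h.lift

theorem RecFun.subst {f : (ℕ → M.Num) → M.Num} (h : RecFun f) {σ : ℕ → (ℕ → M.Num) → M.Num}
    (hσ : ∀ i, Poly (σ i)) : RecFun fun v => f fun i => σ i v :=
  Bdd.subst h (poly_cons (.var 0) fun i => (hσ i).lift)

theorem RecFun.lift {f : (ℕ → M.Num) → M.Num} (h : RecFun f) :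
    RecFun fun v => f fun i => v (i + 1) :=
  h.subst fun i => .var (i + 1)

theorem RecFun.var (i : ℕ) : RecFun fun v : ℕ → M.Num => v i := (Poly.var i).recFun

theorem RecFun.const (a : M.Num) : RecFun fun _ => a := (Poly.const a).recFun

theorem recFun_cons {f : (ℕ → M.Num) → M.Num} {σ : ℕ → (ℕ → M.Num) → M.Num} (hf : RecFun f)
    (hσ : ∀ i, RecFun (σ i)) : ∀ i, RecFun fun v => cons (f v) (fun j => σ j v) i
  | 0 => hf
  | i + 1 => hσ i

theorem RecFun.ite {P : (ℕ → M.Num) → Prop} [DecidablePred P] {f g : (ℕ → M.Num) → M.Num}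
    (hP : Bdd P) (hf : RecFun f) (hg : RecFun g) : RecFun fun v => if P v then f v else g v := by
  refine ((hP.lift.and hf).or (hP.lift.not.and hg)).of_iff fun v => ?_
  by_cases h : P fun i => v (i + 1) <;> simp [h]

variable [IsRCA M]

theorem pr_lt_pr_of_add_lt_add {a b c d : M.Num} (h : a + b < c + d) : pr a b < pr c d := by
  obtain ⟨e, he⟩ := Arith.exists_add_of_lt h
  have hpr : pr c d = pr a b + (a + 2 * b + 2 * e * (a + b) + (e + 1) * e + e + c) + 1 := by
    simp only [pr, he]
    ring
  rw [hpr]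
  exact Arith.lt_add_succ _ _

theorem pr_inj {a b c d : M.Num} : pr a b = pr c d ↔ a = c ∧ b = d := by
  refine ⟨fun h => ?_, fun ⟨h₁, h₂⟩ => h₁ ▸ h₂ ▸ rfl⟩
  have hsum : a + b = c + d := le_antisymm
    (not_lt.1 fun hlt => (pr_lt_pr_of_add_lt_add hlt).ne' h)
    (not_lt.1 fun hlt => (pr_lt_pr_of_add_lt_add hlt).ne h)
  rw [pr, pr, hsum] at h
  obtain rfl := add_left_cancel h
  exact ⟨rfl, add_left_cancel hsum⟩

theorem left_le_pr (a b : M.Num) : a ≤ pr a b := le_add_self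

theorem right_le_pr (a b : M.Num) : b ≤ pr a b := by
  rcases eq_or_ne b 0 with rfl | hb
  · exact zero_le
  · have hone : 1 ≤ a + b := (Order.one_le_iff_ne_zero.2 hb).trans le_add_self
    calc b ≤ a + b := le_add_self
      _ ≤ (a + b) * (a + b) := le_mul_of_one_le_left zero_le hone
      _ ≤ pr a b := le_self_add

theorem Sigma1.ex {R : M.Num → (ℕ → M.Num) → Prop}
    (h : Sigma1 fun v => R (v 0) fun i => v (i + 1)) : Sigma1 fun v => ∃ a, R a v := by
  obtain ⟨Q, hQ, h⟩ := h
  refine ⟨fun v => ∃ a, a < v 0 + 1 ∧ ∃ y, y < v 0 + 1 ∧ Q (cons y (cons a fun i => v (i + 1))),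
    .bex (.add (.var 0) (.const 1)) (.bex (.add (.var 1) (.const 1))
      (hQ.subst (poly_cons (.var 0) (poly_cons (.var 1) fun i => .var (i + 3))))), fun v => ?_⟩
  constructor
  · rintro ⟨a, ha⟩
    obtain ⟨y, hy⟩ := (h (cons a v)).1 ha
    exact ⟨a + y, a, Order.lt_add_one_iff.2 le_self_add, y, Order.lt_add_one_iff.2 le_add_self, hy⟩
  · rintro ⟨_, a, _, y, _, hy⟩
    exact ⟨a, (h (cons a v)).2 ⟨y, hy⟩⟩

theorem Sigma1.and {P Q : (ℕ → M.Num) → Prop} (hP : Sigma1 P) (hQ : Sigma1 Q) :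
    Sigma1 fun v => P v ∧ Q v := by
  obtain ⟨P', hP', hP⟩ := hP
  obtain ⟨Q', hQ', hQ⟩ := hQ
  have hex : Sigma1 fun v => ∃ a, ∃ b, P' (cons a v) ∧ Q' (cons b v) :=
    .ex (.ex (Bdd.sigma1 ((hP'.subst (poly_cons (.var 1) fun i => .var (i + 2))).and
      (hQ'.subst (poly_cons (.var 0) fun i => .var (i + 2))))))
  refine hex.of_iff fun v => ?_
  rw [hP, hQ]
  exact ⟨fun ⟨⟨a, ha⟩, b, hb⟩ => ⟨a, b, ha, hb⟩, fun ⟨a, b, ha, hb⟩ => ⟨⟨a, ha⟩, b, hb⟩⟩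

theorem sigma1_induction {P : M.Num → Prop} (hP : Sigma1 fun v => P (v 0))
    (h₀ : P 0) (h₁ : ∀ x, P x → P (x + 1)) (x : M.Num) : P x := by
  obtain ⟨Q, hQ, h⟩ := hP
  have hPQ (x : M.Num) : P x ↔ ∃ y, Q (cons y fun _ => x) := h fun _ => x
  exact (hPQ x).2 (sigma_induction (P := fun y x => Q (cons y fun _ => x))
    (hQ.subst (poly_cons (.var 0) fun _ => .var 1)) ((hPQ 0).1 h₀)
    (fun x hx => (hPQ _).1 (h₁ x ((hPQ x).2 hx))) x)

theorem mem_sets_of_delta {P : M.Num → Prop} (h₁ : Sigma1 fun v => P (v 0))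
    (h₂ : Sigma1 fun v => ¬ P (v 0)) : {x | P x} ∈ M.Sets := by
  obtain ⟨Q₁, hQ₁, h₁⟩ := h₁
  obtain ⟨Q₂, hQ₂, h₂⟩ := h₂
  have hP (x : M.Num) : P x ↔ ∃ y, Q₁ (cons y fun _ => x) := h₁ fun _ => x
  have hnot (x : M.Num) : ¬ P x ↔ ∃ y, Q₂ (cons y fun _ => x) := h₂ fun _ => x
  simp only [hP]
  exact delta_comprehension (P := fun y x => Q₁ (cons y fun _ => x))
    (Q := fun y x => ¬ Q₂ (cons y fun _ => x))
    (hQ₁.subst (poly_cons (.var 0) fun _ => .var 1))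
    (hQ₂.subst (poly_cons (.var 0) fun _ => .var 1)).not fun x => by
      rw [← hP, ← not_exists, ← hnot, not_not]

/-- A predicate of several variables becomes a set by coding the variables as one number. -/
theorem bdd_of_dependsOn_Iio {Γ : ((ℕ → M.Num) → Prop) → Prop}
    (hmem : ∀ P, Γ P → {x | P fun _ => x} ∈ M.Sets)
    (hpr : ∀ P, Γ P → Γ fun v => ∃ a, ∃ b, v 0 = pr a b ∧ P (cons a (cons b fun i => v (i + 1))))
    {n : ℕ} {P : (ℕ → M.Num) → Prop} (h : Γ P) (hn : DependsOn P (Set.Iio (n + 1))) : Bdd P := by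
  induction n generalizing P with
  | zero =>
    exact (Bdd.mem (.var 0) (hmem P h)).of_iff fun v => Iff.of_eq <| hn fun i hi => by
      rw [Nat.lt_one_iff.1 hi]
  | succ n ih =>
    have hbdd := ih (hpr P h) fun v v' h => by
      have hcons (a b : M.Num) : P (cons a (cons b fun i => v (i + 1))) =
          P (cons a (cons b fun i => v' (i + 1))) := hn fun
        | 0, _ | 1, _ => rfl
        | i + 2, hi => h (i + 1) (Nat.lt_of_succ_lt_succ hi)
      simp only [h 0 (Nat.succ_pos n), hcons]
    refine (hbdd.subst (poly_cons (.pr (.var 0) (.var 1)) fun i => .var (i + 2))).of_iff fun v => ?_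
    have heta : cons (v 0) (cons (v 1) fun i => v (i + 2)) = v := by
      funext i
      rcases i with _ | _ | i <;> rfl
    refine ⟨fun hv => ⟨v 0, v 1, rfl, heta.symm ▸ hv⟩, ?_⟩
    rintro ⟨a, b, hab, hv⟩
    obtain ⟨rfl, rfl⟩ := pr_inj.1 hab
    exact heta ▸ hv

theorem Sigma1.unpair {P : (ℕ → M.Num) → Prop} (h : Sigma1 P) :
    Sigma1 fun v => ∃ a, ∃ b, v 0 = pr a b ∧ P (cons a (cons b fun i => v (i + 1))) :=
  .ex (.ex (.and (Bdd.eq (.var 2) (.pr (.var 1) (.var 0))).sigma1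
    (h.subst (poly_cons (.var 1) (poly_cons (.var 0) fun i => .var (i + 3))))))

theorem bdd_of_delta {P : (ℕ → M.Num) → Prop} (h₁ : Sigma1 P) (h₂ : Sigma1 fun v => ¬ P v) :
    Bdd P := by
  obtain ⟨n, hn⟩ := h₁.exists_dependsOn_Iio
  refine bdd_of_dependsOn_Iio (Γ := fun P => Sigma1 P ∧ Sigma1 fun v => ¬ P v)
    (fun P h => mem_sets_of_delta (P := fun x => P fun _ => x) (h.1.subst fun _ => .var 0)
      (h.2.subst fun _ => .var 0)) (fun P h => ⟨h.1.unpair, ?_⟩) ⟨h₁, h₂⟩ hn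
  have hnotPair : Bdd fun v : ℕ → M.Num => ¬ ∃ a, a < v 0 + 1 ∧ ∃ b, b < v 0 + 1 ∧ v 0 = pr a b :=
    .not (.bex (.add (.var 0) (.const 1)) (.bex (.add (.var 1) (.const 1))
      (.eq (.var 2) (.pr (.var 1) (.var 0)))))
  refine (hnotPair.sigma1.or h.2.unpair).of_iff fun v => ?_
  by_cases hpair : ∃ a b, v 0 = pr a b
  · obtain ⟨a, b, hab⟩ := hpair
    have hbounds : ∃ a', a' < v 0 + 1 ∧ ∃ b', b' < v 0 + 1 ∧ v 0 = pr a' b' :=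
      ⟨a, Order.lt_add_one_iff.2 (hab ▸ left_le_pr a b), b,
        Order.lt_add_one_iff.2 (hab ▸ right_le_pr a b), hab⟩
    simp only [hbounds, not_true_eq_false, false_or]
    simp [hab, pr_inj]
  · simp_all

theorem RecFun.of_sigma1 {f : (ℕ → M.Num) → M.Num}
    (h : Sigma1 fun v => v 0 = f fun i => v (i + 1)) : RecFun f := by
  refine bdd_of_delta h ?_
  have hne : Sigma1 fun v : ℕ → M.Num => ∃ a, a = f (fun i => v (i + 1)) ∧ v 0 ≠ a :=
    .ex (.and (h.subst (poly_cons (.var 0) fun i => .var (i + 2)))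
      (Bdd.eq (.var 1) (.var 0)).not.sigma1)
  exact hne.of_iff fun v => by simp

theorem Bdd.app {R : M.Num → (ℕ → M.Num) → Prop} {f : (ℕ → M.Num) → M.Num}
    (hR : Bdd fun v => R (v 0) fun i => v (i + 1)) (hf : RecFun f) : Bdd fun v => R (f v) v :=
  have hgraph : Sigma1 fun v => v 0 = f fun i => v (i + 1) := Bdd.sigma1 hf
  bdd_of_delta
    ((Sigma1.ex (R := fun a v => a = f v ∧ R a v) (hgraph.and hR.sigma1)).of_iff fun v => by simp)
    ((Sigma1.ex (R := fun a v => a = f v ∧ ¬ R a v) (hgraph.and hR.not.sigma1)).of_iff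
      fun v => by simp)

theorem Bdd.rsubst_of_le {P : (ℕ → M.Num) → Prop} (hP : Bdd P) (n : ℕ)
    {σ : ℕ → (ℕ → M.Num) → M.Num} (hσ : ∀ i, RecFun (σ i)) (hpoly : ∀ i, n ≤ i → Poly (σ i)) :
    Bdd fun v => P fun i => σ i v := by
  induction n generalizing σ with
  | zero => exact hP.subst fun i => hpoly i i.zero_le
  | succ n ih =>
    have happ := Bdd.app (R := fun a v => P (Function.update (fun i => σ i v) n a)) ?_ (hσ n)
    · exact happ.of_iff fun v => by rw [Function.update_eq_self]
    refine (ih (σ := Function.update (fun i v => σ i fun j => v (j + 1)) n fun v => v 0)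
      (fun i => ?_) fun i hi => ?_).of_iff fun v => ?_
    · rcases eq_or_ne i n with rfl | hne
      · simpa using RecFun.var 0
      · simpa [hne] using (hσ i).lift
    · rcases hi.eq_or_lt with rfl | hlt
      · simpa using Poly.var 0
      · simpa [hlt.ne'] using (hpoly i hlt).lift
    · refine Iff.of_eq (congrArg P (funext fun i => ?_))
      rcases eq_or_ne i n with rfl | hne <;> simp [*]

theorem Bdd.rsubst {P : (ℕ → M.Num) → Prop} (hP : Bdd P) {σ : ℕ → (ℕ → M.Num) → M.Num}
    (hσ : ∀ i, RecFun (σ i)) : Bdd fun v => P fun i => σ i v := by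
  obtain ⟨n, hn⟩ := hP.exists_dependsOn_Iio
  have hbdd := hP.rsubst_of_le n (σ := fun i => if i < n then σ i else fun _ => 0)
    (fun i => by split_ifs; exacts [hσ i, .const 0])
    fun i hi => by rw [if_neg hi.not_gt]; exact .const 0
  exact hbdd.of_iff fun v => Iff.of_eq (hn fun i hi => by rw [if_pos (Set.mem_Iio.1 hi)])

theorem RecFun.rsubst {f : (ℕ → M.Num) → M.Num} (h : RecFun f) {σ : ℕ → (ℕ → M.Num) → M.Num}
    (hσ : ∀ i, RecFun (σ i)) : RecFun fun v => f fun i => σ i v :=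
  Bdd.rsubst h (recFun_cons (.var 0) fun i => (hσ i).lift)

section Composition

variable {f g h : (ℕ → M.Num) → M.Num}

theorem Bdd.comp₁ {P : M.Num → Prop} (hP : Bdd fun v => P (v 0)) (hf : RecFun f) :
    Bdd fun v => P (f v) :=
  hP.rsubst fun _ => hf

theorem Bdd.comp₂ {P : M.Num → M.Num → Prop} (hP : Bdd fun v => P (v 0) (v 1))
    (hf : RecFun f) (hg : RecFun g) : Bdd fun v => P (f v) (g v) :=
  hP.rsubst (recFun_cons hf fun _ => hg)

theorem RecFun.comp₁ {k : M.Num → M.Num} (hk : RecFun fun v => k (v 0)) (hf : RecFun f) :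
    RecFun fun v => k (f v) :=
  hk.rsubst fun _ => hf

theorem RecFun.comp₂ {k : M.Num → M.Num → M.Num} (hk : RecFun fun v => k (v 0) (v 1))
    (hf : RecFun f) (hg : RecFun g) : RecFun fun v => k (f v) (g v) :=
  hk.rsubst (recFun_cons hf fun _ => hg)

theorem RecFun.comp₃ {k : M.Num → M.Num → M.Num → M.Num}
    (hk : RecFun fun v => k (v 0) (v 1) (v 2)) (hf : RecFun f) (hg : RecFun g) (hh : RecFun h) :
    RecFun fun v => k (f v) (g v) (h v) :=
  hk.rsubst (recFun_cons hf (recFun_cons hg fun _ => hh))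

theorem RecFun.add (hf : RecFun f) (hg : RecFun g) : RecFun fun v => f v + g v :=
  .comp₂ (k := fun a b => a + b) (Poly.add (.var 0) (.var 1)).recFun hf hg

theorem RecFun.mul (hf : RecFun f) (hg : RecFun g) : RecFun fun v => f v * g v :=
  .comp₂ (k := fun a b => a * b) (Poly.mul (.var 0) (.var 1)).recFun hf hg

theorem RecFun.pr (hf : RecFun f) (hg : RecFun g) : RecFun fun v => pr (f v) (g v) :=
  .add (.mul (.add hf hg) (.add hf hg)) hf

theorem Bdd.recEq (hf : RecFun f) (hg : RecFun g) : Bdd fun v => f v = g v :=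
  .comp₂ (P := fun a b => a = b) (.eq (.var 0) (.var 1)) hf hg

theorem Bdd.recLt (hf : RecFun f) (hg : RecFun g) : Bdd fun v => f v < g v :=
  .comp₂ (P := fun a b => a < b) (.lt (.var 0) (.var 1)) hf hg

theorem Bdd.recLe (hf : RecFun f) (hg : RecFun g) : Bdd fun v => f v ≤ g v :=
  (Bdd.recLt hg hf).not.of_iff fun _ => not_lt.symm

theorem Bdd.recMem {A : Set M.Num} (hf : RecFun f) (hA : A ∈ M.Sets) : Bdd fun v => f v ∈ A :=
  .comp₁ (P := fun a => a ∈ A) (.mem (.var 0) hA) hf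

theorem Bdd.recBall {R : M.Num → (ℕ → M.Num) → Prop} (hf : RecFun f)
    (hR : Bdd fun v => R (v 0) fun i => v (i + 1)) : Bdd fun v => ∀ a, a < f v → R a v :=
  Bdd.app (R := fun b v => ∀ a, a < b → R a v)
    (.ball (.var 0) (hR.subst (poly_cons (.var 0) fun i => .var (i + 2)))) hf

theorem Bdd.recBex {R : M.Num → (ℕ → M.Num) → Prop} (hf : RecFun f)
    (hR : Bdd fun v => R (v 0) fun i => v (i + 1)) : Bdd fun v => ∃ a, a < f v ∧ R a v :=
  (Bdd.recBall (R := fun a v => ¬ R a v) hf hR.not).not.of_iff fun v => by push Not; rfl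

theorem RecFun.sub (hf : RecFun f) (hg : RecFun g) : RecFun fun v => f v - g v := by
  refine .comp₂ (k := fun a b => a - b) ?_ hf hg
  refine (Bdd.or (.and (.recLe (.var 2) (.var 1)) (.recEq (.add (.var 0) (.var 2)) (.var 1)))
    (.and (.lt (.var 1) (.var 2)) (.eq (.var 0) (.const 0)))).of_iff fun v => ?_
  change v 0 = v 1 - v 2 ↔ _
  rcases le_or_gt (v 2) (v 1) with h | h
  · simp [eq_tsub_iff_add_eq_of_le h, h, h.not_gt]
  · simp [tsub_eq_zero_of_le h.le, h, h.not_ge]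

end Composition

theorem mem_sets {P : M.Num → Prop} (h : Bdd fun v => P (v 0)) : {x | P x} ∈ M.Sets :=
  mem_sets_of_delta h.sigma1 h.not.sigma1

theorem strong_induction {P : M.Num → Prop} (hP : Bdd fun v => P (v 0))
    (h : ∀ x, (∀ y, y < x → P y) → P x) (x : M.Num) : P x := by
  refine h x (bdd_induction (P := fun x => ∀ y, y < x → P y) (.ball (.var 0) (hP.comp₁ (.var 0)))
    (fun y hy => (not_lt_zero hy).elim) (fun x ih y hy => ?_) x)
  rcases (Order.lt_add_one_iff.1 hy).lt_or_eq with hlt | rfl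
  exacts [ih y hlt, h y ih]

theorem exists_least {P : M.Num → Prop} (hP : Sigma1 fun v => P (v 0)) (h : ∃ x, P x) :
    ∃ x, P x ∧ ∀ y, P y → x ≤ y := by
  by_contra! hc
  obtain ⟨z, hz⟩ := h
  have descent : ∀ n, ∃ x, P x ∧ x + n ≤ z := by
    refine sigma1_induction (P := fun n => ∃ x, P x ∧ x + n ≤ z)
      (.ex (.and (hP.subst (σ := fun _ v => v 0) fun _ => .var 0)
        (Bdd.recLe (.add (.var 0) (.var 1)) (.const z)).sigma1)) ⟨z, hz, (add_zero z).le⟩ ?_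
    rintro n ⟨x, hx, hle⟩
    obtain ⟨y, hy, hyx⟩ := hc x hx
    refine ⟨y, hy, le_trans ?_ hle⟩
    rw [add_comm n 1, ← add_assoc]
    gcongr
    exact Order.add_one_le_iff.2 hyx
  obtain ⟨x, -, hx⟩ := descent (z + 1)
  exact (Order.add_one_le_iff.1 (le_add_self.trans hx)).false

theorem Bdd.exists_recFun {R : M.Num → (ℕ → M.Num) → Prop}
    (hR : Bdd fun v => R (v 0) fun i => v (i + 1)) (h : ∀ v, ∃ y, R y v) :
    ∃ f, RecFun f ∧ ∀ v, R (f v) v := by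
  choose f hf hle using fun v => exists_least (P := fun y => R y v)
    (hR.subst (poly_cons (.var 0) fun i => .const (v i))).sigma1 (h v)
  refine ⟨f, ?_, hf⟩
  refine (hR.and (Bdd.ball (R := fun a v => ¬ R a fun i => v (i + 1)) (.var 0)
    (hR.subst (poly_cons (.var 0) fun i => .var (i + 2))).not)).of_iff fun v => ?_
  refine ⟨fun h => h ▸ ⟨hf _, fun y hy hRy => hy.not_ge (hle _ y hRy)⟩, fun ⟨h, hmin⟩ => ?_⟩
  exact le_antisymm (not_lt.1 fun hlt => hmin _ hlt (hf _)) (hle _ _ h)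

end Definability

/-! ## Primitive recursion -/

section PrimitiveRecursion

/-- The moduli of Gödel's `β`-function. -/
def modulus (u x : M.Num) : M.Num := 1 + (x + 1) * u

variable [IsRCA M]

/-- `x` belongs to the finite set with code `(a, u, m)`. -/
def InCode (a u m x : M.Num) : Prop := x < a ∧ modulus u x ∣ m

theorem dvd_iff_exists_lt {a b : M.Num} : a ∣ b ↔ ∃ k, k < b + 1 ∧ b = a * k := by
  refine ⟨fun ⟨k, hk⟩ => ?_, fun ⟨k, _, hk⟩ => ⟨k, hk⟩⟩
  rcases eq_or_ne a 0 with rfl | ha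
  · exact ⟨0, Order.lt_add_one_iff.2 zero_le, by rw [hk, zero_mul, zero_mul]⟩
  · exact ⟨k, Order.lt_add_one_iff.2 (hk ▸ le_mul_of_one_le_left zero_le
      (Order.one_le_iff_ne_zero.2 ha)), hk⟩

theorem Bdd.dvd {f g : (ℕ → M.Num) → M.Num} (hf : RecFun f) (hg : RecFun g) :
    Bdd fun v => f v ∣ g v := by
  refine .comp₂ (P := fun a b => a ∣ b) ?_ hf hg
  exact (Bdd.bex (.add (.var 1) (.const 1)) (.eq (.var 2) (.mul (.var 1) (.var 0)))).of_iff
    fun v => dvd_iff_exists_lt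

theorem dvd_of_dvd_add_left {d a b : M.Num} (h : d ∣ a + b) (ha : d ∣ a) : d ∣ b := by
  obtain ⟨c, rfl⟩ := ha
  obtain ⟨e, he⟩ := h
  exact ⟨e - c, by rw [mul_tsub, ← he, add_tsub_cancel_left]⟩

theorem modulus_dvd_of_dvd_mul {u i k m : M.Num} (hk : k ∣ u) (h : modulus u i ∣ m * k) :
    modulus u i ∣ m := by
  obtain ⟨c, rfl⟩ := hk
  have hmul : modulus (k * c) i ∣ m * (k * c) * (i + 1) := by
    rw [show m * (k * c) * (i + 1) = m * k * (c * (i + 1)) by ring]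
    exact h.mul_right _
  exact dvd_of_dvd_add_left ⟨m, by unfold modulus; ring⟩ hmul

theorem modulus_dvd_mul_modulus_iff {a u i j m : M.Num} (hu : ∀ l, l < a → l + 1 ∣ u) (hi : i < a)
    (hj : j < a) (hij : i ≠ j) : modulus u i ∣ m * modulus u j ↔ modulus u i ∣ m := by
  refine ⟨fun h => ?_, fun h => h.mul_right _⟩
  rcases lt_or_gt_of_ne hij with hlt | hlt
  · obtain ⟨k, rfl⟩ := Arith.exists_add_of_lt hlt
    have hk : k < a := (lt_of_le_of_lt le_add_self (lt_add_one _)).trans hj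
    refine modulus_dvd_of_dvd_mul (hu k hk)
      (dvd_of_dvd_add_left (a := m * modulus u (i + k + 1) * (i + 1)) ?_ (h.mul_right _))
    exact ⟨m * (i + k + 1 + 1), by unfold modulus; ring⟩
  · obtain ⟨k, rfl⟩ := Arith.exists_add_of_lt hlt
    have hk : k < a := (lt_of_le_of_lt le_add_self (lt_add_one _)).trans hi
    refine modulus_dvd_of_dvd_mul (hu k hk) (dvd_of_dvd_add_left ?_ ⟨m * (j + 1), mul_comm _ _⟩)
    rw [show m * (j + 1) * modulus u (j + k + 1) + m * (k + 1) =
      m * modulus u j * (j + k + 1 + 1) by unfold modulus; ring]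
    exact h.mul_right _

theorem not_modulus_dvd_one {u : M.Num} (hu : u ≠ 0) (i : M.Num) : ¬ modulus u i ∣ 1 := by
  rintro ⟨c, hc⟩
  have hc₀ : c ≠ 0 := by
    rintro rfl
    exact one_ne_zero (hc.trans (mul_zero _))
  have hone : 1 < modulus u i :=
    lt_add_of_pos_right _ (pos_iff_ne_zero.2 (mul_ne_zero (Arith.succ_ne_zero i) hu))
  exact ((hone.trans_le (le_mul_of_one_le_right zero_le (Order.one_le_iff_ne_zero.2 hc₀))).ne hc)

theorem exists_common_multiple (a : M.Num) : ∃ u : M.Num, u ≠ 0 ∧ ∀ i, i < a → i + 1 ∣ u := by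
  refine sigma_induction (P := fun u a => u ≠ 0 ∧ ∀ i, i < a → i + 1 ∣ u)
    (.and (.not (.eq (.var 0) (.const 0)))
      (.ball (.var 1) (.dvd (.add (.var 0) (.const 1)) (.var 1)))) ?_ ?_ a
  · exact ⟨1, one_ne_zero, fun i hi => (not_lt_zero hi).elim⟩
  · rintro a ⟨u, hu, h⟩
    refine ⟨u * (a + 1), mul_ne_zero hu (Arith.succ_ne_zero a), fun i hi => ?_⟩
    rcases (Order.lt_add_one_iff.1 hi).lt_or_eq with hlt | rfl
    exacts [(h i hlt).mul_right _, ⟨u, mul_comm _ _⟩]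

theorem RecFun.modulus {f g : (ℕ → M.Num) → M.Num} (hf : RecFun f) (hg : RecFun g) :
    RecFun fun v => modulus (f v) (g v) :=
  .add (.const 1) (.mul (.add hg (.const 1)) hf)

theorem Bdd.inCode {f g h k : (ℕ → M.Num) → M.Num} (hf : RecFun f) (hg : RecFun g)
    (hh : RecFun h) (hk : RecFun k) : Bdd fun v => InCode (f v) (g v) (h v) (k v) :=
  .and (.recLt hk hf) (.dvd (.modulus hg hk) hh)

theorem exists_modulus_dvd_iff {A : M.Num → Prop} (hA : Bdd fun v => A (v 0)) {a u : M.Num}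
    (hu₀ : u ≠ 0) (hu : ∀ l, l < a → l + 1 ∣ u) (j : M.Num) :
    ∃ m, ∀ i, i < a → (modulus u i ∣ m ↔ i < j ∧ A i) := by
  refine sigma_induction (P := fun m j => ∀ i, i < a → (modulus u i ∣ m ↔ i < j ∧ A i))
    (.ball (.const a) (.iff (.dvd (.modulus (.const u) (.var 0)) (.var 1))
      (.and (.lt (.var 0) (.var 2)) (hA.comp₁ (.var 0))))) ?_ ?_ j
  · exact ⟨1, fun i _ => iff_of_false (not_modulus_dvd_one hu₀ i) fun h => not_lt_zero h.1⟩
  · rintro j ⟨m, hm⟩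
    by_cases hj : j < a ∧ A j
    · refine ⟨m * modulus u j, fun i hi => ?_⟩
      rcases eq_or_ne i j with rfl | hij
      · exact iff_of_true (dvd_mul_left _ _) ⟨lt_add_one i, hj.2⟩
      · rw [modulus_dvd_mul_modulus_iff hu hi hj.1 hij, hm i hi, Order.lt_add_one_iff,
          hij.le_iff_lt]
    · refine ⟨m, fun i hi => ?_⟩
      have hne : A i → i ≠ j := by
        rintro hAi rfl
        exact hj ⟨hi, hAi⟩
      rw [hm i hi, Order.lt_add_one_iff]
      exact and_congr_left fun hAi => (hne hAi).le_iff_lt.symm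

theorem exists_code {A : M.Num → Prop} (hA : Bdd fun v => A (v 0)) (a : M.Num) :
    ∃ u m, ∀ x, InCode a u m x ↔ x < a ∧ A x := by
  obtain ⟨u, hu₀, hu⟩ := exists_common_multiple a
  obtain ⟨m, hm⟩ := exists_modulus_dvd_iff hA hu₀ hu a
  exact ⟨u, m, fun x => and_congr_right fun hx => (hm x hx).trans (and_iff_right hx)⟩

theorem InCode.lt_of_pr {a u m i z : M.Num} (h : InCode a u m (pr i z)) : i < a ∧ z < a :=
  ⟨(left_le_pr i z).trans_lt h.1, (right_le_pr i z).trans_lt h.1⟩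

/-- `(a, u, m)` codes a computation, by the recursion `f₀`, `f` with parameter `s`, that assigns the
value `y` to the argument `n`. -/
def Computation (f₀ : M.Num → M.Num) (f : M.Num → M.Num → M.Num → M.Num)
    (s a u m n y : M.Num) : Prop :=
  InCode a u m (pr n y) ∧ ∀ i, i < a → ∀ z, z < a → InCode a u m (pr i z) →
    (i = 0 ∧ z = f₀ s) ∨ ∃ j, j < a ∧ ∃ w, w < a ∧
      i = j + 1 ∧ z = f s j w ∧ InCode a u m (pr j w)

section Recursion

variable {f₀ : M.Num → M.Num} {f : M.Num → M.Num → M.Num → M.Num} {s a u m : M.Num}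

theorem Computation.eq_zero {y : M.Num} (h : Computation f₀ f s a u m 0 y) : y = f₀ s := by
  rcases h.2 _ h.1.lt_of_pr.1 _ h.1.lt_of_pr.2 h.1 with ⟨_, hy⟩ | ⟨j, _, _, _, hj, _⟩
  exacts [hy, (Arith.succ_ne_zero j hj.symm).elim]

theorem Computation.exists_eq_succ {n y : M.Num} (h : Computation f₀ f s a u m (n + 1) y) :
    ∃ w, y = f s n w ∧ Computation f₀ f s a u m n w := by
  rcases h.2 _ h.1.lt_of_pr.1 _ h.1.lt_of_pr.2 h.1 with ⟨hn, _⟩ | ⟨j, _, w, _, hj, hy, hw⟩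
  · exact (Arith.succ_ne_zero n hn).elim
  · obtain rfl := Arith.succ_inj hj
    exact ⟨w, hy, hw, h.2⟩

theorem Bdd.computation (hf₀ : RecFun fun v => f₀ (v 0))
    (hf : RecFun fun v => f (v 0) (v 1) (v 2)) {s a u m n y : (ℕ → M.Num) → M.Num} (hs : RecFun s)
    (ha : RecFun a) (hu : RecFun u) (hm : RecFun m) (hn : RecFun n) (hy : RecFun y) :
    Bdd fun v => Computation f₀ f (s v) (a v) (u v) (m v) (n v) (y v) := by
  refine .and (.inCode ha hu hm (.pr hn hy)) (.recBall ha (.recBall ha.lift (.imp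
    (.inCode ha.lift.lift hu.lift.lift hm.lift.lift (.pr (.var 1) (.var 0)))
    (.or (.and (.eq (.var 1) (.const 0)) (.recEq (.var 0) (hf₀.comp₁ hs.lift.lift)))
      (.recBex ha.lift.lift (.recBex ha.lift.lift.lift (.and
        (.eq (.var 3) (.add (.var 1) (.const 1)))
        (.and (.recEq (.var 2) (hf.comp₃ hs.lift.lift.lift.lift (.var 1) (.var 0)))
          (.inCode ha.lift.lift.lift.lift hu.lift.lift.lift.lift hm.lift.lift.lift.lift
            (.pr (.var 1) (.var 0)))))))))))

theorem Computation.unique (hf₀ : RecFun fun v => f₀ (v 0))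
    (hf : RecFun fun v => f (v 0) (v 1) (v 2)) {a' u' m' n y y' : M.Num}
    (h : Computation f₀ f s a u m n y) (h' : Computation f₀ f s a' u' m' n y') : y = y' := by
  refine bdd_induction (P := fun n => ∀ z, z < a → ∀ z', z' < a' → Computation f₀ f s a u m n z →
    Computation f₀ f s a' u' m' n z' → z = z') ?_ ?_ ?_ n y h.1.lt_of_pr.2 y' h'.1.lt_of_pr.2 h h'
  · exact .ball (.const a) (.ball (.const a') (.imp
      (.computation hf₀ hf (.const s) (.const a) (.const u) (.const m) (.var 2) (.var 1))
      (.imp (.computation hf₀ hf (.const s) (.const a') (.const u') (.const m') (.var 2) (.var 0))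
        (.eq (.var 1) (.var 0)))))
  · intro z _ z' _ hz hz'
    exact hz.eq_zero.trans hz'.eq_zero.symm
  · intro n ih z _ z' _ hz hz'
    obtain ⟨w, rfl, hw⟩ := hz.exists_eq_succ
    obtain ⟨w', rfl, hw'⟩ := hz'.exists_eq_succ
    rw [ih w hw.1.lt_of_pr.2 w' hw'.1.lt_of_pr.2 hw hw']

theorem exists_computation_zero (f₀ : M.Num → M.Num) (f : M.Num → M.Num → M.Num → M.Num)
    (s : M.Num) : ∃ a u m, Computation f₀ f s a u m 0 (f₀ s) := by
  obtain ⟨u, m, h⟩ := exists_code (A := fun x => x = pr 0 (f₀ s)) (.eq (.var 0) (.const _))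
    (pr 0 (f₀ s) + 1)
  exact ⟨_, u, m, (h _).2 ⟨lt_add_one _, rfl⟩,
    fun i _ z _ hiz => .inl (pr_inj.1 ((h _).1 hiz).2)⟩

theorem Computation.exists_succ {n y : M.Num} (hc : Computation f₀ f s a u m n y) :
    ∃ a' u' m', Computation f₀ f s a' u' m' (n + 1) (f s n y) := by
  obtain ⟨u', m', h⟩ := exists_code (A := fun x => InCode a u m x ∨ x = pr (n + 1) (f s n y))
    (.or (.inCode (.const _) (.const _) (.const _) (.var 0)) (.eq (.var 0) (.const _)))
    (a + pr (n + 1) (f s n y) + 1)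
  have hle (x : M.Num) (hx : InCode a u m x) : InCode (a + pr (n + 1) (f s n y) + 1) u' m' x :=
    (h x).2 ⟨hx.1.trans_le (by rw [add_assoc]; exact le_self_add), .inl hx⟩
  refine ⟨_, u', m', (h _).2 ⟨Order.lt_add_one_iff.2 le_add_self, .inr rfl⟩,
    fun i _ z _ hiz => ?_⟩
  rcases ((h _).1 hiz).2 with hiz | hiz
  · refine (hc.2 _ hiz.lt_of_pr.1 _ hiz.lt_of_pr.2 hiz).imp id ?_
    rintro ⟨j, _, w, _, hi, hz, hjw⟩
    have hjw := hle _ hjw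
    exact ⟨j, hjw.lt_of_pr.1, w, hjw.lt_of_pr.2, hi, hz, hjw⟩
  · obtain ⟨rfl, rfl⟩ := pr_inj.1 hiz
    have hny := hle _ hc.1
    exact .inr ⟨n, hny.lt_of_pr.1, y, hny.lt_of_pr.2, rfl, rfl, hny⟩

theorem exists_computation (hf₀ : RecFun fun v => f₀ (v 0))
    (hf : RecFun fun v => f (v 0) (v 1) (v 2)) (s n : M.Num) :
    ∃ y a u m, Computation f₀ f s a u m n y := by
  refine sigma1_induction (P := fun n => ∃ y a u m, Computation f₀ f s a u m n y)
    (.ex (.ex (.ex (.ex (Bdd.computation hf₀ hf (.const s) (.var 2) (.var 1) (.var 0) (.var 4)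
      (.var 3)).sigma1)))) ⟨_, exists_computation_zero f₀ f s⟩ ?_ n
  rintro n ⟨y, a, u, m, hc⟩
  exact ⟨_, hc.exists_succ⟩

theorem exists_primitive_recursion (hf₀ : RecFun fun v => f₀ (v 0))
    (hf : RecFun fun v => f (v 0) (v 1) (v 2)) :
    ∃ g : M.Num → M.Num → M.Num, (RecFun fun v => g (v 0) (v 1)) ∧ (∀ s, g s 0 = f₀ s) ∧
      ∀ s n, g s (n + 1) = f s n (g s n) := by
  choose g hg using exists_computation hf₀ hf
  have hiff (s n y : M.Num) : y = g s n ↔ ∃ a u m, Computation f₀ f s a u m n y := by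
    refine ⟨fun h => h ▸ hg s n, ?_⟩
    rintro ⟨a, u, m, h⟩
    obtain ⟨a', u', m', h'⟩ := hg s n
    exact h.unique hf₀ hf h'
  refine ⟨g, ?_, fun s => ?_, fun s n => ?_⟩
  · refine .of_sigma1 ((Sigma1.ex (.ex (.ex (Bdd.computation hf₀ hf (.var 4) (.var 2) (.var 1)
      (.var 0) (.var 5) (.var 3)).sigma1))).of_iff fun v => hiff (v 1) (v 2) (v 0))
  · obtain ⟨a, u, m, h⟩ := hg s 0
    exact h.eq_zero
  · obtain ⟨a, u, m, h⟩ := hg s (n + 1)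
    obtain ⟨w, hy, hw⟩ := h.exists_eq_succ
    rw [hy, (hiff s n w).2 ⟨a, u, m, hw⟩]

end Recursion

end PrimitiveRecursion

/-! ### Collection for increasing approximations -/

section GapsCompute

variable [IsRCA M]

/-- `c s n` is the number of the `x < n` with `K s x`, computed in the model. -/
structure IsCount (K : M.Num → M.Num → Prop) (c : M.Num → M.Num → M.Num) : Prop where
  recFun : RecFun fun v => c (v 0) (v 1)
  map_zero (s : M.Num) : c s 0 = 0
  map_succ_of {s n : M.Num} : K s n → c s (n + 1) = c s n + 1
  map_succ_of_not {s n : M.Num} : ¬ K s n → c s (n + 1) = c s n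

section Count

variable {K : M.Num → M.Num → Prop} {c : M.Num → M.Num → M.Num}

open Classical in
theorem exists_isCount (hK : Bdd fun v => K (v 0) (v 1)) : ∃ c, IsCount K c := by
  obtain ⟨c, hc, h0, h1⟩ := exists_primitive_recursion (f₀ := fun _ => (0 : M.Num))
    (f := fun s n z => if K s n then z + 1 else z) (.const 0)
    (.ite (hK.comp₂ (.var 0) (.var 1)) (.add (.var 2) (.const 1)) (.var 2))
  exact ⟨c, hc, h0, fun h => (h1 _ _).trans (if_pos h), fun h => (h1 _ _).trans (if_neg h)⟩

theorem IsCount.le (hc : IsCount K c) (s n : M.Num) : c s n ≤ n := by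
  refine bdd_induction (P := fun n => c s n ≤ n)
    (.recLe (hc.recFun.comp₂ (.const s) (.var 0)) (.var 0)) (hc.map_zero s).le (fun n ih => ?_) n
  by_cases h : K s n
  · rw [hc.map_succ_of h]
    gcongr
  · rw [hc.map_succ_of_not h]
    exact ih.trans le_self_add

theorem IsCount.mono (hc : IsCount K c) {s t : M.Num} (hst : ∀ x, K s x → K t x) (n : M.Num) :
    c s n ≤ c t n := by
  refine bdd_induction (P := fun n => c s n ≤ c t n) (.recLe (hc.recFun.comp₂ (.const s) (.var 0))
    (hc.recFun.comp₂ (.const t) (.var 0))) (by simp only [hc.map_zero, le_refl]) (fun n ih => ?_) n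
  by_cases ht : K t n
  · rw [hc.map_succ_of ht]
    by_cases hs : K s n
    · rw [hc.map_succ_of hs]
      gcongr
    · rw [hc.map_succ_of_not hs]
      exact ih.trans le_self_add
  · rwa [hc.map_succ_of_not ht, hc.map_succ_of_not (mt (hst n) ht)]

theorem IsCount.lt (hc : IsCount K c) {s t x n : M.Num} (hst : ∀ x, K s x → K t x)
    (hs : ¬ K s x) (ht : K t x) (hx : x < n) : c s n < c t n := by
  refine bdd_induction (P := fun n => x < n → c s n < c t n)
    (.imp (.lt (.const x) (.var 0)) (.recLt (hc.recFun.comp₂ (.const s) (.var 0))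
      (hc.recFun.comp₂ (.const t) (.var 0))))
    (fun h => (not_lt_zero h).elim) (fun n ih hxn => ?_) n hx
  rcases (Order.lt_add_one_iff.1 hxn).lt_or_eq with hxn | rfl
  · by_cases hs : K s n
    · rw [hc.map_succ_of hs, hc.map_succ_of (hst n hs)]
      gcongr
      exact ih hxn
    · rw [hc.map_succ_of_not hs]
      refine (ih hxn).trans_le ?_
      by_cases ht : K t n
      · exact (hc.map_succ_of ht).symm ▸ le_self_add
      · exact (hc.map_succ_of_not ht).ge
  · rw [hc.map_succ_of_not hs, hc.map_succ_of ht, Order.lt_add_one_iff]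
    exact hc.mono hst x

theorem exists_stage_of_monotone (hK : Bdd fun v => K (v 0) (v 1)) (hmono : Monotone K)
    (m : M.Num) : ∃ s, ∀ x, x < m → (∃ r, K r x) → K s x := by
  obtain ⟨c, hc⟩ := exists_isCount hK
  by_contra! hnot
  -- Otherwise the number of `x < m` accepted at stage `s` would grow without bound.
  have unbounded : ∀ k, ∃ s, k ≤ c s m := by
    refine sigma1_induction (P := fun k => ∃ s, k ≤ c s m)
      (.ex (Bdd.recLe (.var 1) (hc.recFun.comp₂ (.var 0) (.const m))).sigma1) ⟨0, zero_le⟩ ?_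
    rintro k ⟨s, hs⟩
    obtain ⟨x, hx, ⟨r, hr⟩, hsx⟩ := hnot s
    exact ⟨s + r, Order.add_one_le_iff.2 <| hs.trans_lt <|
      hc.lt (hmono le_self_add) hsx (hmono le_add_self x hr) hx⟩
  obtain ⟨s, hs⟩ := unbounded (m + 1)
  exact (Order.add_one_le_iff.1 hs).not_ge (hc.le s m)

end Count

/-! ### The largest power of two dividing a number -/

theorem even_or_odd (a : M.Num) : ∃ b, a = 2 * b ∨ a = 2 * b + 1 := by
  refine sigma1_induction (P := fun a => ∃ b, a = 2 * b ∨ a = 2 * b + 1)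
    (.ex (Bdd.or (.eq (.var 1) (.mul (.const 2) (.var 0)))
      (.eq (.var 1) (.add (.mul (.const 2) (.var 0)) (.const 1)))).sigma1)
    ⟨0, .inl (mul_zero 2).symm⟩ ?_ a
  rintro a ⟨b, rfl | rfl⟩
  · exact ⟨b, .inr rfl⟩
  · exact ⟨b + 1, .inl (by ring)⟩

theorem two_mul_ne_two_mul_add_one (a b : M.Num) : 2 * a ≠ 2 * b + 1 := by
  intro h
  rcases le_or_gt a b with hab | hab
  · exact (Order.lt_add_one_iff.2 (mul_le_mul_right hab 2)).ne h
  · obtain ⟨c, rfl⟩ := Arith.exists_add_of_lt hab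
    have : 2 * b + 1 + (2 * c + 1) = 2 * b + 1 + 0 := by
      rw [add_zero]
      exact (by ring : _ = 2 * (b + c + 1)).trans h
    exact Arith.succ_ne_zero _ (add_left_cancel this)

theorem le_of_dvd {a b : M.Num} (hb : b ≠ 0) (h : a ∣ b) : a ≤ b := by
  obtain ⟨c, rfl⟩ := h
  exact le_mul_of_one_le_right zero_le (Order.one_le_iff_ne_zero.2 (right_ne_zero_of_mul hb))

theorem lt_two_mul {a : M.Num} (h : a ≠ 0) : a < 2 * a := by
  rw [two_mul]
  exact lt_add_of_pos_right _ (pos_iff_ne_zero.2 h)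

/-- `u` is a power of two: all its divisors other than `1` are even. Unlike the existence of an
exponent, this is expressed by a bounded formula. -/
def Pow2 (u : M.Num) : Prop := u ≠ 0 ∧ ∀ d, d < u + 1 → d ∣ u → d = 1 ∨ 2 ∣ d

theorem Bdd.pow2 {f : (ℕ → M.Num) → M.Num} (hf : RecFun f) : Bdd fun v => Pow2 (f v) :=
  .comp₁ (.and (.not (.eq (.var 0) (.const 0))) (.ball (.add (.var 0) (.const 1))
    (.imp (.dvd (.var 0) (.var 1)) (.or (.eq (.var 0) (.const 1)) (.dvd (.const 2) (.var 0)))))) hf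

namespace Pow2

variable {u w : M.Num}

theorem eq_one_or_two_dvd (hu : Pow2 u) {d : M.Num} (h : d ∣ u) : d = 1 ∨ 2 ∣ d :=
  hu.2 d (Order.lt_add_one_iff.2 (le_of_dvd hu.1 h)) h

theorem one : Pow2 (1 : M.Num) :=
  ⟨one_ne_zero, fun _ _ h => .inl <| le_antisymm (le_of_dvd one_ne_zero h) <|
    Order.one_le_iff_ne_zero.2 (ne_zero_of_dvd_ne_zero one_ne_zero h)⟩

theorem double (hu : Pow2 u) : Pow2 (2 * u) := by
  refine ⟨mul_ne_zero two_ne_zero hu.1, fun d _ ⟨c, hc⟩ => ?_⟩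
  obtain ⟨e, rfl | rfl⟩ := even_or_odd d
  · exact .inr (dvd_mul_right _ _)
  obtain ⟨c', rfl | rfl⟩ := even_or_odd c
  · refine hu.eq_one_or_two_dvd ⟨c', mul_left_cancel₀ (two_ne_zero (α := M.Num)) ?_⟩
    rw [hc]
    ring
  · refine (two_mul_ne_two_mul_add_one u (2 * e * c' + e + c') ?_).elim
    rw [hc]
    ring

theorem exists_half (hu : Pow2 u) (h : u ≠ 1) : ∃ w, u = 2 * w ∧ Pow2 w := by
  obtain ⟨w, rfl⟩ := (hu.eq_one_or_two_dvd dvd_rfl).resolve_left h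
  exact ⟨w, rfl, right_ne_zero_of_mul hu.1, fun d _ hd => hu.eq_one_or_two_dvd (hd.mul_left 2)⟩

theorem two_mul_dvd_of_lt (hu : Pow2 u) (hw : Pow2 w) (h : u < w) : 2 * u ∣ w := by
  refine strong_induction (P := fun u => ∀ z, z < w + 1 → Pow2 u → Pow2 z → u < z → 2 * u ∣ z)
    (.ball (.const _) (.imp (.pow2 (.var 1)) (.imp (.pow2 (.var 0)) (.imp (.lt (.var 1) (.var 0))
      (.dvd (.mul (.const 2) (.var 1)) (.var 0)))))) ?_ u w (lt_add_one _) hu hw h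
  intro u ih z hzw hu hz hlt
  have hz1 : z ≠ 1 := ((Order.one_le_iff_ne_zero.2 hu.1).trans_lt hlt).ne'
  obtain ⟨y, rfl, hy⟩ := hz.exists_half hz1
  rcases eq_or_ne u 1 with rfl | hu1
  · rw [mul_one]
    exact dvd_mul_right _ _
  · obtain ⟨t, rfl, ht⟩ := hu.exists_half hu1
    exact mul_dvd_mul_left 2 (ih t (lt_two_mul ht.1) y ((lt_two_mul hy.1).trans hzw) ht hy
      (lt_of_mul_lt_mul_left hlt zero_le))

end Pow2

/-- `p` is the product of the power of two `u` and an odd number. The odd number is bounded to make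
this a bounded formula. -/
def IsTwoPart (p u : M.Num) : Prop := Pow2 u ∧ ∃ a, a < p + 1 ∧ p = u * (2 * a + 1)

theorem Bdd.isTwoPart {f g : (ℕ → M.Num) → M.Num} (hf : RecFun f) (hg : RecFun g) :
    Bdd fun v => IsTwoPart (f v) (g v) :=
  .comp₂ (.and (.pow2 (.var 1)) (.bex (.add (.var 0) (.const 1))
    (.eq (.var 1) (.mul (.var 2) (.add (.mul (.const 2) (.var 0)) (.const 1)))))) hf hg

theorem isTwoPart_of_eq {p u a : M.Num} (hu : Pow2 u) (h : p = u * (2 * a + 1)) :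
    IsTwoPart p u := by
  refine ⟨hu, a, Order.lt_add_one_iff.2 ?_, h⟩
  calc a ≤ 2 * a + 1 := by rw [two_mul, add_assoc]; exact le_self_add
    _ ≤ u * (2 * a + 1) := le_mul_of_one_le_left zero_le (Order.one_le_iff_ne_zero.2 hu.1)
    _ = p := h.symm

theorem exists_isTwoPart {p : M.Num} (hp : p ≠ 0) : ∃ u, IsTwoPart p u := by
  suffices ∀ p : M.Num, p ≠ 0 → ∃ u, u < p + 1 ∧ IsTwoPart p u from
    (this p hp).imp fun _ h => h.2
  refine strong_induction (.imp (.not (.eq (.var 0) (.const 0)))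
    (.bex (.add (.var 0) (.const 1)) (.isTwoPart (.var 1) (.var 0)))) fun p ih hp => ?_
  obtain ⟨b, rfl | rfl⟩ := even_or_odd p
  · have hb := right_ne_zero_of_mul hp
    obtain ⟨u, hub, hu, a, -, hba⟩ := ih b (lt_two_mul hb) hb
    refine ⟨2 * u, ?_, isTwoPart_of_eq (a := a) hu.double ?_⟩
    · exact Order.lt_add_one_iff.2 (mul_le_mul_right (Order.lt_add_one_iff.1 hub) 2)
    · rw [mul_assoc, ← hba]
  · exact ⟨1, Order.lt_add_one_iff.2 le_add_self, isTwoPart_of_eq Pow2.one (one_mul _).symm⟩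

open Classical in
/-- The largest power of two that divides `p`, and `0` for `p = 0`. -/
noncomputable def twoPart (p : M.Num) : M.Num :=
  if h : p = 0 then 0 else (exists_isTwoPart h).choose

theorem twoPart_zero : twoPart (0 : M.Num) = 0 := dif_pos rfl

theorem isTwoPart_twoPart {p : M.Num} (hp : p ≠ 0) : IsTwoPart p (twoPart p) := by
  simp only [twoPart, dif_neg hp]
  exact (exists_isTwoPart hp).choose_spec

theorem twoPart_pos {p : M.Num} (hp : p ≠ 0) : 0 < twoPart p :=
  pos_iff_ne_zero.2 (isTwoPart_twoPart hp).1.1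

theorem IsTwoPart.not_two_mul_dvd {p u : M.Num} (h : IsTwoPart p u) : ¬ 2 * u ∣ p := by
  rintro ⟨c, hc⟩
  obtain ⟨hu, a, -, ha⟩ := h
  refine two_mul_ne_two_mul_add_one c a (mul_left_cancel₀ hu.1 ?_)
  rw [← ha, hc]
  ring

theorem IsTwoPart.dvd {p u : M.Num} (h : IsTwoPart p u) : u ∣ p :=
  have ⟨_, _, _, ha⟩ := h
  ⟨_, ha⟩

theorem lt_twoPart {u p : M.Num} (hu : Pow2 u) (hp : p ≠ 0) (h : 2 * u ∣ p) : u < twoPart p := by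
  have htp := isTwoPart_twoPart hp
  by_contra! hle
  rcases hle.lt_or_eq with hlt | heq
  · exact htp.not_two_mul_dvd
      ((htp.1.two_mul_dvd_of_lt hu hlt).trans ((dvd_mul_left u 2).trans h))
  · exact htp.not_two_mul_dvd (heq ▸ h)

theorem IsTwoPart.twoPart_eq {u p : M.Num} (h : IsTwoPart p u) (hp : p ≠ 0) : twoPart p = u := by
  have htp := isTwoPart_twoPart hp
  rcases lt_trichotomy (twoPart p) u with hlt | heq | hlt
  · exact (htp.not_two_mul_dvd ((htp.1.two_mul_dvd_of_lt h.1 hlt).trans h.dvd)).elim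
  · exact heq
  · exact (h.not_two_mul_dvd ((h.1.two_mul_dvd_of_lt htp.1 hlt).trans htp.dvd)).elim

theorem RecFun.twoPart {f : (ℕ → M.Num) → M.Num} (hf : RecFun f) :
    RecFun fun v => twoPart (f v) := by
  refine .comp₁ (k := Model.twoPart) ?_ hf
  refine Bdd.of_iff (P := fun v => (v 1 = 0 ∧ v 0 = 0) ∨ (v 1 ≠ 0 ∧ IsTwoPart (v 1) (v 0)))
    (.or (.and (.eq (.var 1) (.const 0)) (.eq (.var 0) (.const 0)))
      (.and (.not (.eq (.var 1) (.const 0))) (.isTwoPart (.var 1) (.var 0)))) fun v => ?_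
  change v 0 = Model.twoPart (v 1) ↔ _
  rcases eq_or_ne (v 1) 0 with h | h
  · simp only [h, twoPart_zero, true_and, ne_eq, not_true_eq_false, false_and, or_false]
  · simp only [h, false_and, ne_eq, not_false_eq_true, true_and, false_or]
    exact ⟨fun e => e ▸ isTwoPart_twoPart h, fun ht => (ht.twoPart_eq h).symm⟩

theorem isDyadic_twoPart : AdjacentHindman.IsDyadic (twoPart (M := M)) where
  map_add_of_lt {p q} hp hq h := by
    obtain ⟨hu, a, -, ha⟩ := isTwoPart_twoPart hp
    obtain ⟨hw, b, -, hb⟩ := isTwoPart_twoPart hq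
    obtain ⟨c, hc⟩ := hu.two_mul_dvd_of_lt hw h
    refine (isTwoPart_of_eq (a := a + c * (2 * b + 1)) hu ?_).twoPart_eq
      fun h => hp (add_eq_zero.1 h).1
    nth_rw 1 [ha, hb]
    rw [hc]
    ring
  lt_map_add_of_eq {p q} hp hq h := by
    obtain ⟨hu, a, -, ha⟩ := isTwoPart_twoPart hp
    obtain ⟨-, b, -, hb⟩ := isTwoPart_twoPart hq
    refine lt_twoPart hu (fun h => hp (add_eq_zero.1 h).1) ⟨a + b + 1, ?_⟩
    nth_rw 1 [ha, hb]
    rw [← h]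
    ring

/-! ### Homogeneous sets of gaps compute -/

/-- `x` has a witness below `s` for the `Σ⁰₁` property `∃ y, P y x`. -/
def Stage (P : M.Num → M.Num → Prop) (s x : M.Num) : Prop := ∃ y, y < s ∧ P y x

section Stage

variable {P : M.Num → M.Num → Prop}

theorem monotone_stage : Monotone (Stage P) := fun _ _ hst _ ⟨y, hy, h⟩ => ⟨y, hy.trans_le hst, h⟩

theorem exists_stage_iff {x : M.Num} : (∃ s, Stage P s x) ↔ ∃ y, P y x :=
  ⟨fun ⟨_, y, _, h⟩ => ⟨y, h⟩, fun ⟨y, h⟩ => ⟨y + 1, y, lt_add_one y, h⟩⟩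

theorem Bdd.stage (hP : Bdd fun v => P (v 0) (v 1)) {f g : (ℕ → M.Num) → M.Num} (hf : RecFun f)
    (hg : RecFun g) : Bdd fun v => Stage P (f v) (g v) :=
  .comp₂ (.bex (.var 0) (hP.comp₂ (.var 0) (.var 2))) hf hg

end Stage

section Gaps

variable {X : Set M.Num}

theorem Sigma1.exists_gap (hX : X ∈ M.Sets) {R : M.Num → (ℕ → M.Num) → Prop}
    (hR : Bdd fun v => R (v 0) fun i => v (i + 1)) :
    Sigma1 fun v => ∃ a ∈ X, ∃ b ∈ X, a < b ∧ R (b - a) v := by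
  have hRsub : Bdd fun v => R (v 0 - v 1) fun i => v (i + 2) :=
    hR.rsubst (recFun_cons (.sub (.var 0) (.var 1)) fun i => .var (i + 2))
  refine (Sigma1.ex (R := fun a v => ∃ b, (a ∈ X ∧ b ∈ X) ∧ a < b ∧ R (b - a) v)
    (.ex (Bdd.and (.and (.mem (.var 1) hX) (.mem (.var 0) hX))
      (.and (.lt (.var 1) (.var 0)) hRsub)).sigma1)).of_iff fun v => ?_
  simp only [exists_and_left, and_assoc]

theorem hasMinimalGap_twoPart (hX : X ∈ M.Sets) (hinf : ∀ a, ∃ b ∈ X, a < b) :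
    AdjacentHindman.HasMinimalGap twoPart X := by
  obtain ⟨a, ha, -⟩ := hinf 0
  obtain ⟨b, hb, hab⟩ := hinf a
  obtain ⟨_, ⟨p, hp, q, hq, hpq, rfl⟩, least⟩ := exists_least
    (P := fun m => ∃ a ∈ X, ∃ b ∈ X, a < b ∧ m = twoPart (b - a))
    (.exists_gap (R := fun d v => v 0 = twoPart d) hX (.recEq (.var 1) (.twoPart (.var 0))))
    ⟨_, a, ha, b, hb, hab, rfl⟩
  exact ⟨p, hp, q, hq, hpq, fun a ha b hb hab => least _ ⟨a, ha, b, hb, hab, rfl⟩⟩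

theorem exists_lt_twoPart_sub (hX : X ∈ M.Sets) (hinf : ∀ a, ∃ b ∈ X, a < b)
    (hlt : ∀ a ∈ X, ∀ b ∈ X, ∀ c ∈ X, a < b → b < c → twoPart (b - a) < twoPart (c - b))
    (e : M.Num) : ∃ a ∈ X, ∃ b ∈ X, a < b ∧ e < twoPart (b - a) := by
  refine sigma1_induction (P := fun e => ∃ a ∈ X, ∃ b ∈ X, a < b ∧ e < twoPart (b - a))
    (.exists_gap (R := fun d v => v 0 < twoPart d) hX (.recLt (.var 1) (.twoPart (.var 0)))) ?_ ?_ e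
  · obtain ⟨a, ha, -⟩ := hinf 0
    obtain ⟨b, hb, hab⟩ := hinf a
    exact ⟨a, ha, b, hb, hab, twoPart_pos (tsub_pos_of_lt hab).ne'⟩
  · rintro n ⟨a, ha, b, hb, hab, hn⟩
    obtain ⟨c, hc, hbc⟩ := hinf b
    exact ⟨b, hb, c, hc, hbc, (Order.add_one_le_iff.2 hn).trans_lt (hlt a ha b hb c hc hab hbc)⟩

theorem mem_sets_of_gapHomogeneous {P : M.Num → M.Num → Prop} (hP : Bdd fun v => P (v 0) (v 1))
    (hX : X ∈ M.Sets) (hinf : ∀ a, ∃ b ∈ X, a < b) {i : Fin 4}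
    (hhom : AdjacentHindman.GapHomogeneous (AdjacentHindman.jumpColour twoPart (Stage P)) X i) :
    {x | ∃ y, P y x} ∈ M.Sets := by
  have hmin := hasMinimalGap_twoPart hX hinf
  have decides {a b x : M.Num} (ha : a ∈ X) (hb : b ∈ X) (hab : a < b) (hx : x < twoPart (b - a)) :
      Stage P (b - a) x ↔ ∃ y, P y x :=
    (isDyadic_twoPart.approx_sub_iff hinf hhom hmin monotone_stage
      (exists_stage_of_monotone (.stage hP (.var 0) (.var 1)) monotone_stage) ha hb hab hx).trans
      exists_stage_iff
  refine mem_sets_of_delta (.ex hP.sigma1) ((Sigma1.exists_gap (X := X)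
    (R := fun d v => v 0 < twoPart d ∧ ¬ Stage P d (v 0)) hX
    (.and (.recLt (.var 1) (.twoPart (.var 0))) (.not (.stage hP (.var 0) (.var 1))))).of_iff
    fun v => ⟨fun hnot => ?_, ?_⟩)
  · obtain ⟨a, ha, b, hb, hab, hlt⟩ := exists_lt_twoPart_sub hX hinf
      (fun a ha b hb c hc => isDyadic_twoPart.map_sub_lt_map_sub hinf hhom hmin ha hb hc) (v 0)
    exact ⟨a, ha, b, hb, hab, hlt, fun hS => hnot ((decides ha hb hab hlt).1 hS)⟩
  · rintro ⟨a, ha, b, hb, hab, hlt, hS⟩ h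
    exact hS ((decides ha hb hab hlt).2 h)

end Gaps

end GapsCompute

/-! ## The combinatorial principles in a model -/

section Satisfaction

section Clauses

variable (v : ℕ → M.Num) (w : ℕ → M.Sets)

theorem eval_add (s t : Term) : M.eval v (s + t) = M.eval v s + M.eval v t := rfl

theorem eval_zero : M.eval v 0 = 0 := rfl

theorem eval_one : M.eval v 1 = 1 := rfl

theorem eval_var (i : ℕ) : M.eval v (.var i) = v i := rfl

theorem eval_pair (s t : Term) : M.eval v (s.pair t) = pr (M.eval v s) (M.eval v t) := rfl

theorem sat_eq (s t : Term) : M.Sat v w (.eq s t) ↔ M.eval v s = M.eval v t := Iff.rfl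

theorem sat_lt (s t : Term) : M.Sat v w (.lt s t) ↔ M.eval v s < M.eval v t := Iff.rfl

theorem sat_mem (t : Term) (X : ℕ) :
    M.Sat v w (.mem t X) ↔ M.eval v t ∈ (w X : Set M.Num) := Iff.rfl

theorem sat_and (φ ψ : Formula) : M.Sat v w (.and φ ψ) ↔ M.Sat v w φ ∧ M.Sat v w ψ := Iff.rfl

theorem sat_all (x : ℕ) (φ : Formula) :
    M.Sat v w (.all x φ) ↔ ∀ a, M.Sat (Function.update v x a) w φ := Iff.rfl

theorem sat_allSet (X : ℕ) (φ : Formula) :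
    M.Sat v w (.allSet X φ) ↔ ∀ A, M.Sat v (Function.update w X A) φ := Iff.rfl

end Clauses

theorem sat_ZRT3_iff (v : ℕ → M.Num) (w : ℕ → M.Sets) : M.Sat v w ZRT3 ↔
    ∀ (k : M.Num) (C : M.Sets), ((∀ x, x ∈ C.1 → ∃ a b c i, (a < b ∧ b < c) ∧ i < k ∧
        x = pr (pr (pr a b) c) i) ∧
      ∀ a b c, a < b ∧ b < c → ∃ i, pr (pr (pr a b) c) i ∈ C.1 ∧
        ∀ j, pr (pr (pr a b) c) j ∈ C.1 → j = i) ∧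
      (∀ a b c t i, a < b ∧ b < c →
        (pr (pr (pr a b) c) i ∈ C.1 ↔ pr (pr (pr (a + t) (b + t)) (c + t)) i ∈ C.1)) →
      ∃ X : M.Sets, (∀ a, ∃ b, a < b ∧ b ∈ X.1) ∧ ∃ i, i < k ∧ ∀ a b c,
        (a < b ∧ b < c) ∧ (a ∈ X.1 ∧ b ∈ X.1 ∧ c ∈ X.1) → pr (pr (pr a b) c) i ∈ C.1 := by
  simp only [ZRT3, isColouringOfTriples, isTranslationInvariant, isInfinite, Formula.alls,
    Formula.exs, List.foldr, sat_lt, sat_eq, sat_mem, sat_and, sat_all, sat_allSet, sat_imp,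
    sat_iff, sat_ex, sat_exSet, eval_pair, eval_add, eval_var, Function.update_apply,
    Nat.reduceEqDiff, reduceIte, OfNat.zero_ne_ofNat, OfNat.one_ne_ofNat,
    OfNat.ofNat_ne_zero, OfNat.ofNat_ne_one, zero_ne_one, one_ne_zero]

/-- The set `F` is the graph of a function, as the formula `isFunction` says. -/
def IsFunctionGraph (F : Set M.Num) : Prop :=
  (∀ x, x ∈ F → ∃ a b, x = pr a b) ∧ ∀ a, ∃ b, pr a b ∈ F ∧ ∀ c, pr a c ∈ F → c = b

theorem sat_AHT2_iff (v : ℕ → M.Num) (w : ℕ → M.Sets) : M.Sat v w AHT2 ↔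
    ∀ (k : M.Num) (C : M.Sets), ((∀ x, x ∈ C.1 → ∃ a b i, i < k ∧ x = pr (pr a b) i) ∧
      ∀ a b, ∃ i, pr (pr a b) i ∈ C.1 ∧ ∀ j, pr (pr a b) j ∈ C.1 → j = i) →
      ∃ Y : M.Sets, (∀ a, ∃ b, a < b ∧ b ∈ Y.1) ∧ ∃ F : M.Sets, (IsFunctionGraph F.1 ∧
        (∀ a b c d, a < b ∧ pr a c ∈ F.1 ∧ pr b d ∈ F.1 → c < d) ∧
        ∀ a, a ∈ Y.1 ↔ ∃ b, pr b a ∈ F.1) ∧ ∃ G : M.Sets, (IsFunctionGraph G.1 ∧ pr 0 0 ∈ G.1 ∧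
          ∀ a b c, pr a b ∈ G.1 ∧ pr a c ∈ F.1 → pr (a + 1) (b + c) ∈ G.1) ∧
          ∃ i, i < k ∧ ∀ k₀ k₁ k₂ g₀ g₁ g₂ p q, ((k₀ < k₁ ∨ k₀ = k₁) ∧ k₁ < k₂) ∧
            (pr k₀ g₀ ∈ G.1 ∧ pr (k₁ + 1) g₁ ∈ G.1 ∧ pr (k₂ + 1) g₂ ∈ G.1) ∧
            (g₀ + p = g₁ ∧ g₁ + q = g₂) → pr (pr p q) i ∈ C.1 := by
  simp only [AHT2, isColouringOfPairs, isInfinite, Formula.alls, isIncreasingEnumeration,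
    isFunction, isPartialSums, isMonochromaticAFS2, Formula.le, sat_or, IsFunctionGraph,
    Formula.exs, List.foldr, sat_lt, sat_eq, sat_mem, sat_and, sat_all, sat_allSet, sat_imp,
    sat_iff, sat_ex, sat_exSet, eval_pair, eval_add, eval_var, eval_zero, eval_one,
    Function.update_apply,
    Nat.reduceEqDiff, reduceIte, OfNat.zero_ne_ofNat, OfNat.one_ne_ofNat,
    OfNat.ofNat_ne_zero, OfNat.ofNat_ne_one, zero_ne_one, one_ne_zero]

end Satisfaction

section Equivalence

/-- `ZRT3` for colourings given by definable functions. -/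
def TranslationRamsey (M : Model.{u}) : Prop :=
  ∀ (k : M.Num) (col : M.Num → M.Num → M.Num → M.Num), (RecFun fun v => col (v 0) (v 1) (v 2)) →
    (∀ a b c, a < b → b < c → col a b c < k) →
    (∀ a b c t, a < b → b < c → col (a + t) (b + t) (c + t) = col a b c) →
    ∃ X ∈ M.Sets, (∀ a, ∃ b ∈ X, a < b) ∧
      ∃ i, ∀ a ∈ X, ∀ b ∈ X, ∀ c ∈ X, a < b → b < c → col a b c = i

/-- `AHT2` for colourings given by definable functions: `F` is the increasing enumeration of the
solution and `G` its sequence of partial sums, so that `p` and `q` are sums over adjacent blocks. -/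
def AdjacentHindmanPrinciple (M : Model.{u}) : Prop :=
  ∀ (k : M.Num) (col : M.Num → M.Num → M.Num), (RecFun fun v => col (v 0) (v 1)) →
    (∀ a b, col a b < k) →
    ∃ F G : M.Num → M.Num, (RecFun fun v => F (v 0)) ∧ (RecFun fun v => G (v 0)) ∧
      (∀ a b, a < b → F a < F b) ∧ G 0 = 0 ∧ (∀ n, G (n + 1) = G n + F n) ∧
      ∃ i, ∀ l m n p q, l < m → m < n → G l + p = G m → G m + q = G n → col p q = i

theorem IsFunctionGraph.exists_recFun {F : Set M.Num} (h : IsFunctionGraph F) (hF : F ∈ M.Sets) :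
    ∃ f : M.Num → M.Num, (RecFun fun v => f (v 0)) ∧ ∀ a b, pr a b ∈ F ↔ b = f a := by
  choose f hf hu using h.2
  have hmem a b : pr a b ∈ F ↔ b = f a := ⟨hu a b, fun h => h ▸ hf a⟩
  exact ⟨f, (Bdd.mem (.pr (.var 1) (.var 0)) hF).of_iff fun v => (hmem (v 1) (v 0)).symm, hmem⟩

theorem exists_triple {X : Set M.Num} (hinf : ∀ a, ∃ b ∈ X, a < b) :
    ∃ a ∈ X, ∃ b ∈ X, ∃ c ∈ X, a < b ∧ b < c := by
  obtain ⟨a, ha, -⟩ := hinf 0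
  obtain ⟨b, hb, hab⟩ := hinf a
  obtain ⟨c, hc, hbc⟩ := hinf b
  exact ⟨a, ha, b, hb, c, hc, hab, hbc⟩

variable [IsRCA M]

/-- The common form of the two principles: a colouring of pairs is constant on the pairs of adjacent
gaps of some infinite set. -/
def GapRamsey (M : Model.{u}) [IsRCA M] : Prop :=
  ∀ (k : M.Num) (col : M.Num → M.Num → M.Num), (RecFun fun v => col (v 0) (v 1)) →
    (∀ p q, col p q < k) →
    ∃ X ∈ M.Sets, (∀ a, ∃ b ∈ X, a < b) ∧ ∃ i, AdjacentHindman.GapHomogeneous col X i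

section PairCodes

theorem Bdd.exPr {R : M.Num → M.Num → (ℕ → M.Num) → Prop} {f : (ℕ → M.Num) → M.Num}
    (hR : Bdd fun v => R (v 0) (v 1) fun i => v (i + 2)) (hf : RecFun f) :
    Bdd fun v => ∃ a b, f v = pr a b ∧ R a b v := by
  refine (Bdd.recBex (R := fun a v => ∃ b, b < f v + 1 ∧ f v = pr a b ∧ R a b v)
    (.add hf (.const 1)) (.recBex (R := fun b v => f (fun i => v (i + 1)) = pr (v 0) b ∧
      R (v 0) b fun i => v (i + 1)) (.add hf.lift (.const 1))
    (.and (.recEq hf.lift.lift (.pr (.var 1) (.var 0)))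
      (hR.subst (poly_cons (.var 1) (poly_cons (.var 0) fun i => .var (i + 2))))))).of_iff
    fun v => ⟨?_, fun ⟨a, _, b, _, h⟩ => ⟨a, b, h⟩⟩
  rintro ⟨a, b, h, hR⟩
  exact ⟨a, Order.lt_add_one_iff.2 (h ▸ left_le_pr a b), b,
    Order.lt_add_one_iff.2 (h ▸ right_le_pr a b), h, hR⟩

theorem exists_set_pr_mem_iff {R : M.Num → M.Num → Prop} (hR : Bdd fun v => R (v 0) (v 1)) :
    ∃ C ∈ M.Sets, (∀ x ∈ C, ∃ a b, x = pr a b) ∧ ∀ a b, pr a b ∈ C ↔ R a b := by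
  refine ⟨_, mem_sets (P := fun x => ∃ a b, x = pr a b ∧ R a b)
    (.exPr (R := fun a b _ => R a b) hR (.var 0)), fun x ⟨a, b, h, _⟩ => ⟨a, b, h⟩, fun a b => ?_⟩
  refine ⟨fun ⟨a', b', h, hR⟩ => ?_, fun h => ⟨a, b, rfl, h⟩⟩
  obtain ⟨rfl, rfl⟩ := pr_inj.1 h
  exact hR

theorem exists_isFunctionGraph {f : M.Num → M.Num} (hf : RecFun fun v => f (v 0)) :
    ∃ F ∈ M.Sets, IsFunctionGraph F ∧ ∀ a b, pr a b ∈ F ↔ b = f a := by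
  obtain ⟨F, hF, hpr, hmem⟩ := exists_set_pr_mem_iff (R := fun a b => b = f a)
    (.recEq (.var 1) (hf.comp₁ (.var 0)))
  exact ⟨F, hF, ⟨hpr, fun a => ⟨f a, (hmem a _).2 rfl, fun c hc => (hmem a c).1 hc⟩⟩, hmem⟩

end PairCodes

section StrictlyIncreasing

variable {F : M.Num → M.Num}

theorem lt_of_lt_succ (hF : RecFun fun v => F (v 0)) (h : ∀ n, F n < F (n + 1)) {a b : M.Num} :
    a < b → F a < F b := by
  refine bdd_induction (P := fun b => a < b → F a < F b)
    (.imp (.lt (.const a) (.var 0)) (.recLt (.const (F a)) (hF.comp₁ (.var 0))))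
    (fun h => (not_lt_zero h).elim) (fun n ih hlt => ?_) b
  rcases (Order.lt_add_one_iff.1 hlt).lt_or_eq with hlt | rfl
  exacts [(ih hlt).trans (h n), h a]

theorem le_apply_of_lt_succ (hF : RecFun fun v => F (v 0)) (h : ∀ n, F n < F (n + 1)) (n : M.Num) :
    n ≤ F n :=
  bdd_induction (P := fun n => n ≤ F n) (.recLe (.var 0) (hF.comp₁ (.var 0))) zero_le
    (fun n ih => Order.add_one_le_iff.2 (ih.trans_lt (h n))) n

theorem exists_range_of_lt_succ (hF : RecFun fun v => F (v 0)) (h : ∀ n, F n < F (n + 1)) :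
    ∃ X ∈ M.Sets, (∀ a, a ∈ X ↔ ∃ n, a = F n) ∧ ∀ a, ∃ b ∈ X, a < b := by
  have hle := le_apply_of_lt_succ hF h
  have hmem a : a ∈ {x | ∃ n, n < x + 1 ∧ x = F n} ↔ ∃ n, a = F n :=
    ⟨fun ⟨n, _, h⟩ => ⟨n, h⟩, fun ⟨n, h⟩ => ⟨n, Order.lt_add_one_iff.2 (h ▸ hle n), h⟩⟩
  exact ⟨_, mem_sets (.bex (.add (.var 0) (.const 1)) (.recEq (.var 1) (hF.comp₁ (.var 0)))), hmem,
    fun a => ⟨F (a + 1), (hmem _).2 ⟨_, rfl⟩, (hle a).trans_lt (h a)⟩⟩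

end StrictlyIncreasing

/-! ### The principles as formulas -/

theorem translationRamsey_of_sat {v : ℕ → M.Num} {w : ℕ → M.Sets} (h : M.Sat v w ZRT3) :
    TranslationRamsey M := by
  intro k col hcol hk hinv
  obtain ⟨C, hC, hpr, hmem⟩ := exists_set_pr_mem_iff
    (R := fun d i => ∃ e c, d = pr e c ∧ ∃ a b, e = pr a b ∧ (a < b ∧ b < c) ∧ i = col a b c)
    (.exPr (.exPr (.and (.and (.lt (.var 0) (.var 1)) (.lt (.var 1) (.var 3)))
      (.recEq (.var 5) (hcol.comp₃ (.var 0) (.var 1) (.var 3)))) (.var 0)) (.var 0))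
  have mem a b c i : pr (pr (pr a b) c) i ∈ C ↔ (a < b ∧ b < c) ∧ i = col a b c := by
    simp [hmem, pr_inj, and_assoc]
  have shape x (hx : x ∈ C) :
      ∃ a b c i, (a < b ∧ b < c) ∧ i < k ∧ x = pr (pr (pr a b) c) i := by
    obtain ⟨d, i, rfl⟩ := hpr x hx
    obtain ⟨_, c, rfl, a, b, rfl, habc, rfl⟩ := (hmem d i).1 hx
    exact ⟨a, b, c, _, habc, hk a b c habc.1 habc.2, rfl⟩
  have unique a b c (habc : a < b ∧ b < c) :
      ∃ i, pr (pr (pr a b) c) i ∈ C ∧ ∀ j, pr (pr (pr a b) c) j ∈ C → j = i :=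
    ⟨col a b c, (mem ..).2 ⟨habc, rfl⟩, fun j hj => ((mem ..).1 hj).2⟩
  have invariant a b c t i (habc : a < b ∧ b < c) :
      pr (pr (pr a b) c) i ∈ C ↔ pr (pr (pr (a + t) (b + t)) (c + t)) i ∈ C := by
    rw [mem, mem, hinv a b c t habc.1 habc.2, add_lt_add_iff_right, add_lt_add_iff_right]
  obtain ⟨X, hinf, i, _, hi⟩ := (sat_ZRT3_iff v w).1 h k ⟨C, hC⟩ ⟨⟨shape, unique⟩, invariant⟩
  exact ⟨X.1, X.2, fun a => (hinf a).imp fun _ => And.symm, i, fun a ha b hb c hc hab hbc =>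
    ((mem ..).1 (hi a b c ⟨⟨hab, hbc⟩, ha, hb, hc⟩)).2.symm⟩

theorem sat_of_translationRamsey (h : TranslationRamsey M) (v : ℕ → M.Num) (w : ℕ → M.Sets) :
    M.Sat v w ZRT3 := by
  refine (sat_ZRT3_iff v w).2 fun k ⟨C, hC⟩ ⟨⟨hshape, hunique⟩, hinv⟩ => ?_
  obtain ⟨f, hf, hfC⟩ := Bdd.exists_recFun
    (R := fun i v => v 0 < v 1 ∧ v 1 < v 2 → pr (pr (pr (v 0) (v 1)) (v 2)) i ∈ C)
    (.imp (.and (.lt (.var 1) (.var 2)) (.lt (.var 2) (.var 3)))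
      (.mem (.pr (.pr (.pr (.var 1) (.var 2)) (.var 3)) (.var 0)) hC)) fun v => by
        by_cases hv : v 0 < v 1 ∧ v 1 < v 2
        · exact (hunique _ _ _ hv).imp fun _ hi _ => hi.1
        · exact ⟨0, fun hv' => (hv hv').elim⟩
  let col a b c := f (cons a (cons b fun _ => c))
  have hcol : RecFun fun v : ℕ → M.Num => col (v 0) (v 1) (v 2) :=
    hf.subst (poly_cons (.var 0) (poly_cons (.var 1) fun _ => .var 2))
  have col_mem {a b c} (hab : a < b) (hbc : b < c) : pr (pr (pr a b) c) (col a b c) ∈ C :=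
    hfC (cons a (cons b fun _ => c)) ⟨hab, hbc⟩
  have eq_col {a b c i} (hab : a < b) (hbc : b < c) (hi : pr (pr (pr a b) c) i ∈ C) :
      col a b c = i := by
    obtain ⟨j, _, hj⟩ := hunique a b c ⟨hab, hbc⟩
    exact (hj _ (col_mem hab hbc)).trans (hj _ hi).symm
  have col_lt a b c (hab : a < b) (hbc : b < c) : col a b c < k := by
    obtain ⟨_, _, _, i, _, hi, heq⟩ := hshape _ (col_mem hab hbc)
    exact (pr_inj.1 heq).2 ▸ hi
  obtain ⟨X, hX, hinf, i, hi⟩ := h k col hcol col_lt fun a b c t hab hbc => eq_col (by gcongr)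
    (by gcongr) ((hinv a b c t _ ⟨hab, hbc⟩).1 (col_mem hab hbc))
  obtain ⟨a, ha, b, hb, c, hc, hab, hbc⟩ := exists_triple hinf
  exact ⟨⟨X, hX⟩, fun a => (hinf a).imp fun _ => And.symm, i,
    hi a ha b hb c hc hab hbc ▸ col_lt a b c hab hbc, fun a b c ⟨⟨hab, hbc⟩, ha, hb, hc⟩ =>
      hi a ha b hb c hc hab hbc ▸ col_mem hab hbc⟩

theorem adjacentHindmanPrinciple_of_sat {v : ℕ → M.Num} {w : ℕ → M.Sets} (h : M.Sat v w AHT2) :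
    AdjacentHindmanPrinciple M := by
  intro k col hcol hk
  obtain ⟨C, hC, hpr, hmem⟩ := exists_set_pr_mem_iff
    (R := fun d i => ∃ a b, d = pr a b ∧ i = col a b)
    (.exPr (.recEq (.var 3) (hcol.comp₂ (.var 0) (.var 1))) (.var 0))
  have mem a b i : pr (pr a b) i ∈ C ↔ i = col a b := by simp [hmem, pr_inj, and_assoc]
  have shape x (hx : x ∈ C) : ∃ a b i, i < k ∧ x = pr (pr a b) i := by
    obtain ⟨d, i, rfl⟩ := hpr x hx
    obtain ⟨a, b, rfl, rfl⟩ := (hmem d i).1 hx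
    exact ⟨a, b, _, hk a b, rfl⟩
  obtain ⟨_, _, F, ⟨hF, hFlt, _⟩, G, ⟨hG, hG₀, hG₁⟩, i, _, hi⟩ :=
    (sat_AHT2_iff v w).1 h k ⟨C, hC⟩
      ⟨shape, fun a b => ⟨col a b, (mem ..).2 rfl, fun j hj => (mem ..).1 hj⟩⟩
  obtain ⟨f, hf, hfF⟩ := hF.exists_recFun F.2
  obtain ⟨g, hg, hgG⟩ := hG.exists_recFun G.2
  have apply_mem n : pr n (f n) ∈ F.1 := (hfF ..).2 rfl
  have sum_mem n : pr n (g n) ∈ G.1 := (hgG ..).2 rfl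
  refine ⟨f, g, hf, hg, fun a b hab => hFlt a b _ _ ⟨hab, apply_mem a, apply_mem b⟩,
    ((hgG _ _).1 hG₀).symm, fun n => ((hgG _ _).1 (hG₁ n _ _ ⟨sum_mem n, apply_mem n⟩)).symm, i,
    fun l m n p q hlm hmn hp hq => ?_⟩
  obtain ⟨m, rfl⟩ : ∃ m', m = m' + 1 := (Arith.exists_add_of_lt hlm).imp' _ fun _ => id
  obtain ⟨n, rfl⟩ : ∃ n', n = n' + 1 := (Arith.exists_add_of_lt hmn).imp' _ fun _ => id
  exact ((mem p q i).1 (hi l m n _ _ _ p q ⟨⟨(Order.lt_add_one_iff.1 hlm).lt_or_eq,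
    (add_lt_add_iff_right 1).1 hmn⟩, ⟨sum_mem _, sum_mem _, sum_mem _⟩, hp, hq⟩)).symm

theorem sat_of_adjacentHindmanPrinciple (h : AdjacentHindmanPrinciple M) (v : ℕ → M.Num)
    (w : ℕ → M.Sets) : M.Sat v w AHT2 := by
  refine (sat_AHT2_iff v w).2 fun k ⟨C, hC⟩ ⟨hshape, hunique⟩ => ?_
  choose col hcol hcol_unique using hunique
  have mem a b i : pr (pr a b) i ∈ C ↔ i = col a b := ⟨hcol_unique a b i, fun h => h ▸ hcol a b⟩
  have col_lt a b : col a b < k := by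
    obtain ⟨_, _, i, hi, heq⟩ := hshape _ (hcol a b)
    exact (pr_inj.1 heq).2 ▸ hi
  obtain ⟨f, g, hf, hg, hlt, hg₀, hg₁, i, hi⟩ := h k col
    ((Bdd.mem (.pr (.pr (.var 1) (.var 2)) (.var 0)) hC).of_iff fun v => (mem ..).symm) col_lt
  obtain ⟨F, hF, hFgraph, hFf⟩ := exists_isFunctionGraph hf
  obtain ⟨G, hG, hGgraph, hGg⟩ := exists_isFunctionGraph hg
  obtain ⟨Y, hY, hYf, hinf⟩ := exists_range_of_lt_succ hf fun n => hlt _ _ (lt_add_one n)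
  have i_lt : i < k :=
    hi 0 1 (1 + 1) (f 0) (f 1) zero_lt_one (lt_add_one 1) (by rw [← zero_add 1, hg₁])
      (hg₁ 1).symm ▸ col_lt _ _
  refine ⟨⟨Y, hY⟩, fun a => (hinf a).imp fun _ => And.symm, ⟨F, hF⟩, ⟨hFgraph, ?_, ?_⟩, ⟨G, hG⟩,
    ⟨hGgraph, (hGg _ _).2 hg₀.symm, ?_⟩, i, i_lt, ?_⟩
  · rintro a b c d ⟨hab, hc, hd⟩
    rw [(hFf ..).1 hc, (hFf ..).1 hd]
    exact hlt a b hab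
  · simp only [hYf, hFf, implies_true]
  · rintro a b c ⟨hb, hc⟩
    rw [hGg, (hGg ..).1 hb, (hFf ..).1 hc, hg₁]
  · rintro l m n x y z p q ⟨⟨hlm, hmn⟩, ⟨hx, hy, hz⟩, hp, hq⟩
    rw [(hGg ..).1 hx, (hGg ..).1 hy] at hp
    rw [(hGg ..).1 hy, (hGg ..).1 hz] at hq
    exact (mem p q i).2 (hi l (m + 1) (n + 1) p q (Order.lt_add_one_iff.2 (le_iff_lt_or_eq.2 hlm))
      ((add_lt_add_iff_right 1).2 hmn) hp hq).symm

/-! ### The equivalence -/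

theorem TranslationRamsey.gapRamsey (h : TranslationRamsey M) : GapRamsey M :=
  fun k col hcol hk => h k (fun a b c => col (b - a) (c - b))
    (hcol.comp₂ (.sub (.var 1) (.var 0)) (.sub (.var 2) (.var 1))) (fun _ _ _ _ _ => hk _ _)
    fun a b c t _ _ => by simp only [add_tsub_add_eq_tsub_right]

open Classical in
theorem GapRamsey.translationRamsey (h : GapRamsey M) : TranslationRamsey M := by
  intro k col hcol hk hinv
  obtain ⟨X, hX, hinf, i, hi⟩ := h k
    (fun p q => if 0 < p ∧ 0 < q then col 0 p (p + q) else col 0 1 (1 + 1))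
    (.ite (.and (.lt (.const 0) (.var 0)) (.lt (.const 0) (.var 1)))
      (hcol.comp₃ (.const 0) (.var 0) (.add (.var 0) (.var 1))) (.const _)) fun p q => by
        split_ifs with hpq
        · exact hk _ _ _ hpq.1 (lt_add_of_pos_right _ hpq.2)
        · exact hk _ _ _ zero_lt_one (lt_add_one 1)
  refine ⟨X, hX, hinf, i, fun a ha b hb c hc hab hbc => ?_⟩
  have hba : 0 < b - a := tsub_pos_of_lt hab
  have hcb : 0 < c - b := tsub_pos_of_lt hbc
  have hb' : b - a + a = b := tsub_add_cancel_of_le hab.le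
  have hc' : b - a + (c - b) + a = c := by
    rw [add_right_comm, hb', add_tsub_cancel_of_le hbc.le]
  calc col a b c = col (0 + a) (b - a + a) (b - a + (c - b) + a) := by rw [zero_add, hb', hc']
    _ = col 0 (b - a) (b - a + (c - b)) := hinv _ _ _ a hba (lt_add_of_pos_right _ hcb)
    _ = i := (if_pos ⟨hba, hcb⟩).symm.trans (hi a ha b hb c hc hab hbc)

theorem AdjacentHindmanPrinciple.gapRamsey (h : AdjacentHindmanPrinciple M) : GapRamsey M := by
  intro k col hcol hk
  obtain ⟨F, G, -, hG, hlt, -, hG₁, i, hi⟩ := h k col hcol hk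
  have hG' : RecFun fun v : ℕ → M.Num => G (v 0 + 1) := hG.comp₁ (.add (.var 0) (.const 1))
  have hGsucc n : G (n + 1) < G (n + 1 + 1) := by
    rw [hG₁ (n + 1)]
    exact lt_add_of_pos_right _ (zero_le.trans_lt (hlt n (n + 1) (lt_add_one n)))
  have lt_of_apply_lt {m n} (h : G (m + 1) < G (n + 1)) : m + 1 < n + 1 := by
    contrapose! h
    rcases h.lt_or_eq with h | h
    · exact (lt_of_lt_succ (F := fun n => G (n + 1)) hG' hGsucc ((add_lt_add_iff_right 1).1 h)).le
    · rw [h]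
  obtain ⟨X, hX, hXG, hinf⟩ := exists_range_of_lt_succ (F := fun n => G (n + 1)) hG' hGsucc
  refine ⟨X, hX, hinf, i, fun a ha b hb c hc hab hbc => ?_⟩
  obtain ⟨l, rfl⟩ := (hXG a).1 ha
  obtain ⟨m, rfl⟩ := (hXG b).1 hb
  obtain ⟨n, rfl⟩ := (hXG c).1 hc
  exact hi (l + 1) (m + 1) (n + 1) _ _ (lt_of_apply_lt hab) (lt_of_apply_lt hbc)
    (add_tsub_cancel_of_le hab.le) (add_tsub_cancel_of_le hbc.le)

theorem exists_sparse_enumeration {X : Set M.Num} (hX : X ∈ M.Sets)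
    (hinf : ∀ a, ∃ b ∈ X, a < b) : ∃ g : M.Num → M.Num, (RecFun fun v => g (v 0)) ∧
      (∀ n, g n ∈ X) ∧ ∀ n, g n + g n < g (n + 1) := by
  obtain ⟨next, hnext, next_spec⟩ := Bdd.exists_recFun (R := fun b v => b ∈ X ∧ v 0 + v 0 < b)
    (.and (.mem (.var 0) hX) (.lt (.add (.var 1) (.var 1)) (.var 0))) fun v => hinf _
  obtain ⟨g, hg, hg₀, hg₁⟩ := exists_primitive_recursion (f₀ := fun _ => next fun _ => 0)
    (f := fun _ _ z => next fun _ => z) (.const _) (hnext.subst fun _ => .var 2)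
  have hg' : RecFun fun v : ℕ → M.Num => g 0 (v 0) := hg.comp₂ (.const 0) (.var 0)
  refine ⟨g 0, hg', bdd_induction (.recMem hg' hX) ?_ fun n _ => ?_, fun n => ?_⟩
  · exact hg₀ 0 ▸ (next_spec _).1
  · exact hg₁ 0 n ▸ (next_spec _).1
  · exact hg₁ 0 n ▸ (next_spec fun _ => g 0 n).2

theorem GapRamsey.adjacentHindmanPrinciple (h : GapRamsey M) : AdjacentHindmanPrinciple M := by
  intro k col hcol hk
  obtain ⟨X, hX, hinf, i, hi⟩ := h k col hcol hk
  obtain ⟨g, hg, hgX, hsparse⟩ := exists_sparse_enumeration hX hinf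
  have hlt n : g n < g (n + 1) := le_self_add.trans_lt (hsparse n)
  have hmono {m n : M.Num} : m < n → g m < g n := lt_of_lt_succ hg hlt
  have hle n : g 0 ≤ g n := by
    rcases (zero_le (a := n)).lt_or_eq with hn | rfl
    exacts [(hmono hn).le, le_rfl]
  have hdiff : RecFun fun v : ℕ → M.Num => g (v 0 + 1) - g (v 0) :=
    .sub (hg.comp₁ (.add (.var 0) (.const 1))) hg
  -- Sparseness makes the successive differences of `g` increase.
  have hdiff_lt n : g (n + 1) - g n < g (n + 1 + 1) - g (n + 1) :=
    tsub_le_self.trans_lt (lt_tsub_of_add_lt_left (hsparse _))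
  have eq_sub {m n p : M.Num} (hmn : m < n) (hp : g m - g 0 + p = g n - g 0) :
      p = g n - g m := by
    rw [← tsub_add_tsub_cancel (hmono hmn).le (hle m), add_comm] at hp
    exact add_right_cancel hp
  refine ⟨fun n => g (n + 1) - g n, fun n => g n - g 0, hdiff, .sub hg (.const _),
    fun a b => lt_of_lt_succ (F := fun n => g (n + 1) - g n) hdiff hdiff_lt, tsub_self _,
    fun n => ?_, i, fun l m n p q hlm hmn hp hq => ?_⟩
  · exact (tsub_add_tsub_cancel (hlt n).le (hle n)).symm.trans (add_comm _ _)
  · rw [eq_sub hlm hp, eq_sub hmn hq]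
    exact hi _ (hgX l) _ (hgX m) _ (hgX n) (hmono hlm) (hmono hmn)

end Equivalence

/-! ## Arithmetical comprehension -/

section Comprehension

theorem poly_eval : ∀ t : Term, Poly fun v : ℕ → M.Num => M.eval v t
  | .var i => .var i
  | .zero => .const _
  | .one => .const _
  | .add s t => .add (poly_eval s) (poly_eval t)
  | .mul s t => .mul (poly_eval s) (poly_eval t)

theorem poly_update {s : (ℕ → M.Num) → M.Num} {σ : ℕ → (ℕ → M.Num) → M.Num} (hs : Poly s)
    (hσ : ∀ i, Poly (σ i)) (x i : ℕ) :
    Poly fun v => Function.update (fun j => σ j v) x (s v) i := by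
  by_cases h : i = x
  · simpa only [h, Function.update_self] using hs
  · simpa only [Function.update_of_ne h] using hσ i

variable [IsRCA M]

open Classical in
theorem recFun_natCast_jumpColour {P : M.Num → M.Num → Prop} (hP : Bdd fun v => P (v 0) (v 1)) :
    RecFun fun v : ℕ → M.Num =>
      ((AdjacentHindman.jumpColour twoPart (Stage P) (v 0) (v 1) : ℕ) : M.Num) := by
  have hagree : Bdd fun v => AdjacentHindman.Agree twoPart (Stage P) (v 0) (v 1) :=
    .recBall (.twoPart (.var 0))
      (.iff (.stage hP (.var 1) (.var 0)) (.stage hP (.var 2) (.var 0)))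
  have hcode (i j : Fin 4) : RecFun fun v : ℕ → M.Num =>
      if AdjacentHindman.Agree twoPart (Stage P) (v 0) (v 1) then ((i : ℕ) : M.Num)
      else ((j : ℕ) : M.Num) := .ite hagree (.const _) (.const _)
  convert RecFun.ite (.recLt (.twoPart (.var 0)) (.twoPart (.var 1))) (hcode 0 1) (hcode 2 3)
    using 2 with v
  unfold AdjacentHindman.jumpColour
  split_ifs <;> rfl

namespace GapRamsey

theorem mem_sets (h : GapRamsey M) {P : M.Num → M.Num → Prop} (hP : Bdd fun v => P (v 0) (v 1)) :
    {x | ∃ y, P y x} ∈ M.Sets := by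
  obtain ⟨X, hX, hinf, i, hi⟩ := h 4
    (fun p q => (AdjacentHindman.jumpColour twoPart (Stage P) p q : ℕ))
    (recFun_natCast_jumpColour hP)
    fun p q => by exact_mod_cast (AdjacentHindman.jumpColour twoPart (Stage P) p q).isLt
  obtain ⟨a, ha, b, hb, c, hc, hab, hbc⟩ := exists_triple hinf
  exact mem_sets_of_gapHomogeneous hP hX hinf fun a' ha' b' hb' c' hc' hab' hbc' =>
    Fin.ext (Nat.cast_injective ((hi a' ha' b' hb' c' hc' hab' hbc').trans
      (hi a ha b hb c hc hab hbc).symm))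

theorem bdd_of_sigma1 (h : GapRamsey M) {P : (ℕ → M.Num) → Prop} (hP : Sigma1 P) : Bdd P := by
  obtain ⟨n, hn⟩ := hP.exists_dependsOn_Iio
  refine bdd_of_dependsOn_Iio (Γ := Sigma1) (fun P ⟨Q, hQ, hPQ⟩ => ?_) (fun P hP => hP.unpair) hP
    hn
  simp only [hPQ]
  exact h.mem_sets (hQ.subst (poly_cons (.var 0) fun _ => .var 1))

theorem bdd_sat (h : GapRamsey M) (w : ℕ → M.Sets) {φ : Formula} (hφ : φ.IsArithmetical) :
    Bdd fun v => M.Sat v w φ := by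
  induction φ with
  | eq s t => exact .eq (poly_eval s) (poly_eval t)
  | lt s t => exact .lt (poly_eval s) (poly_eval t)
  | mem t X => exact .mem (poly_eval t) (w X).2
  | neg φ ih => exact .not (ih hφ)
  | and φ ψ ih₁ ih₂ => exact .and (ih₁ hφ.1) (ih₂ hφ.2)
  | all x φ ih =>
    have hupdate : Bdd fun v => M.Sat (Function.update (fun i => v (i + 1)) x (v 0)) w φ :=
      (ih hφ).subst (poly_update (.var 0) (fun i => .var (i + 1)) x)
    refine (h.bdd_of_sigma1 (.ex (R := fun a v => ¬ M.Sat (Function.update v x a) w φ)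
      hupdate.not.sigma1)).not.of_iff fun v => ?_
    rw [sat_all, not_exists_not]
  | allSet X φ => exact hφ.elim

theorem models_comprehensionFor (h : GapRamsey M) {φ : Formula} (hφ : φ.IsArithmetical) {x X : ℕ}
    (hX : ¬ φ.SetFree X) : M.Models (comprehensionFor x X φ) := by
  intro v w
  rw [comprehensionFor, sat_exSet]
  refine ⟨⟨_, Model.mem_sets (P := fun a => M.Sat (Function.update v x a) w φ)
    ((h.bdd_sat w hφ).subst (poly_update (.var 0) (fun i => .const (v i)) x))⟩, fun a => ?_⟩
  rw [sat_iff, sat_mem, eval_var, Function.update_self, Function.update_self]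
  exact sat_congr_set _ fun Y hY =>
    (Function.update_of_ne (ne_of_mem_of_not_mem (s := {Y | φ.SetFree Y}) hY hX) _ _).symm

end GapRamsey

theorem models_inductionAxiom : M.Models inductionAxiom := by
  intro v w
  rw [inductionAxiom, sat_imp]
  rintro ⟨h₀, h₁⟩ a
  simp only [sat_all, sat_imp, sat_mem, eval_add, eval_var, eval_one, Function.update_self]
    at h₀ h₁ ⊢
  exact bdd_induction (P := fun a => a ∈ (w 0).1) (.mem (.var 0) (w 0).2) h₀ h₁ a

theorem GapRamsey.models_of_mem_ACA₀ (h : GapRamsey M) {φ : Formula} (hφ : φ ∈ ACA₀) :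
    M.Models φ := by
  rcases hφ with (hφ | rfl) | ⟨φ, x, X, harith, hX, rfl⟩
  · exact IsRCA.models φ (.inl (.inl hφ))
  · exact models_inductionAxiom
  · exact h.models_comprehensionFor harith hX

end Comprehension

end Model

open Model

theorem isRCA_of_models {M : Model.{u}} {T : Set Formula} (hT : RCA₀ ⊆ T)
    (h : ∀ ψ ∈ T, M.Models ψ) : M.IsRCA := ⟨fun ψ hψ => h ψ (hT hψ)⟩

theorem exists_sat_of_models {M : Model.{u}} {φ : Formula} (h : M.Models φ) : ∃ v w, M.Sat v w φ :=
  ⟨fun _ => 0, fun _ => ⟨_, M.sets_nonempty.choose_spec⟩, h _ _⟩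

theorem entails_of_AHT2 {φ : Formula} (hφ : φ ∈ ACA₀) : Entails.{u} (RCA₀ ∪ {AHT2}) φ := by
  intro M hM
  have := isRCA_of_models Set.subset_union_left hM
  obtain ⟨_, _, h⟩ := exists_sat_of_models (hM AHT2 (.inr rfl))
  exact (adjacentHindmanPrinciple_of_sat h).gapRamsey.models_of_mem_ACA₀ hφ

theorem entails_of_ZRT3 {φ : Formula} (hφ : φ ∈ ACA₀) : Entails.{u} (RCA₀ ∪ {ZRT3}) φ := by
  intro M hM
  have := isRCA_of_models Set.subset_union_left hM
  obtain ⟨_, _, h⟩ := exists_sat_of_models (hM ZRT3 (.inr rfl))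
  exact (translationRamsey_of_sat h).gapRamsey.models_of_mem_ACA₀ hφ

theorem entails_AHT2_iff_ZRT3 : Entails.{u} RCA₀ (Formula.iff AHT2 ZRT3) := by
  intro M hM v w
  have := isRCA_of_models subset_rfl hM
  rw [sat_iff]
  exact ⟨fun h => sat_of_translationRamsey
      (adjacentHindmanPrinciple_of_sat h).gapRamsey.translationRamsey v w,
    fun h => sat_of_adjacentHindmanPrinciple
      (translationRamsey_of_sat h).gapRamsey.adjacentHindmanPrinciple v w⟩

end SecondOrderArith

theorem theorem5 :
    (∃ c : ℕ → ℕ → Fin 4, Computable₂ c ∧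
      ∀ Y : Set ℕ, AdjacentHindman.IsSolution c Y →
        AdjacentHindman.Computes Y AdjacentHindman.haltingSet) ∧
    (∀ φ ∈ SecondOrderArith.ACA₀,
      SecondOrderArith.Entails.{u} (SecondOrderArith.RCA₀ ∪ {SecondOrderArith.AHT2}) φ) ∧
    (∀ φ ∈ SecondOrderArith.ACA₀,
      SecondOrderArith.Entails.{u} (SecondOrderArith.RCA₀ ∪ {SecondOrderArith.ZRT3}) φ) ∧
    SecondOrderArith.Entails.{u} SecondOrderArith.RCA₀
      (SecondOrderArith.Formula.iff SecondOrderArith.AHT2 SecondOrderArith.ZRT3) :=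
  ⟨AdjacentHindman.exists_colouring_computing_haltingSet,
    fun _ h => SecondOrderArith.entails_of_AHT2 h,
    fun _ h => SecondOrderArith.entails_of_ZRT3 h,
    SecondOrderArith.entails_AHT2_iff_ZRT3⟩
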